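/- **Plant.** Let $n,m\ge 1$, $q_1,q_2,b>0$, and let $d_1,d_2,p,\bar q_0,\dots,\bar q_{m-1},l_1,\dots,l_n\in\mathbb R$, $M\in\mathbb R^n$ be arbitrary and known. Let $A$ be the $n\times n$ companion matrix with ones on the superdiagonal, last row $(l_1,\dots,l_n)$ and zeros elsewhere, and $B=(0,\dots,0,b)^T$. Let $f_j:\mathbb R^j\to\mathbb R$, $j=1,\dots,m$, be of class $C^{m-j}$ with $f_j(0)=0$. Consider, for $x\in[0,1]$, $t\ge0$, $$\dot Y=AY+Bw(0,t),\quad z_t=-q_1z_x+d_1w,\quad w_t=q_2w_x+d_2z,\quad z(0,t)=p\,w(0,t),\quad w(1,t)=x_1(t),$$ $$\dot x_j=x_{j+1}+f_j(x_1,\dots,x_j)\ (1\le j<m),\qquad \dot x_m=f_m(x_1,\dots,x_m)+\sum_{i=0}^{m-1}\bar q_i\,\partial_t^iz(1,t)+M^TY+U(t),$$ with $Y=(y_1,\dots,y_n)^T$, $X=(x_1,\dots,x_m)^T$. **First transformation.** For gains $\kappa_1,\dots,\kappa_n>0$ put $g_0=0$, $z_i=y_i-g_{i-1}$, $g_i=-\kappa_iz_i+\sum_{j=1}^{i-1}\frac{\partial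 g_{i-1}}{\partial y_j}y_{j+1}$; each $g_i$ is a linear function of $y_1,\dots,y_i$. Let $K\in\mathbb R^n$ have the entries $K_j=\frac1b\big(-l_j+\frac{\partial g_{n-1}}{\partial y_{j-1}}+\kappa_n\frac{\partial g_{n-1}}{\partial y_j}-\kappa_n\delta_{jn}\big)$, where derivatives with respect to $y_0$ and $y_n$ are $0$. **Kernels.** On $0\le y\le x\le1$ let $F,H$ be the (smooth, unique, explicit) solution of $$q_2F_x-q_1F_y=d_2H,\quad q_2H_x+q_2H_y=d_1F,\quad F(x,x)=-\tfrac{d_2}{q_1+q_2},\quad H(x,0)=\tfrac{q_1}{q_2}pF(x,0).$$ Put $\lambda(x)=K^Te^{Ax/q_2}$, $L(x,y)=-\frac1{q_2}\lambda(x-y)B$, $\Psi(x,y)=F(x,y)+\int_y^xL(x,r)F(r,y)\,dr$, $\Phi(x,y)=H(x,y)-L(x,y)+\int_y^xL(x,r)H(r,y)\,dr$. Let $R_0=\Psi(1,\cdot)$, $P_0=\Phi(1,\cdot)$, $R_i=q_1R_{i-1}'+d_2P_{i-1}$, $P_i=-q_2P_{i-1}'+d_1R_{i-1}$, and for $0\le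 i\le m$ $$\Gamma^{(i)}(t)=\sum_{j=0}^{i-1}\Big[-q_1R_{i-1-j}(1)\partial_t^jz(1,t)+q_1R_{i-1-j}(0)\partial_t^jz(0,t)+q_2P_{i-1-j}(1)\partial_t^jw(1,t)-\big(q_2P_{i-1-j}(0)-\lambda(1)A^{i-1-j}B\big)\partial_t^jw(0,t)\Big]$$ $$\qquad+\int_0^1R_i(y)z(y,t)\,dy+\int_0^1P_i(y)w(y,t)\,dy+\lambda(1)A^iY(t).$$ These are $\Gamma=\Gamma^{(0)}$ and its time derivatives along the plant. **Controller.** For gains $c_1,\dots,c_m$ put $\tau_0=0$, $h_i=x_i-\tau_{i-1}-\Gamma^{(i-1)}$ and, for $1\le i\le m$, $$\tau_i=-c_ih_i-f_i(x_1,\dots,x_i)+\sum_{j=1}^{i-1}\Big[\frac{\partial\tau_{i-1}}{\partial x_j}(x_{j+1}+f_j)+\frac{\partial\tau_{i-1}}{\partial\Gamma^{(j-1)}}\Gamma^{(j)}\Big].$$ The control law is $U(t)=\tau_m-\sum_{i=0}^{m-1}\bar q_i\,\partial_t^iz(1,t)-M^TY(t)+\Gamma^{(m)}(t)$. **Initial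 data.** Let $z_0,w_0\in C^{m-1}([0,1])$, $X(0)\in\mathbb R^m$, $Y(0)\in\mathbb R^n$, put $\eta_0(x)=w_0(x)-\int_0^xF(x,y)z_0(y)\,dy-\int_0^xH(x,y)w_0(y)\,dy$, and let $\Pi(\varsigma)$ be the first entry of $e^{A\varsigma/q_2}Y(0)+\frac1{q_2}e^{A\varsigma/q_2}\int_0^\varsigma e^{-Ax/q_2}B\,\eta_0(x)\,dx$. Assume $y_1(0)\ge0$, $\Pi(\varsigma)\ge0$ for $0<\varsigma<1$, $\Pi(1)>0$, and $x_1(0)>\int_0^1\Psi(1,y)z_0(y)\,dy+\int_0^1\Phi(1,y)w_0(y)\,dy+\lambda(1)Y(0)$. **Gains.** Put $\bar Y=e^{A/q_2}Y(0)+\int_0^{1/q_2}e^{A(1/q_2-t)}B\,\eta_0(q_2t)\,dt$, which is $Y(1/q_2)$. Assume $\kappa_n>0$ and, for $1\le i\le n-1$, that $\kappa_i>0$ and $$\kappa_i>\frac{\sum_{j=1}^{i-1}\frac{\partial g_{i-1}}{\partial y_j}\bar Y_{j+1}-\bar Y_{i+1}}{\bar Y_i-g_{i-1}(\bar Y_1,\dots,\bar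 Y_{i-1})}.$$ Assume $c_m>1$ and, for $1\le i\le m-1$, $c_i>\max\{2,\check c_i\}$, where $\check c_i$ is the value at $t=0$ of $$\frac1{h_i}\Big[-x_{i+1}-f_i+\sum_{j=1}^{i-1}\Big(\frac{\partial\tau_{i-1}}{\partial x_j}(x_{j+1}+f_j)+\frac{\partial\tau_{i-1}}{\partial\Gamma^{(j-1)}}\Gamma^{(j)}\Big)+\Gamma^{(i)}\Big].$$ **Claim.** Let $(z,w,X,Y)$ be a solution of the closed loop on $[0,1]\times[0,\infty)$ with these initial data and $z,w\in C^{m-1}([0,1]\times[0,\infty))$ (for $m=1$ the transport equations are understood in integrated form along characteristics). Then: 1. $y_1(t)\ge0$ for all $t\ge0$. 2. There are $C$ and $\sigma>0$ with $\|w(\cdot,t)\|_{L^2(0,1)}^2+\|z(\cdot,t)\|_{L^2(0,1)}^2+|X(t)|^2+|Y(t)|^2\le Ce^{-\sigma t}$ for all $t\ge0$. 3. $\lim_{t\to\infty}U(t)=0$. If moreover $f_m(x)=O(|x|)$ as $x\to0$ (for example if $f_m$ is differentiable at $0$), then $|U(t)|\le Ce^{-\sigma t}$ for all $t\ge 0$,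 for some $C$ and $\sigma>0$. -/

import Mathlib

open Set Filter Topology

noncomputable section

/-- Data of the ODE - `2 × 2` hyperbolic PDE - ODE sandwich plant, with `n` states in the distal
linear ODE and `m` states in the actuator ODE. All indices are shifted to start at `0`: `l j` is
the coefficient `l_{j+1}`, `f k` is the nonlinearity `f_{k+1}`, a function of the first `k + 1`
actuator states (only `k < m` is used). -/
structure Plant (n m : ℕ) where
  q₁ : ℝ
  q₂ : ℝ
  d₁ : ℝ
  d₂ : ℝ
  p : ℝ
  b : ℝ
  l : Fin n → ℝ
  qbar : Fin m → ℝ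
  M : Fin n → ℝ
  f : (k : ℕ) → (Fin (k + 1) → ℝ) → ℝ

/-- The sequence that extends a vector by zeros. -/
def extendZero {m : ℕ} (X : Fin m → ℝ) (k : ℕ) : ℝ := if h : k < m then X ⟨k, h⟩ else 0

/-- The sum over `l, k ≥ 0` of `s ^ l * X ^ k / (k! * (l + k + r)!)`. It contains the functions
`I₀(2√X) = bessel 0 0 X`, `I₁(2√X) / √X = bessel 1 0 X`, and
`Π(s₁,s₂) = exp (s₁ + s₂) (1 - s₂ exp (-s₁) ∫₀¹ exp (-τ s₂) I₀(2√(τ s₁ s₂)) dτ)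
  = bessel 0 s₁ (s₁ s₂)` as entire functions, without any restriction on signs. -/
def bessel (r : ℕ) (s X : ℝ) : ℝ :=
  ∑' i : ℕ × ℕ, s ^ i.1 * X ^ i.2 / ((i.2.factorial : ℝ) * ((i.1 + i.2 + r).factorial : ℝ))

/-- Coefficients of the linear functions `g_i` of the first backstepping transformation
`z_i = y_i - g_{i-1}`, `g_0 = 0`, `g_i = - κ_i z_i + ∑_{j<i} (∂g_{i-1}/∂y_j) y_{j+1}`:
`gCoef κ i j` is `∂g_i / ∂y_{j+1}`, and `κ j` is the gain `κ_{j+1}`. -/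
def gCoef (κ : ℕ → ℝ) : ℕ → ℕ → ℝ
  | 0, _ => 0
  | i + 1, 0 => -κ i * ((if 0 = i then 1 else 0) - gCoef κ i 0)
  | i + 1, j + 1 => -κ i * ((if j + 1 = i then 1 else 0) - gCoef κ i (j + 1)) + gCoef κ i j

/-- `gShift κ i j` is the coefficient of `y_{j+1}` in `∑_k (∂g_i/∂y_k) y_{k+1}`. -/
def gShift (κ : ℕ → ℝ) (i : ℕ) : ℕ → ℝ
  | 0 => 0
  | j + 1 => gCoef κ i j

namespace Plant

variable {n m : ℕ} (P : Plant n m)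

/-- The companion matrix `A`. -/
def A : Matrix (Fin n) (Fin n) ℝ := fun i j =>
  if (i : ℕ) + 1 = n then P.l j else if (j : ℕ) = i + 1 then 1 else 0

/-- The column vector `B = (0, …, 0, b)`. -/
def B : Fin n → ℝ := fun i => if (i : ℕ) + 1 = n then P.b else 0

/-- The matrix exponential `exp (t A)`. -/
def expA (t : ℝ) : Matrix (Fin n) (Fin n) ℝ := NormedSpace.exp (t • P.A)

/-! ### Kernels -/

/-- The first characteristic coordinate `(x - y) / (q₁ + q₂)`. -/
def charU (x y : ℝ) : ℝ := (x - y) / (P.q₁ + P.q₂)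

/-- The second characteristic coordinate `(q₁ x + q₂ y) / (q₂ (q₁ + q₂))`. -/
def charV (x y : ℝ) : ℝ := (P.q₁ * x + P.q₂ * y) / (P.q₂ * (P.q₁ + P.q₂))

/-- `s₁ = (p q₁ d₂ / q₂) (x - y) / (q₁ + q₂)`. -/
def argS (x y : ℝ) : ℝ := P.q₁ / P.q₂ * P.p * P.d₂ * P.charU x y

/-- `d₁ d₂ (x - y) ((q₁ / q₂) x + y) / (q₁ + q₂) ^ 2`. -/
def argX (x y : ℝ) : ℝ := P.d₁ * P.d₂ * P.charU x y * P.charV x y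

/-- The explicit kernel `F`, which solves, together with `H`,
`q₂ F_x - q₁ F_y = d₂ H`, `q₂ H_x + q₂ H_y = d₁ F`, `F(x,x) = - d₂ / (q₁ + q₂)`,
`H(x,0) = (q₁ / q₂) p F(x,0)`. For `p ≠ 0` it equals
`-(p (q₁+q₂))⁻¹ [ (d₁ q₂ / (p q₁)) I₀ + √(d₁ d₂ (x-y) / ((q₁/q₂) x + y)) I₁
  + (p d₂ - d₁ q₂ / (p q₁)) Π ]`; this form has no division by `p`. -/
def F (x y : ℝ) : ℝ :=
  -(1 / (P.q₁ + P.q₂)) *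
    (P.d₂ * bessel 0 (P.argS x y) (P.argX x y)
      - P.q₁ / P.q₂ * P.d₁ * P.d₂ ^ 2 * P.charU x y ^ 2 * bessel 2 (P.argS x y) (P.argX x y))

/-- The explicit kernel `H`. For `p ≠ 0` it equals
`-(q₁+q₂)⁻¹ [ (d₁ / p) I₀ + √(d₁ d₂ ((q₁/q₂) x + y) / (x-y)) I₁ + (p d₂ q₁ / q₂ - d₁ / p) Π ]`. -/
def H (x y : ℝ) : ℝ :=
  -(1 / (P.q₁ + P.q₂)) *
    (P.d₁ * P.d₂ * P.charV x y * bessel 1 0 (P.argX x y)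
      + P.q₁ / P.q₂ * P.p * P.d₂ * bessel 0 (P.argS x y) (P.argX x y)
      - P.q₁ / P.q₂ * P.d₁ * P.d₂ * P.charU x y * bessel 1 (P.argS x y) (P.argX x y))

/-- The row vector `Kᵀ`. -/
def K (κ : ℕ → ℝ) : Fin n → ℝ := fun j =>
  1 / P.b * (-P.l j + gShift κ (n - 1) j + κ (n - 1) * gCoef κ (n - 1) j
    - if (j : ℕ) + 1 = n then κ (n - 1) else 0)

/-- `λ(x) = Kᵀ exp (A x / q₂)`. -/
def lam (κ : ℕ → ℝ) (x : ℝ) : Fin n → ℝ := Matrix.vecMul (P.K κ) (P.expA (x / P.q₂))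

/-- `L(x,y) = - λ(x - y) B / q₂`. -/
def L (κ : ℕ → ℝ) (x y : ℝ) : ℝ := -1 / P.q₂ * (P.lam κ (x - y) ⬝ᵥ P.B)

/-- The kernel `Ψ` of the transformation of the PDE state `w`. -/
def Psi (κ : ℕ → ℝ) (x y : ℝ) : ℝ := P.F x y + ∫ r in y..x, P.L κ x r * P.F r y

/-- The kernel `Φ` of the transformation of the PDE state `w`. -/
def Phi (κ : ℕ → ℝ) (x y : ℝ) : ℝ :=
  P.H x y - P.L κ x y + ∫ r in y..x, P.L κ x r * P.H r y

/-- The pair `(R_i, P_i)`: `R_0 = Ψ(1,·)`, `P_0 = Φ(1,·)`, `R_{i+1} = q₁ R_i' + d₂ P_i`,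
`P_{i+1} = - q₂ P_i' + d₁ R_i`. -/
def RP (κ : ℕ → ℝ) : ℕ → (ℝ → ℝ) × (ℝ → ℝ)
  | 0 => (fun y => P.Psi κ 1 y, fun y => P.Phi κ 1 y)
  | i + 1 =>
    (fun y => P.q₁ * deriv (RP κ i).1 y + P.d₂ * (RP κ i).2 y,
     fun y => -P.q₂ * deriv (RP κ i).2 y + P.d₁ * (RP κ i).1 y)

/-! ### The signal `Γ` and its time derivatives -/

/-- The `j`-th derivative of a signal on `[0, ∞)` (one-sided at `0`). -/
def timeDeriv (j : ℕ) (s : ℝ → ℝ) (t : ℝ) : ℝ := iteratedDerivWithin j s (Ici 0) t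

/-- `Γ(0)` in terms of the initial states. -/
def Gamma0 (κ : ℕ → ℝ) (z₀ w₀ : ℝ → ℝ) (Y₀ : Fin n → ℝ) : ℝ :=
  (∫ y in (0 : ℝ)..1, P.Psi κ 1 y * z₀ y) + (∫ y in (0 : ℝ)..1, P.Phi κ 1 y * w₀ y)
    + P.lam κ 1 ⬝ᵥ Y₀

/-- `Γ^{(i)}(t)`, expressed through the plant states. For `i = 0` the sums are empty and this is
`Γ(t) = ∫ Ψ(1,y) z(y,t) dy + ∫ Φ(1,y) w(y,t) dy + λ(1) Y(t)`. -/
def Gamma (κ : ℕ → ℝ) (z w : ℝ → ℝ → ℝ) (Y : ℝ → Fin n → ℝ) (i : ℕ) (t : ℝ) : ℝ :=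
  -(∑ j ∈ Finset.range i, P.q₁ * (P.RP κ (i - 1 - j)).1 1 * timeDeriv j (z 1) t)
  + (∑ j ∈ Finset.range i, P.q₁ * (P.RP κ (i - 1 - j)).1 0 * timeDeriv j (z 0) t)
  + (∫ y in (0 : ℝ)..1, (P.RP κ i).1 y * z y t)
  + (∑ j ∈ Finset.range i, P.q₂ * (P.RP κ (i - 1 - j)).2 1 * timeDeriv j (w 1) t)
  - (∑ j ∈ Finset.range i,
      (P.q₂ * (P.RP κ (i - 1 - j)).2 0 - P.lam κ 1 ⬝ᵥ ((P.A ^ (i - 1 - j)).mulVec P.B))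
        * timeDeriv j (w 0) t)
  + (∫ y in (0 : ℝ)..1, (P.RP κ i).2 y * w y t)
  + P.lam κ 1 ⬝ᵥ ((P.A ^ i).mulVec (Y t))

/-! ### Backstepping of the actuator ODE -/

/-- `f_{k+1}(x_1, …, x_{k+1})` for a sequence `x` with `x k = x_{k+1}`. -/
def fAt (k : ℕ) (x : ℕ → ℝ) : ℝ := P.f k (fun a => x a)

/-- `∑_{j=1}^{i} [ (∂τ/∂x_j) (x_{j+1} + f_j) + (∂τ/∂Γ^{(j-1)}) Γ^{(j)} ]`, where `x k = x_{k+1}` and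
`G k = Γ^{(k)}`. -/
def drift (τ : (ℕ → ℝ) → (ℕ → ℝ) → ℝ) (i : ℕ) (x G : ℕ → ℝ) : ℝ :=
  ∑ j ∈ Finset.range i,
    (deriv (fun s => τ (Function.update x j s) G) (x j) * (x (j + 1) + P.fAt j x)
      + deriv (fun s => τ x (Function.update G j s)) (G j) * G (j + 1))

/-- The functions `τ_i`: `τ_0 = 0` and `τ_i = - c_i h_i - f_i + ∑_{j<i} [ … ]`, where
`h_i = x_i - τ_{i-1} - Γ^{(i-1)}`; here `c k` is the gain `c_{k+1}`. -/
def tau (c : ℕ → ℝ) : ℕ → (ℕ → ℝ) → (ℕ → ℝ) → ℝ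
  | 0 => fun _ _ => 0
  | i + 1 => fun x G =>
      -c i * (x i - tau c i x G - G i) - P.fAt i x + P.drift (tau c i) i x G

/-- The nominal safe control law
`U = τ_m - ∑_i q̄_i z_t^{(i)}(1,t) - Mᵀ Y + Γ^{(m)}`. -/
def control (κ c : ℕ → ℝ) (z w : ℝ → ℝ → ℝ) (X : ℝ → Fin m → ℝ) (Y : ℝ → Fin n → ℝ)
    (t : ℝ) : ℝ :=
  P.tau c m (extendZero (X t)) (fun i => P.Gamma κ z w Y i t)
    - (∑ i : Fin m, P.qbar i * timeDeriv i (z 1) t) - P.M ⬝ᵥ Y t + P.Gamma κ z w Y m t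

/-! ### Solutions -/

/-- `(z, w, X, Y)` is a solution on `[0,1] × [0,∞)` of the plant with input `U` and the given
initial values, with PDE states of class `C^{m-1}`. Since for `m = 1` the PDE states are only
continuous, the transport equations `z_t = - q₁ z_x + d₁ w` and `w_t = q₂ w_x + d₂ z` are stated
in integrated form along their characteristics. -/
structure IsSolution (U : ℝ → ℝ) (z₀ w₀ : ℝ → ℝ) (X₀ : Fin m → ℝ) (Y₀ : Fin n → ℝ)
    (z w : ℝ → ℝ → ℝ) (X : ℝ → Fin m → ℝ) (Y : ℝ → Fin n → ℝ) : Prop where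
  z_reg : ContDiffOn ℝ ((m - 1 : ℕ) : ℕ∞) (fun a : ℝ × ℝ => z a.1 a.2) (Icc 0 1 ×ˢ Ici 0)
  w_reg : ContDiffOn ℝ ((m - 1 : ℕ) : ℕ∞) (fun a : ℝ × ℝ => w a.1 a.2) (Icc 0 1 ×ˢ Ici 0)
  z_init : ∀ x ∈ Icc (0 : ℝ) 1, z x 0 = z₀ x
  w_init : ∀ x ∈ Icc (0 : ℝ) 1, w x 0 = w₀ x
  X_init : X 0 = X₀
  Y_init : Y 0 = Y₀
  ode_Y : ∀ t, 0 ≤ t →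
    HasDerivWithinAt Y (P.A.mulVec (Y t) + w 0 t • P.B) (Ici 0) t
  pde_z : ∀ x t s, 0 ≤ x → 0 ≤ t → 0 ≤ s → x + P.q₁ * s ≤ 1 →
    z (x + P.q₁ * s) (t + s) =
      z x t + ∫ r in (0 : ℝ)..s, P.d₁ * w (x + P.q₁ * r) (t + r)
  pde_w : ∀ x t s, x ≤ 1 → 0 ≤ t → 0 ≤ s → 0 ≤ x - P.q₂ * s →
    w (x - P.q₂ * s) (t + s) =
      w x t + ∫ r in (0 : ℝ)..s, P.d₂ * z (x - P.q₂ * r) (t + r)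
  bc_zero : ∀ t, 0 ≤ t → z 0 t = P.p * w 0 t
  bc_one : ∀ t, 0 ≤ t → w 1 t = extendZero (X t) 0
  ode_X : ∀ j : Fin m, (j : ℕ) + 1 < m → ∀ t, 0 ≤ t →
    HasDerivWithinAt (fun s => X s j)
      (extendZero (X t) (j + 1) + P.fAt j (extendZero (X t))) (Ici 0) t
  ode_X_last : ∀ j : Fin m, (j : ℕ) + 1 = m → ∀ t, 0 ≤ t →
    HasDerivWithinAt (fun s => X s j)
      (P.fAt j (extendZero (X t)) + (∑ i : Fin m, P.qbar i * timeDeriv i (z 1) t)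
        + P.M ⬝ᵥ Y t + U t) (Ici 0) t

/-! ### Conditions on the initial values and on the design parameters -/

/-- `w(x,0) - ∫₀ˣ F(x,y) z(y,0) dy - ∫₀ˣ H(x,y) w(y,0) dy`. -/
def eta0 (z₀ w₀ : ℝ → ℝ) (x : ℝ) : ℝ :=
  w₀ x - (∫ y in (0 : ℝ)..x, P.F x y * z₀ y) - ∫ y in (0 : ℝ)..x, P.H x y * w₀ y

/-- The vector `exp (A ς/q₂) Y(0) + (1/q₂) exp (A ς/q₂) ∫₀^ς exp (-A x/q₂) B η₀(x) dx`, whose first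
entry is `Π(ς)`. -/
def PiVec (z₀ w₀ : ℝ → ℝ) (Y₀ : Fin n → ℝ) (ς : ℝ) : Fin n → ℝ :=
  (P.expA (ς / P.q₂)).mulVec Y₀ + (1 / P.q₂) • (P.expA (ς / P.q₂)).mulVec
    (∫ x in (0 : ℝ)..ς, (P.expA (-(x / P.q₂))).mulVec (P.eta0 z₀ w₀ x • P.B))

/-- `Y(1/q₂)`, expressed through the initial values of `z`, `w` and `Y`. -/
def YArrival (z₀ w₀ : ℝ → ℝ) (Y₀ : Fin n → ℝ) : Fin n → ℝ :=
  (P.expA (1 / P.q₂)).mulVec Y₀ + ∫ t in (0 : ℝ)..(1 / P.q₂),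
    (P.expA (1 / P.q₂ - t)).mulVec (P.eta0 z₀ w₀ (P.q₂ * t) • P.B)

/-- The lower bound `κ̌_{i+1}` of the gain `κ_{i+1}`, `i + 1 ≤ n - 1`. -/
def kappaCheck (κ : ℕ → ℝ) (z₀ w₀ : ℝ → ℝ) (Y₀ : Fin n → ℝ) (i : ℕ) : ℝ :=
  ((∑ j : Fin n, gShift κ i j * P.YArrival z₀ w₀ Y₀ j)
      - extendZero (P.YArrival z₀ w₀ Y₀) (i + 1)) /
    (extendZero (P.YArrival z₀ w₀ Y₀) i - ∑ j : Fin n, gCoef κ i j * P.YArrival z₀ w₀ Y₀ j)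

/-- The lower bound `č_{i+1}` of the gain `c_{i+1}`, `i + 1 ≤ m - 1`, where `x k = x_{k+1}(0)` and
`G k = Γ^{(k)}(0)`. -/
def cCheck (c : ℕ → ℝ) (x G : ℕ → ℝ) (i : ℕ) : ℝ :=
  1 / (x i - P.tau c i x G - G i) *
    (-x (i + 1) - P.fAt i x + P.drift (P.tau c i) i x G + G (i + 1))

end Plant

end

/-!
The controller is a backstepping design in three layers, and the proof follows the signal from the
actuator to the distal end.

*Actuator.* `Γ = Γ⁽⁰⁾` is a linear functional of `(z, w, Y)`, and `Γ⁽ⁱ⁺¹⁾` is the time derivative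
of `Γ⁽ⁱ⁾` (`Plant.TransportPair.hasDerivWithinAt_Gamma`). This makes the errors `h_i = x_i -
τ_{i-1} - Γ⁽ⁱ⁻¹⁾` an autonomous chain `h_i' = -c_i h_i + h_{i+1}`, `h_m' = -c_m h_m`
(`Plant.IsSolution.hasDerivWithinAt_loopError`). The gain conditions make all `h_i(0)` positive,
so every `h_i` stays nonnegative and decays exponentially.

*Transport.* The kernels `F`, `H` turn `w` into a state `η` that is constant along the
characteristics of the leftward transport (`Plant.TransportPair.eta_transport`). The kernel
equations are checked on power series: in characteristic coordinates they are index shifts of the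
coefficients of double exponential generating functions (`Plant.coefF_succ`, `Plant.coefH_succ`).
Hence `w(0, t + x / q₂) = η(x, t)`, so that variation of constants predicts `Y` over one transport
delay. As `Γ` is the predicted value of `K Y` plus the terms that separate `w(1,·)` from `η(1,·)`,
this gives the identity `w(0, t + 1/q₂) = K Y(t + 1/q₂) + h_1(t)`
(`Plant.TransportPair.w_zero_eq_feedback`).

*Distal ODE.* After time `1/q₂` the errors `y_{i+1} - g_i(y)` therefore form a second stable
chain, driven by `b h_1 ≥ 0`, and the conditions on the `κ_i` make them positive at time `1/q₂`.
Hence `y_1 ≥ 0` afterwards; before, `y_1` is given by `Π`, which is nonnegative by assumption.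

*Decay.* From time `1/q₂` on, `Y` and the delayed errors `h` solve a linear system with `w(0,·)`
as an output, so `w(0,·)` and all its time derivatives decay exponentially. The time derivatives
of `(z, w)` solve the same transport equations, and read as an evolution in `x` these spread the
decay from `x = 0` to `[0,1]` (`Plant.TransportPair.bound_of_boundary`). So all `Γ⁽ⁱ⁾`, `i ≤ m`,
decay, and the `x_i` follow by induction along the chain. Every `τ_i` with `i < m` is
differentiable and vanishes at the origin, but `τ_m` contains `f_m`, which may be only continuous:
this is why the exponential decay of the input needs `f_m(x) = O(|x|)`.
-/

noncomputable section

/-! ### Leibniz rules along characteristics -/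

/-- Leibniz rule for an integral with moving endpoints. -/
theorem hasDerivAt_integral_moving {g g' : ℝ → ℝ → ℝ} (hg : Continuous (Function.uncurry g))
    (hg' : Continuous (Function.uncurry g'))
    (hd : ∀ y s, HasDerivAt (fun s => g y s) (g' y s) s)
    {a b : ℝ → ℝ} {a' b' s : ℝ} (ha : HasDerivAt a a' s) (hb : HasDerivAt b b' s) :
    HasDerivAt (fun s => ∫ y in (a s)..(b s), g y s)
      (b' * g (b s) s - a' * g (a s) s + ∫ y in (a s)..(b s), g' y s) s := by
  have hgs : ∀ s, Continuous (fun y => g y s) := fun s =>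
      hg.comp (by fun_prop : Continuous fun y => (y, s))
  have hgs' : ∀ s, Continuous (fun y => g' y s) := fun s =>
      hg'.comp (by fun_prop : Continuous fun y => (y, s))
  -- the primitive `(c, s) ↦ ∫₀ᶜ g y s dy` has continuous partial derivatives
  have hpart : ∀ c s, HasDerivAt (fun s => ∫ y in (0:ℝ)..c, g y s) (∫ y in (0:ℝ)..c, g' y s) s := by
    intro c s
    obtain ⟨M, hM⟩ := (isCompact_uIcc.prod (isCompact_closedBall s 1)).exists_bound_of_continuousOn
      (f := Function.uncurry g') (s := uIcc 0 c ×ˢ Metric.closedBall s 1) hg'.continuousOn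
    refine (intervalIntegral.hasDerivAt_integral_of_dominated_loc_of_deriv_le
        (μ := MeasureTheory.volume)
      (F := fun s y => g y s) (F' := fun s y => g' y s) (bound := fun _ => M)
      (Metric.closedBall_mem_nhds s one_pos) ?_ ?_ ?_ ?_ ?_ ?_).2
    · exact Eventually.of_forall fun x => (hgs x).aestronglyMeasurable
    · exact (hgs s).intervalIntegrable _ _
    · exact (hgs' s).aestronglyMeasurable
    · exact Eventually.of_forall fun y hy x hx => hM (y, x) ⟨uIoc_subset_uIcc hy, hx⟩
    · exact intervalIntegrable_const
    · exact Eventually.of_forall fun y _ x _ => hd y x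
  have key : ∀ c s, HasStrictFDerivAt (Function.uncurry fun c s => ∫ y in (0:ℝ)..c, g y s)
      ((ContinuousLinearMap.toSpanSingleton ℝ (g c s)).coprod
        (ContinuousLinearMap.toSpanSingleton ℝ (∫ y in (0:ℝ)..c, g' y s))) (c, s) := by
    intro c s
    refine hasStrictFDerivAt_uncurry_coprod (𝕜 := ℝ) (u := (c, s))
      (f := fun c s => ∫ y in (0:ℝ)..c, g y s)
      (f₁ := fun c s => ContinuousLinearMap.toSpanSingleton ℝ (g c s))
      (f₂ := fun c s => ContinuousLinearMap.toSpanSingleton ℝ (∫ y in (0:ℝ)..c, g' y s)) ?_ ?_ ?_ ?_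
    · refine Eventually.of_forall fun v => ?_
      exact (intervalIntegral.integral_hasDerivAt_right ((hgs v.2).intervalIntegrable _ _)
        ((hgs v.2).stronglyMeasurableAtFilter _ _) (hgs v.2).continuousAt).hasFDerivAt
    · exact Eventually.of_forall fun v => (hpart v.1 v.2).hasFDerivAt
    · refine Continuous.continuousAt ?_
      exact (ContinuousLinearMap.toSpanSingletonCLE (𝕜 := ℝ) (E := ℝ)).continuous.comp hg
    · refine Continuous.continuousAt ?_
      refine (ContinuousLinearMap.toSpanSingletonCLE (𝕜 := ℝ) (E := ℝ)).continuous.comp ?_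
      refine intervalIntegral.continuous_parametric_intervalIntegral_of_continuous (X := ℝ × ℝ)
        (f := fun v y => g' y v.2)
            (hg'.comp (by fun_prop : Continuous fun v : (ℝ × ℝ) × ℝ => (v.2, v.1.2)))
        continuous_fst
  have hB := (key (b s) s).hasFDerivAt.comp_hasDerivAt (f := fun s => (b s, s)) s
    (hb.prodMk (hasDerivAt_id s))
  have hA := (key (a s) s).hasFDerivAt.comp_hasDerivAt (f := fun s => (a s, s)) s
    (ha.prodMk (hasDerivAt_id s))
  refine ((hB.sub hA).congr_of_eventuallyEq (Eventually.of_forall fun x => ?_)).congr_deriv ?_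
  · simp only [Function.comp_apply, Function.uncurry, Pi.sub_apply]
    rw [intervalIntegral.integral_interval_sub_left ((hgs x).intervalIntegrable _ _)
      ((hgs x).intervalIntegrable _ _)]
  · rw [← intervalIntegral.integral_interval_sub_left ((hgs' s).intervalIntegrable 0 (b s))
      ((hgs' s).intervalIntegrable 0 (a s))]
    simp
    ring

/-- Leibniz rule for the integral of a weakly transported density `Z` (with velocity `q` and source
`S`) against a kernel `k`, both of which need to be differentiable only along the characteristics
`y = ξ + q s`. -/
theorem hasDerivAt_integral_transport {Z S k k' : ℝ → ℝ → ℝ} {q : ℝ}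
    (hZ : Continuous (Function.uncurry Z)) (hS : Continuous (Function.uncurry S))
    (hk : Continuous (Function.uncurry k)) (hk' : Continuous (Function.uncurry k'))
    (hdZ : ∀ ξ s, HasDerivAt (fun s => Z (ξ + q * s) s) (S (ξ + q * s) s) s)
    (hdk : ∀ ξ s, HasDerivAt (fun s => k (ξ + q * s) s) (k' (ξ + q * s) s) s)
    {a b : ℝ → ℝ} {a' b' s : ℝ} (ha : HasDerivAt a a' s) (hb : HasDerivAt b b' s) :
    HasDerivAt (fun s => ∫ y in (a s)..(b s), k y s * Z y s)
      ((b' - q) * (k (b s) s * Z (b s) s) - (a' - q) * (k (a s) s * Z (a s) s)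
        + ∫ y in (a s)..(b s), (k' y s * Z y s + k y s * S y s)) s := by
  have hc : Continuous fun v : ℝ × ℝ => (v.1 + q * v.2, v.2) := by fun_prop
  have hZ' := hZ.comp hc
  have hS' := hS.comp hc
  have hk1 := hk.comp hc
  have hk2 := hk'.comp hc
  have hq : HasDerivAt (fun s : ℝ => q * s) q s := by
    simpa using (hasDerivAt_id s).const_mul q
  have h := hasDerivAt_integral_moving
    (g := fun ξ s => k (ξ + q * s) s * Z (ξ + q * s) s)
    (g' := fun ξ s => k' (ξ + q * s) s * Z (ξ + q * s) s + k (ξ + q * s) s * S (ξ + q * s) s)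
    (hk1.mul hZ') ((hk2.mul hZ').add (hk1.mul hS')) (fun ξ s => (hdk ξ s).mul (hdZ ξ s))
    (ha.sub hq) (hb.sub hq)
  refine (h.congr_of_eventuallyEq (Eventually.of_forall fun x => ?_)).congr_deriv ?_
  · simp only [Pi.sub_apply]
    rw [intervalIntegral.integral_comp_add_right (fun y => k y x * Z y x)]
    simp
  · simp only [Pi.sub_apply]
    rw [intervalIntegral.integral_comp_add_right
      (fun y => k' y s * Z y s + k y s * S y s)]
    simp

/-- A solution of the transport equation `z_t + q z_x = src` on `[0,1] × [0,∞)`, in integrated form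
along the characteristics, extends to a continuous function on the plane that is differentiable
along every characteristic line. The source is extended by clamping its arguments. -/
theorem exists_transport_extension {q : ℝ} (hq : 0 < q) {z src : ℝ → ℝ → ℝ}
    (hz : ContinuousOn (Function.uncurry z) (Icc 0 1 ×ˢ Ici 0))
    (hsrc : ContinuousOn (Function.uncurry src) (Icc 0 1 ×ˢ Ici 0))
    (hpde : ∀ x t s, 0 ≤ x → 0 ≤ t → 0 ≤ s → x + q * s ≤ 1 →
      z (x + q * s) (t + s) = z x t + ∫ r in (0 : ℝ)..s, src (x + q * r) (t + r)) :
    ∃ Z S : ℝ → ℝ → ℝ, Continuous (Function.uncurry Z) ∧ Continuous (Function.uncurry S) ∧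
      (∀ x ∈ Icc (0 : ℝ) 1, ∀ t, 0 ≤ t → Z x t = z x t ∧ S x t = src x t) ∧
      ∀ ξ s, HasDerivAt (fun s => Z (ξ + q * s) s) (S (ξ + q * s) s) s := by
  set cl : ℝ → ℝ := fun x => max 0 (min 1 x) with hcl
  have hcl_mem : ∀ x, cl x ∈ Icc (0 : ℝ) 1 := fun x =>
    ⟨le_max_left _ _, max_le zero_le_one (min_le_left _ _)⟩
  have hcl_id : ∀ x ∈ Icc (0 : ℝ) 1, cl x = x := fun x hx => by
    simp only [hcl, min_eq_right hx.2, max_eq_right hx.1]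
  have hcl_cont : Continuous cl := by fun_prop
  set S : ℝ → ℝ → ℝ := fun x t => src (cl x) (max 0 t) with hSdef
  have hS : Continuous (Function.uncurry S) := by
    refine hsrc.comp_continuous (f := fun v : ℝ × ℝ => (cl v.1, max 0 v.2)) (by fun_prop)
      fun v => ⟨hcl_mem _, mem_Ici.2 (le_max_left _ _)⟩
  have hSeq : ∀ x ∈ Icc (0 : ℝ) 1, ∀ t, 0 ≤ t → S x t = src x t := fun x hx t ht => by
    simp only [hSdef, hcl_id x hx, max_eq_right ht]
  -- `en ξ` is the time at which the characteristic `x = ξ + q t` enters the domain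
  set en : ℝ → ℝ := fun ξ => max 0 (-ξ / q) with hen
  have hen_cont : Continuous en := by fun_prop
  set J : ℝ → ℝ → ℝ := fun ξ t => ∫ r in (0:ℝ)..t, S (ξ + q * r) r with hJ
  have hSc : ∀ ξ, Continuous fun r => S (ξ + q * r) r := fun ξ =>
    hS.comp (by fun_prop : Continuous fun r : ℝ => (ξ + q * r, r))
  have hJc : Continuous (Function.uncurry J) :=
    intervalIntegral.continuous_parametric_intervalIntegral_of_continuous (X := ℝ × ℝ)
      (f := fun v r => S (v.1 + q * r) r)
      (hS.comp (by fun_prop : Continuous fun v : (ℝ × ℝ) × ℝ => (v.1.1 + q * v.2, v.2)))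
      continuous_snd
  set z1 : ℝ → ℝ := fun ξ => z (cl ξ) (en ξ) with hz1
  have hz1c : Continuous z1 :=
    hz.comp_continuous (f := fun v : ℝ => (cl v, en v)) (by fun_prop)
      fun v => ⟨hcl_mem _, mem_Ici.2 (le_max_left _ _)⟩
  refine ⟨fun x t => z1 (x - q * t) + J (x - q * t) t - J (x - q * t) (en (x - q * t)), S, ?_, hS,
    ?_, ?_⟩
  · have h1 : Continuous fun v : ℝ × ℝ => z1 (v.1 - q * v.2) := by fun_prop
    have h2 : Continuous fun v : ℝ × ℝ => J (v.1 - q * v.2) v.2 :=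
      hJc.comp (by fun_prop : Continuous fun v : ℝ × ℝ => (v.1 - q * v.2, v.2))
    have h3 : Continuous fun v : ℝ × ℝ => J (v.1 - q * v.2) (en (v.1 - q * v.2)) :=
      hJc.comp (by fun_prop : Continuous fun v : ℝ × ℝ => (v.1 - q * v.2, en (v.1 - q * v.2)))
    exact (h1.add h2).sub h3
  · intro x hx t ht
    refine ⟨?_, hSeq x hx t ht⟩
    have hJsub : J (x - q * t) t - J (x - q * t) (en (x - q * t)) =
        ∫ r in (en (x - q * t))..t, S (x - q * t + q * r) r := by
      simp only [hJ]
      exact intervalIntegral.integral_interval_sub_left ((hSc _).intervalIntegrable _ _)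
        ((hSc _).intervalIntegrable _ _)
    beta_reduce
    rw [add_sub_assoc, hJsub]
    rcases le_total 0 (x - q * t) with h | h
    · have he : en (x - q * t) = 0 := by
        simp only [hen]
        exact max_eq_left (div_nonpos_of_nonpos_of_nonneg (by linarith) hq.le)
      have hxm : x - q * t ∈ Icc (0:ℝ) 1 := ⟨h, by have := mul_nonneg hq.le ht; linarith [hx.2]⟩
      have := hpde (x - q * t) 0 t h le_rfl ht (by linarith [hx.2])
      simp only [hz1, he, hcl_id _ hxm]
      rw [show x - q * t + q * t = x by ring, zero_add] at this
      rw [this]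
      congr 1
      refine intervalIntegral.integral_congr fun r hr => ?_
      rw [uIcc_of_le ht] at hr
      have := mul_nonneg hq.le hr.1
      have := mul_le_mul_of_nonneg_left hr.2 hq.le
      simp only [zero_add]
      exact hSeq _ ⟨by linarith, by linarith [hx.2]⟩ _ hr.1
    · have he : en (x - q * t) = t - x / q := by
        simp only [hen]
        rw [max_eq_right (div_nonneg (by linarith) hq.le)]
        field_simp; ring
      have hxq : 0 ≤ x / q := div_nonneg hx.1 hq.le
      have he0 : 0 ≤ t - x / q := by rw [← he]; exact le_max_left _ _
      have hcl0 : cl (x - q * t) = 0 := by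
        simp only [hcl]
        exact max_eq_left ((min_le_right _ _).trans h)
      have := hpde 0 (t - x / q) (x / q) le_rfl he0 hxq (by
        rw [mul_div_cancel₀ _ hq.ne']; linarith [hx.2])
      simp only [hz1, he, hcl0]
      rw [mul_div_cancel₀ _ hq.ne', zero_add, sub_add_cancel] at this
      rw [this]
      congr 1
      have hsub := intervalIntegral.integral_comp_add_right (a := 0) (b := x / q)
        (fun r => S (x - q * t + q * r) r) (t - x / q)
      rw [zero_add, add_sub_cancel] at hsub
      rw [← hsub]
      refine intervalIntegral.integral_congr fun r hr => ?_
      rw [uIcc_of_le hxq] at hr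
      have h0 := mul_nonneg hq.le hr.1
      have h1 := mul_le_mul_of_nonneg_left hr.2 hq.le
      rw [mul_div_cancel₀ _ hq.ne'] at h1
      simp only [zero_add]
      have e1 : x - q * t + q * (r + (t - x / q)) = q * r := by field_simp; ring
      rw [e1, add_comm r]
      exact hSeq _ ⟨h0, by linarith [hx.2]⟩ _ (by linarith [hr.1])
  · intro ξ s
    have : (fun s => z1 (ξ + q * s - q * s) + J (ξ + q * s - q * s) s
        - J (ξ + q * s - q * s) (en (ξ + q * s - q * s))) =
        fun s => z1 ξ + J ξ s - J ξ (en ξ) := by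
      funext s; simp
    simp only [this]
    have hJd : HasDerivAt (J ξ) (S (ξ + q * s) s) s :=
      intervalIntegral.integral_hasDerivAt_right ((hSc ξ).intervalIntegrable _ _)
        ((hSc ξ).stronglyMeasurableAtFilter _ _) (hSc ξ).continuousAt
    exact (hJd.const_add (z1 ξ)).sub_const _

/-! ### Double exponential generating functions -/

/-- The exponential generating function `∑ α N k * u ^ N / N! * v ^ k / k!` of a double sequence. -/
def egf (α : ℕ → ℕ → ℝ) (u v : ℝ) : ℝ :=
  ∑' i : ℕ × ℕ, α i.1 i.2 * (u ^ i.1 / (i.1.factorial : ℝ)) * (v ^ i.2 / (i.2.factorial : ℝ))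

/-- Double sequences with at most geometric growth; their generating functions are entire. -/
def GeomBounded (α : ℕ → ℕ → ℝ) : Prop :=
  ∃ C D : ℝ, 0 ≤ C ∧ 1 ≤ D ∧ ∀ N k, |α N k| ≤ C * D ^ (N + k)

theorem GeomBounded.add {α β : ℕ → ℕ → ℝ} (hα : GeomBounded α) (hβ : GeomBounded β) :
    GeomBounded (fun N k => α N k + β N k) := by
  obtain ⟨C, D, hC, hD, h⟩ := hα
  obtain ⟨C', D', hC', hD', h'⟩ := hβ
  refine ⟨C + C', max D D', by positivity, le_max_of_le_left hD, fun N k => ?_⟩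
  have h1 : D ^ (N + k) ≤ max D D' ^ (N + k) := pow_le_pow_left₀ (by linarith) (le_max_left _ _) _
  have h2 : D' ^ (N + k) ≤ max D D' ^ (N + k) := pow_le_pow_left₀ (by linarith) (le_max_right _ _) _
  calc |α N k + β N k| ≤ |α N k| + |β N k| := abs_add_le _ _
    _ ≤ C * D ^ (N + k) + C' * D' ^ (N + k) := add_le_add (h N k) (h' N k)
    _ ≤ C * max D D' ^ (N + k) + C' * max D D' ^ (N + k) := by gcongr
    _ = _ := by ring

theorem GeomBounded.const_mul {α : ℕ → ℕ → ℝ} (hα : GeomBounded α) (r : ℝ) :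
    GeomBounded (fun N k => r * α N k) := by
  obtain ⟨C, D, hC, hD, h⟩ := hα
  refine ⟨|r| * C, D, by positivity, hD, fun N k => ?_⟩
  rw [abs_mul, mul_assoc]
  exact mul_le_mul_of_nonneg_left (h N k) (abs_nonneg _)

theorem GeomBounded.swap {α : ℕ → ℕ → ℝ} (hα : GeomBounded α) : GeomBounded (fun N k => α k N) := by
  obtain ⟨C, D, hC, hD, h⟩ := hα
  exact ⟨C, D, hC, hD, fun N k => by rw [add_comm]; exact h k N⟩

theorem GeomBounded.shift {α : ℕ → ℕ → ℝ} (hα : GeomBounded α) :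
    GeomBounded (fun N k => α (N + 1) k) := by
  obtain ⟨C, D, hC, hD, h⟩ := hα
  refine ⟨C * D, D, by positivity, hD, fun N k => (h (N + 1) k).trans (le_of_eq ?_)⟩
  ring

theorem egf_swap (α : ℕ → ℕ → ℝ) (u v : ℝ) : egf (fun N k => α k N) v u = egf α u v := by
  unfold egf
  rw [← (Equiv.prodComm ℕ ℕ).tsum_eq]
  refine tsum_congr fun i => ?_
  simp only [Equiv.prodComm_apply, Prod.fst_swap, Prod.snd_swap]
  ring

/-- The dominating double series of an exponential generating function. -/
theorem summable_egf_bound (C D R : ℝ) :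
    Summable fun i : ℕ × ℕ => C * D ^ (i.1 + i.2) * (R ^ i.1 / (i.1.factorial : ℝ))
      * (R ^ i.2 / (i.2.factorial : ℝ)) := by
  have h : Summable fun i : ℕ × ℕ => ‖((D * R) ^ i.1 / (i.1.factorial : ℝ))
      * ((D * R) ^ i.2 / (i.2.factorial : ℝ))‖ :=
    Summable.mul_norm (f := fun N : ℕ => (D * R) ^ N / (N.factorial : ℝ))
      (g := fun N : ℕ => (D * R) ^ N / (N.factorial : ℝ))
      (Real.summable_pow_div_factorial (D * R)).norm
      (Real.summable_pow_div_factorial (D * R)).norm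
  have h' : Summable fun i : ℕ × ℕ => ((D * R) ^ i.1 / (i.1.factorial : ℝ))
      * ((D * R) ^ i.2 / (i.2.factorial : ℝ)) := h.of_norm
  refine (h'.mul_left C).congr fun i => ?_
  rw [mul_pow, mul_pow, pow_add]
  ring

theorem egf_term_le {α : ℕ → ℕ → ℝ} {C D R u v : ℝ} (hC : 0 ≤ C) (hD : 1 ≤ D)
    (h : ∀ N k, |α N k| ≤ C * D ^ (N + k)) (hu : |u| ≤ R) (hv : |v| ≤ R) (N k : ℕ) :
    ‖α N k * (u ^ N / (N.factorial : ℝ)) * (v ^ k / (k.factorial : ℝ))‖ ≤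
      C * D ^ (N + k) * (R ^ N / (N.factorial : ℝ)) * (R ^ k / (k.factorial : ℝ)) := by
  rw [norm_mul, norm_mul, norm_div, norm_div, norm_pow, norm_pow]
  simp only [Real.norm_eq_abs, Nat.abs_cast]
  have := h N k
  have hD0 : 0 ≤ D := by linarith
  have hR : 0 ≤ R := (abs_nonneg u).trans hu
  gcongr

theorem summable_egf {α : ℕ → ℕ → ℝ} (hα : GeomBounded α) (u v : ℝ) :
    Summable fun i : ℕ × ℕ => α i.1 i.2 * (u ^ i.1 / (i.1.factorial : ℝ))
      * (v ^ i.2 / (i.2.factorial : ℝ)) := by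
  obtain ⟨C, D, hC, hD, h⟩ := hα
  exact Summable.of_norm_bounded (summable_egf_bound C D (max |u| |v|))
    fun i => egf_term_le hC hD h (le_max_left _ _) (le_max_right _ _) i.1 i.2

theorem egf_add {α β : ℕ → ℕ → ℝ} (hα : GeomBounded α) (hβ : GeomBounded β) (u v : ℝ) :
    egf (fun N k => α N k + β N k) u v = egf α u v + egf β u v := by
  unfold egf
  rw [← (summable_egf hα u v).tsum_add (summable_egf hβ u v)]
  exact tsum_congr fun i => by ring

theorem egf_const_mul (α : ℕ → ℕ → ℝ) (r u v : ℝ) :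
    egf (fun N k => r * α N k) u v = r * egf α u v := by
  unfold egf
  rw [← tsum_mul_left]
  exact tsum_congr fun i => by ring

theorem continuous_egf {α : ℕ → ℕ → ℝ} (hα : GeomBounded α) :
    Continuous (Function.uncurry (egf α)) := by
  obtain ⟨C, D, hC, hD, h⟩ := hα
  refine continuous_iff_continuousAt.2 fun p => ?_
  have hcont : ContinuousOn (Function.uncurry (egf α)) (Metric.ball 0 (‖p‖ + 1)) := by
    refine continuousOn_tsum (u := fun i : ℕ × ℕ => C * D ^ (i.1 + i.2) *
      ((‖p‖ + 1) ^ i.1 / (i.1.factorial : ℝ)) * ((‖p‖ + 1) ^ i.2 / (i.2.factorial : ℝ)))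
      (fun i => ?_) (summable_egf_bound _ _ _) fun i x hx => ?_
    · fun_prop
    · have hx' : ‖x‖ ≤ ‖p‖ + 1 := by simpa using (mem_ball_zero_iff.1 hx).le
      exact egf_term_le hC hD h ((norm_fst_le x).trans hx') ((norm_snd_le x).trans hx') i.1 i.2
  exact hcont.continuousAt (Metric.isOpen_ball.mem_nhds (by simp))

/-- Differentiation in the first variable shifts the coefficients. -/
theorem hasDerivAt_egf_left {α : ℕ → ℕ → ℝ} (hα : GeomBounded α) (u v : ℝ) :
    HasDerivAt (fun u => egf α u v) (egf (fun N k => α (N + 1) k) u v) u := by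
  obtain ⟨C, D, hC, hD, h⟩ := hα
  set R := max |u| |v| + 1 with hR
  have hR0 : 0 ≤ R := by positivity
  have hinj : Function.Injective fun i : ℕ × ℕ => (i.1 + 1, i.2) := fun i j hij => by
    simp only [Prod.mk.injEq, Nat.add_right_cancel_iff] at hij
    exact Prod.ext hij.1 hij.2
  -- the terms outside the range of the index shift have the factor `N = 0`
  have hrange : ∀ i : ℕ × ℕ, i ∉ range (fun i : ℕ × ℕ => (i.1 + 1, i.2)) → i.1 = 0 := by
    rintro ⟨N, k⟩ hi
    by_contra h0
    exact hi ⟨(N - 1, k), by simp only [Prod.mk.injEq, and_true]; simp only at h0; omega⟩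
  have hfac : ∀ (N : ℕ) (x : ℝ), ((N + 1 : ℕ) : ℝ) * x ^ N / ((N + 1).factorial : ℝ)
      = x ^ N / (N.factorial : ℝ) := fun N x => by
    rw [Nat.factorial_succ]
    push_cast
    have : ((N : ℝ) + 1) ≠ 0 := by positivity
    field_simp
  have hsum : Summable fun i : ℕ × ℕ => C * D ^ (i.1 + i.2) *
      (i.1 * R ^ (i.1 - 1) / (i.1.factorial : ℝ)) * (R ^ i.2 / (i.2.factorial : ℝ)) := by
    refine (hinj.summable_iff fun i hi => by simp [hrange i hi]).1 ?_
    refine (summable_egf_bound (C * D) D R).congr fun i => ?_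
    simp only [Function.comp_apply, Nat.add_sub_cancel]
    rw [hfac, show i.1 + 1 + i.2 = (i.1 + i.2) + 1 by ring, pow_succ]
    ring
  have key := hasDerivAt_tsum_of_isPreconnected (𝕜 := ℝ)
      (u := fun i : ℕ × ℕ => C * D ^ (i.1 + i.2) *
      (i.1 * R ^ (i.1 - 1) / (i.1.factorial : ℝ)) * (R ^ i.2 / (i.2.factorial : ℝ)))
    (g := fun (i : ℕ × ℕ) u => α i.1 i.2 * (u ^ i.1 / (i.1.factorial : ℝ)) *
      (v ^ i.2 / (i.2.factorial : ℝ)))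
    (g' := fun (i : ℕ × ℕ) u => α i.1 i.2 * (i.1 * u ^ (i.1 - 1) / (i.1.factorial : ℝ)) *
      (v ^ i.2 / (i.2.factorial : ℝ)))
    (t := Metric.ball 0 R) (y₀ := u) (y := u) hsum Metric.isOpen_ball
    (convex_ball _ _).isPreconnected ?_ ?_ ?_ ?_ ?_
  · refine key.congr_deriv ?_
    unfold egf
    rw [← hinj.tsum_eq]
    · refine tsum_congr fun i => ?_
      simp only [Nat.add_sub_cancel]
      rw [hfac]
    · intro i hi
      by_contra hcon
      exact hi (by simp [hrange i hcon])
  · intro i x _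
    exact (((hasDerivAt_pow i.1 x).div_const _).const_mul _).mul_const _
  · intro i x hx
    have hx' : |x| ≤ R := by simpa using (mem_ball_zero_iff.1 hx).le
    have hv' : |v| ≤ R := (le_max_right _ _).trans (by linarith)
    rw [norm_mul, norm_mul, norm_div, norm_div, norm_mul, norm_pow, norm_pow]
    simp only [Real.norm_eq_abs, Nat.abs_cast]
    have := h i.1 i.2
    gcongr
  · simp only [mem_ball_zero_iff, Real.norm_eq_abs, hR]
    linarith [le_max_left |u| |v|]
  · exact summable_egf ⟨C, D, hC, hD, h⟩ u v
  · simp only [mem_ball_zero_iff, Real.norm_eq_abs, hR]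
    linarith [le_max_left |u| |v|]

theorem hasDerivAt_egf_right {α : ℕ → ℕ → ℝ} (hα : GeomBounded α) (u v : ℝ) :
    HasDerivAt (fun v => egf α u v) (egf (fun N k => α N (k + 1)) u v) v := by
  have := hasDerivAt_egf_left hα.swap v u
  simp only [egf_swap α] at this
  rwa [egf_swap (fun N k => α N (k + 1)) u v] at this

theorem contDiff_egf {α : ℕ → ℕ → ℝ} (hα : GeomBounded α) (n : ℕ) :
    ContDiff ℝ n (Function.uncurry (egf α)) := by
  induction n generalizing α with
  | zero => exact contDiff_zero.2 (continuous_egf hα)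
  | succ n ih =>
    have hα2 : GeomBounded (fun N k => α N (k + 1)) := hα.swap.shift.swap
    push_cast
    refine contDiff_succ_iff_hasFDerivAt.2 ⟨fun p =>
      Function.uncurry (egf fun N k => α (N + 1) k) p • ContinuousLinearMap.fst ℝ ℝ ℝ
        + Function.uncurry (egf fun N k => α N (k + 1)) p • ContinuousLinearMap.snd ℝ ℝ ℝ,
      ((ih hα.shift).smul contDiff_const).add ((ih hα2).smul contDiff_const), fun p => ?_⟩
    have hcl := (ContinuousLinearMap.toSpanSingletonCLE (𝕜 := ℝ) (E := ℝ)).continuous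
    have := (hasStrictFDerivAt_uncurry_coprod (𝕜 := ℝ) (u := p) (f := egf α)
      (f₁ := fun u v => ContinuousLinearMap.toSpanSingleton ℝ (egf (fun N k => α (N + 1) k) u v))
      (f₂ := fun u v => ContinuousLinearMap.toSpanSingleton ℝ (egf (fun N k => α N (k + 1)) u v))
      (Eventually.of_forall fun w => (hasDerivAt_egf_left hα w.1 w.2).hasFDerivAt)
      (Eventually.of_forall fun w => (hasDerivAt_egf_right hα w.1 w.2).hasFDerivAt)
      (hcl.comp (continuous_egf hα.shift)).continuousAt
      (hcl.comp (continuous_egf hα2)).continuousAt).hasFDerivAt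
    refine this.congr_fderiv ?_
    ext
    · simp [Function.uncurry, Function.HasUncurry.uncurry]
    · simp [Function.uncurry, Function.HasUncurry.uncurry]

/-! ### The backstepping kernels -/

/-- The coefficients of `u ^ r * bessel r (a * u) (c * u * v)`. -/
def besselCoef (a c : ℝ) (r N k : ℕ) : ℝ := if k + r ≤ N then a ^ (N - r - k) * c ^ k else 0

theorem geomBounded_besselCoef (a c : ℝ) (r : ℕ) : GeomBounded (besselCoef a c r) := by
  refine ⟨1, 1 + |a| + |c|, zero_le_one, by linarith [abs_nonneg a, abs_nonneg c], fun N k => ?_⟩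
  have ha := abs_nonneg a
  have hc := abs_nonneg c
  unfold besselCoef
  split_ifs with h
  · rw [abs_mul, abs_pow, abs_pow, pow_add, one_mul]
    have h1 : |a| ^ (N - r - k) ≤ (1 + |a| + |c|) ^ N :=
      (pow_le_pow_left₀ ha (by linarith) _).trans (pow_le_pow_right₀ (by linarith) (by omega))
    have h2 : |c| ^ k ≤ (1 + |a| + |c|) ^ k := pow_le_pow_left₀ hc (by linarith) _
    gcongr
  · rw [abs_zero]; positivity

theorem egf_besselCoef (a c : ℝ) (r : ℕ) (u v : ℝ) :
    egf (besselCoef a c r) u v = u ^ r * bessel r (a * u) (c * u * v) := by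
  have hinj : Function.Injective fun i : ℕ × ℕ => (i.1 + i.2 + r, i.2) := fun i j hij => by
    simp only [Prod.mk.injEq] at hij
    exact Prod.ext (by omega) hij.2
  unfold egf bessel
  rw [← tsum_mul_left, ← hinj.tsum_eq]
  · refine tsum_congr fun i => ?_
    simp only [besselCoef]
    rw [if_pos (by omega), show i.1 + i.2 + r - r - i.2 = i.1 by omega]
    simp only [mul_pow, pow_add]
    field_simp
  · rintro ⟨N, k⟩ hi
    by_contra hcon
    refine hi ?_
    simp only [besselCoef]
    rw [if_neg, zero_mul, zero_mul]
    intro hle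
    exact hcon ⟨(N - r - k, k), by simp only [Prod.mk.injEq, and_true]; omega⟩

theorem besselCoef_eq_add (a c : ℝ) (r N k : ℕ) :
    besselCoef a c r N k = besselCoef 0 c r N k + a * besselCoef a c (r + 1) N k := by
  unfold besselCoef
  rcases lt_trichotomy (k + r) N with h | h | h
  · rw [if_pos h.le, if_pos h.le, if_pos (by omega),
      show N - r - k = (N - (r + 1) - k) + 1 by omega, zero_pow (by omega)]
    ring
  · rw [if_pos h.le, if_pos h.le, if_neg (by omega), show N - r - k = 0 by omega]
    simp
  · rw [if_neg (by omega), if_neg (by omega), if_neg (by omega)]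
    simp

/-- Splitting off the terms with `l = 0`; the others are an index shift. -/
theorem bessel_eq_add (r : ℕ) (s X : ℝ) :
    bessel r s X = bessel r 0 X + s * bessel (r + 1) s X := by
  have h : egf (besselCoef s X r) 1 1
      = egf (fun N k => besselCoef 0 X r N k + s * besselCoef s X (r + 1) N k) 1 1 := by
    congr 1; funext N k; exact besselCoef_eq_add s X r N k
  rw [egf_add (geomBounded_besselCoef 0 X r) ((geomBounded_besselCoef s X (r + 1)).const_mul s),
    egf_const_mul] at h
  simpa [egf_besselCoef] using h

theorem bessel_zero_zero_zero : bessel 0 0 0 = 1 := by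
  unfold bessel
  rw [tsum_eq_single ((0, 0) : ℕ × ℕ)]
  · simp
  · rintro ⟨l, k⟩ h
    rcases Nat.eq_zero_or_pos l with rfl | hl
    · rcases Nat.eq_zero_or_pos k with rfl | hk
      · exact absurd rfl h
      · simp [hk.ne']
    · simp [hl.ne']

namespace Plant

variable {n m : ℕ} (P : Plant n m)

/-- The coefficients of `F` as a function of the characteristic coordinates. -/
def coefF (N k : ℕ) : ℝ :=
  -(1 / (P.q₁ + P.q₂)) * P.d₂ * besselCoef (P.q₁ / P.q₂ * P.p * P.d₂) (P.d₁ * P.d₂) 0 N k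
  + 1 / (P.q₁ + P.q₂) * (P.q₁ / P.q₂ * P.d₁ * P.d₂ ^ 2)
    * besselCoef (P.q₁ / P.q₂ * P.p * P.d₂) (P.d₁ * P.d₂) 2 N k

/-- The coefficients of `H` as a function of the characteristic coordinates. -/
def coefH (N k : ℕ) : ℝ :=
  -(1 / (P.q₁ + P.q₂)) * (P.d₁ * P.d₂) * besselCoef 0 (P.d₁ * P.d₂) 1 k N
  + (-(1 / (P.q₁ + P.q₂)) * (P.q₁ / P.q₂ * P.p * P.d₂)
      * besselCoef (P.q₁ / P.q₂ * P.p * P.d₂) (P.d₁ * P.d₂) 0 N k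
  + 1 / (P.q₁ + P.q₂) * (P.q₁ / P.q₂ * P.d₁ * P.d₂)
      * besselCoef (P.q₁ / P.q₂ * P.p * P.d₂) (P.d₁ * P.d₂) 1 N k)

theorem geomBounded_coefF : GeomBounded P.coefF :=
  ((geomBounded_besselCoef _ _ _).const_mul _).add ((geomBounded_besselCoef _ _ _).const_mul _)

theorem geomBounded_coefH : GeomBounded P.coefH :=
  ((geomBounded_besselCoef _ _ _).swap.const_mul _).add
    (((geomBounded_besselCoef _ _ _).const_mul _).add ((geomBounded_besselCoef _ _ _).const_mul _))

/-- The first kernel equation, `∂F/∂U = d₂ H` in the characteristic coordinates `U`, `V`. -/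
theorem coefF_succ (N k : ℕ) : P.coefF (N + 1) k = P.d₂ * P.coefH N k := by
  have h2 : ∀ a c : ℝ, besselCoef a c 2 (N + 1) k = besselCoef a c 1 N k := fun a c => by
    unfold besselCoef
    simp only [show k + 2 ≤ N + 1 ↔ k + 1 ≤ N by omega, show N + 1 - 2 = N - 1 by omega]
  have h0 : ∀ a c : ℝ, besselCoef a c 0 (N + 1) k
      = c * besselCoef 0 c 1 k N + a * besselCoef a c 0 N k := fun a c => by
    unfold besselCoef
    rcases lt_trichotomy k (N + 1) with h | h | h
    · rw [if_pos (by omega), if_neg (by omega), if_pos (by omega),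
        show N + 1 - 0 - k = (N - 0 - k) + 1 by omega]
      ring
    · subst h
      simp [pow_succ]
      ring
    · rw [if_neg (by omega), if_pos (by omega), if_neg (by omega), zero_pow (by omega)]
      ring
  unfold coefF coefH
  rw [h2, h0]
  ring

/-- The second kernel equation, `∂H/∂V = d₁ F` in the characteristic coordinates `U`, `V`. -/
theorem coefH_succ (N k : ℕ) : P.coefH N (k + 1) = P.d₁ * P.coefF N k := by
  have h1 : ∀ (a c : ℝ) (r : ℕ), besselCoef a c r N (k + 1) = c * besselCoef a c (r + 1) N k :=
    fun a c r => by
      unfold besselCoef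
      simp only [show k + 1 + r ≤ N ↔ k + (r + 1) ≤ N by omega,
        show N - r - (k + 1) = N - (r + 1) - k by omega]
      split_ifs <;> ring
  have h2 : ∀ c : ℝ, besselCoef 0 c 1 (k + 1) N = besselCoef 0 c 0 N k := fun c => by
    unfold besselCoef
    rcases lt_trichotomy k N with h | h | h
    · rw [if_neg (by omega), if_pos (by omega), zero_pow (by omega), zero_mul]
    · subst h; simp
    · rw [if_pos (by omega), if_neg (by omega), zero_pow (by omega), zero_mul]
  have h3 := besselCoef_eq_add (P.q₁ / P.q₂ * P.p * P.d₂) (P.d₁ * P.d₂) 0 N k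
  unfold coefF coefH
  rw [h1, h1, h2, h3]
  ring

theorem F_eq_egf (x y : ℝ) : P.F x y = egf P.coefF (P.charU x y) (P.charV x y) := by
  unfold coefF
  rw [egf_add ((geomBounded_besselCoef _ _ _).const_mul _)
    ((geomBounded_besselCoef _ _ _).const_mul _), egf_const_mul, egf_const_mul,
    egf_besselCoef, egf_besselCoef]
  unfold F argS argX
  ring

theorem H_eq_egf (x y : ℝ) : P.H x y = egf P.coefH (P.charU x y) (P.charV x y) := by
  unfold coefH
  rw [egf_add ((geomBounded_besselCoef _ _ _).swap.const_mul _)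
    (((geomBounded_besselCoef _ _ _).const_mul _).add ((geomBounded_besselCoef _ _ _).const_mul _)),
    egf_add ((geomBounded_besselCoef _ _ _).const_mul _)
    ((geomBounded_besselCoef _ _ _).const_mul _), egf_const_mul, egf_const_mul, egf_const_mul,
    egf_swap (besselCoef 0 (P.d₁ * P.d₂) 1), egf_besselCoef, egf_besselCoef, egf_besselCoef]
  unfold H argS argX
  rw [zero_mul, mul_right_comm (P.d₁ * P.d₂) (P.charV x y) (P.charU x y)]
  ring

theorem contDiff_F : ContDiff ℝ (⊤ : ℕ∞) (Function.uncurry P.F) := by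
  refine contDiff_infty.2 fun k => ?_
  have : Function.uncurry P.F = Function.uncurry (egf P.coefF) ∘
      fun v : ℝ × ℝ => (P.charU v.1 v.2, P.charV v.1 v.2) := by
    funext v; exact P.F_eq_egf v.1 v.2
  rw [this]
  refine (contDiff_egf P.geomBounded_coefF k).comp ?_
  unfold charU charV
  fun_prop

theorem contDiff_H : ContDiff ℝ (⊤ : ℕ∞) (Function.uncurry P.H) := by
  refine contDiff_infty.2 fun k => ?_
  have : Function.uncurry P.H = Function.uncurry (egf P.coefH) ∘
      fun v : ℝ × ℝ => (P.charU v.1 v.2, P.charV v.1 v.2) := by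
    funext v; exact P.H_eq_egf v.1 v.2
  rw [this]
  refine (contDiff_egf P.geomBounded_coefH k).comp ?_
  unfold charU charV
  fun_prop

/-- The kernel equation `q₂ F_x - q₁ F_y = d₂ H`, along its characteristics. -/
theorem hasDerivAt_F (hq : P.q₁ + P.q₂ ≠ 0) (hq₂ : P.q₂ ≠ 0) (x y s : ℝ) :
    HasDerivAt (fun s => P.F (x - P.q₂ * s) (y + P.q₁ * s))
      (-(P.d₂ * P.H (x - P.q₂ * s) (y + P.q₁ * s))) s := by
  have hU : ∀ s, P.charU (x - P.q₂ * s) (y + P.q₁ * s) = P.charU x y - s := fun s => by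
    unfold charU; field_simp; ring
  have hV : ∀ s, P.charV (x - P.q₂ * s) (y + P.q₁ * s) = P.charV x y := fun s => by
    unfold charV; field_simp; ring
  simp only [F_eq_egf, H_eq_egf, hU, hV]
  have h := (hasDerivAt_egf_left P.geomBounded_coefF (P.charU x y - s) (P.charV x y)).comp_const_sub
    (P.charU x y) s
  refine h.congr_deriv ?_
  simp only [coefF_succ, egf_const_mul]

/-- The kernel equation `q₂ H_x + q₂ H_y = d₁ F`, along its characteristics. -/
theorem hasDerivAt_H (hq : P.q₁ + P.q₂ ≠ 0) (hq₂ : P.q₂ ≠ 0) (x y s : ℝ) :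
    HasDerivAt (fun s => P.H (x - P.q₂ * s) (y - P.q₂ * s))
      (-(P.d₁ * P.F (x - P.q₂ * s) (y - P.q₂ * s))) s := by
  have hU : ∀ s, P.charU (x - P.q₂ * s) (y - P.q₂ * s) = P.charU x y := fun s => by
    unfold charU; field_simp; ring
  have hV : ∀ s, P.charV (x - P.q₂ * s) (y - P.q₂ * s) = P.charV x y - s := fun s => by
    unfold charV; field_simp; ring
  simp only [F_eq_egf, H_eq_egf, hU, hV]
  have h := (hasDerivAt_egf_right P.geomBounded_coefH (P.charU x y)
      (P.charV x y - s)).comp_const_sub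
    (P.charV x y) s
  refine h.congr_deriv ?_
  simp only [coefH_succ, egf_const_mul]

theorem F_diag (x : ℝ) : P.F x x = -(P.d₂ / (P.q₁ + P.q₂)) := by
  unfold F argS argX charU
  simp [bessel_zero_zero_zero]
  ring

theorem H_zero (x : ℝ) : P.H x 0 = P.q₁ / P.q₂ * P.p * P.F x 0 := by
  have hV : P.charV x 0 = P.q₁ / P.q₂ * P.charU x 0 := by
    unfold charU charV; rw [mul_zero, add_zero, sub_zero, mul_div_mul_comm]
  unfold H F
  rw [bessel_eq_add 1 (P.argS x 0), hV]
  unfold argS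
  ring

end Plant

/-! ### Smoothness of the controller kernels -/

theorem contDiff_integral_lower {g : ℝ → ℝ → ℝ} (hg : ContDiff ℝ (⊤ : ℕ∞) (Function.uncurry g))
    (b : ℝ) :
    ContDiff ℝ (⊤ : ℕ∞) (fun y => ∫ r in y..b, g r y) := by
  refine contDiff_infty.2 fun k => ?_
  induction k generalizing g with
  | zero =>
    refine contDiff_zero.2 ?_
    have : (fun y => ∫ r in y..b, g r y) = fun y => -∫ r in b..y, g r y := by
      funext y; rw [intervalIntegral.integral_symm]
    rw [this]
    exact (intervalIntegral.continuous_parametric_intervalIntegral_of_continuous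
      (f := fun y r => g r y) (hg.continuous.comp continuous_swap) continuous_id).neg
  | succ k ih =>
    set g2 : ℝ → ℝ → ℝ := fun r y => fderiv ℝ (Function.uncurry g) (r, y) (0, 1) with hg2
    have hg2s : ContDiff ℝ (⊤ : ℕ∞) (Function.uncurry g2) :=
      (hg.fderiv_right (m := (⊤ : ℕ∞)) (by simp)).clm_apply contDiff_const
    have hder : ∀ y, HasDerivAt (fun y => ∫ r in y..b, g r y)
        (-g y y + ∫ r in y..b, g2 r y) y := fun y => by
      have := hasDerivAt_integral_moving (s := y) hg.continuous hg2s.continuous (fun r s => ?_)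
        (hasDerivAt_id y) (hasDerivAt_const y b)
      · refine this.congr_deriv ?_
        simp
      · exact (hg.differentiable (by simp) (r, s)).hasFDerivAt.comp_hasDerivAt s
          ((hasDerivAt_const s r).prodMk (hasDerivAt_id s))
    push_cast
    refine contDiff_succ_iff_deriv.2 ⟨fun y => (hder y).differentiableAt, by simp, ?_⟩
    rw [show deriv (fun y => ∫ r in y..b, g r y) = fun y => -g y y + ∫ r in y..b, g2 r y from
      funext fun y => (hder y).deriv]
    refine ContDiff.add ?_ (ih hg2s)
    exact ((hg.of_le (by exact_mod_cast le_top)).comp (contDiff_id.prodMk contDiff_id)).neg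

namespace Plant

variable {n m : ℕ} (P : Plant n m)

open Matrix

theorem expA_zero : P.expA 0 = 1 := by
  unfold expA; rw [zero_smul]; exact NormedSpace.exp_zero

theorem expA_add (s t : ℝ) : P.expA (s + t) = P.expA s * P.expA t := by
  unfold expA
  rw [add_smul]
  exact Matrix.exp_add_of_commute _ _ (((Commute.refl P.A).smul_left s).smul_right t)

section

-- any Banach algebra norm on the matrices serves to differentiate the exponential
attribute [local instance] Matrix.linftyOpNormedRing Matrix.linftyOpNormedAlgebra

theorem hasDerivAt_expA_mulVec (v : Fin n → ℝ) (t : ℝ) :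
    HasDerivAt (fun t => P.expA t *ᵥ v) (P.A *ᵥ (P.expA t *ᵥ v)) t := by
  have h : HasDerivAt (fun t : ℝ => NormedSpace.exp (t • P.A))
      (P.A * NormedSpace.exp (t • P.A)) t :=
    hasDerivAt_exp_smul_const' P.A t
  let φ : Matrix (Fin n) (Fin n) ℝ →ₗ[ℝ] (Fin n → ℝ) :=
    { toFun := fun M => M *ᵥ v
      map_add' := fun M N => Matrix.add_mulVec M N v
      map_smul' := fun r M => Matrix.smul_mulVec r M v }
  have := (LinearMap.toContinuousLinearMap φ).hasFDerivAt.comp_hasDerivAt t h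
  refine this.congr_deriv ?_
  change (P.A * NormedSpace.exp (t • P.A)) *ᵥ v = _
  rw [← Matrix.mulVec_mulVec]
  rfl

end

theorem expA_mulVec_comm (v : Fin n → ℝ) (t : ℝ) :
    P.expA t *ᵥ (P.A *ᵥ v) = P.A *ᵥ (P.expA t *ᵥ v) := by
  have : Commute P.A (P.expA t) := by
    unfold expA
    exact ((Commute.refl P.A).smul_right t).exp_right
  rw [Matrix.mulVec_mulVec, Matrix.mulVec_mulVec, this.eq]

theorem contDiff_expA_mulVec (v : Fin n → ℝ) : ContDiff ℝ (⊤ : ℕ∞) (fun t => P.expA t *ᵥ v) := by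
  refine contDiff_infty.2 fun k => ?_
  induction k generalizing v with
  | zero =>
    exact contDiff_zero.2 (continuous_iff_continuousAt.2 fun t =>
      (P.hasDerivAt_expA_mulVec v t).continuousAt)
  | succ k ih =>
    push_cast
    refine contDiff_succ_iff_deriv.2
      ⟨fun t => (P.hasDerivAt_expA_mulVec v t).differentiableAt, by simp, ?_⟩
    rw [show deriv (fun t => P.expA t *ᵥ v) = fun t => P.expA t *ᵥ (P.A *ᵥ v) from
      funext fun t => by rw [(P.hasDerivAt_expA_mulVec v t).deriv, expA_mulVec_comm]]
    exact ih _

variable (κ : ℕ → ℝ)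

theorem lam_dotProduct (x : ℝ) (v : Fin n → ℝ) :
    P.lam κ x ⬝ᵥ v = P.K κ ⬝ᵥ (P.expA (x / P.q₂) *ᵥ v) := by
  unfold lam; rw [Matrix.dotProduct_mulVec]

theorem contDiff_dotProduct_left (w : Fin n → ℝ) {k : WithTop ℕ∞} :
    ContDiff ℝ k (fun v : Fin n → ℝ => w ⬝ᵥ v) := by
  unfold dotProduct; fun_prop

theorem contDiff_L : ContDiff ℝ (⊤ : ℕ∞) (Function.uncurry (P.L κ)) := by
  have : Function.uncurry (P.L κ) =
      fun v : ℝ × ℝ => -1 / P.q₂ * (P.K κ ⬝ᵥ (P.expA ((v.1 - v.2) / P.q₂) *ᵥ P.B)) := by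
    funext v; simp only [Function.uncurry, L, lam_dotProduct]
  rw [this]
  refine contDiff_const.mul ((contDiff_dotProduct_left _).comp
    ((P.contDiff_expA_mulVec P.B).comp ?_))
  fun_prop

theorem contDiff_Psi_one : ContDiff ℝ (⊤ : ℕ∞) (fun y => P.Psi κ 1 y) := by
  have hF : ContDiff ℝ (⊤ : ℕ∞) (fun y => P.F 1 y) :=
    P.contDiff_F.comp (f := fun y : ℝ => ((1 : ℝ), y)) (by fun_prop)
  have hL : ContDiff ℝ (⊤ : ℕ∞) (fun v : ℝ × ℝ => P.L κ 1 v.1) :=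
    (P.contDiff_L κ).comp (f := fun v : ℝ × ℝ => ((1 : ℝ), v.1)) (by fun_prop)
  exact hF.add (contDiff_integral_lower (g := fun r y => P.L κ 1 r * P.F r y)
    (hL.mul P.contDiff_F) 1)

theorem contDiff_Phi_one : ContDiff ℝ (⊤ : ℕ∞) (fun y => P.Phi κ 1 y) := by
  have hH : ContDiff ℝ (⊤ : ℕ∞) (fun y => P.H 1 y) :=
    P.contDiff_H.comp (f := fun y : ℝ => ((1 : ℝ), y)) (by fun_prop)
  have hL1 : ContDiff ℝ (⊤ : ℕ∞) (fun y => P.L κ 1 y) :=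
    (P.contDiff_L κ).comp (f := fun y : ℝ => ((1 : ℝ), y)) (by fun_prop)
  have hL : ContDiff ℝ (⊤ : ℕ∞) (fun v : ℝ × ℝ => P.L κ 1 v.1) :=
    (P.contDiff_L κ).comp (f := fun v : ℝ × ℝ => ((1 : ℝ), v.1)) (by fun_prop)
  exact (hH.sub hL1).add (contDiff_integral_lower (g := fun r y => P.L κ 1 r * P.H r y)
    (hL.mul P.contDiff_H) 1)

theorem contDiff_RP (i : ℕ) :
    ContDiff ℝ (⊤ : ℕ∞) (P.RP κ i).1 ∧ ContDiff ℝ (⊤ : ℕ∞) (P.RP κ i).2 := by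
  induction i with
  | zero => exact ⟨P.contDiff_Psi_one κ, P.contDiff_Phi_one κ⟩
  | succ i ih =>
    have h1 := (contDiff_infty_iff_deriv.1 ih.1).2
    have h2 := (contDiff_infty_iff_deriv.1 ih.2).2
    exact ⟨(contDiff_const.mul h1).add (contDiff_const.mul ih.2),
      (contDiff_const.mul h2).add (contDiff_const.mul ih.1)⟩

/-! ### The transport subsystem -/

/-- A continuous solution `(z, w)` on `[0,1] × [0,∞)` of the transport equations, in integrated
form along characteristics, and of the boundary condition at `x = 0`. -/
structure TransportPair (z w : ℝ → ℝ → ℝ) : Prop where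
  z_cont : ContinuousOn (Function.uncurry z) (Icc 0 1 ×ˢ Ici 0)
  w_cont : ContinuousOn (Function.uncurry w) (Icc 0 1 ×ˢ Ici 0)
  pde_z : ∀ x t s, 0 ≤ x → 0 ≤ t → 0 ≤ s → x + P.q₁ * s ≤ 1 →
    z (x + P.q₁ * s) (t + s) =
      z x t + ∫ r in (0 : ℝ)..s, P.d₁ * w (x + P.q₁ * r) (t + r)
  pde_w : ∀ x t s, x ≤ 1 → 0 ≤ t → 0 ≤ s → 0 ≤ x - P.q₂ * s →
    w (x - P.q₂ * s) (t + s) =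
      w x t + ∫ r in (0 : ℝ)..s, P.d₂ * z (x - P.q₂ * r) (t + r)
  bc_zero : ∀ t, 0 ≤ t → z 0 t = P.p * w 0 t

/-- Continuous extensions `Z`, `W` of the transport states to the plane, differentiable along all
characteristics with derivatives `S`, `T`. -/
structure TransportExtension (z w Z S W T : ℝ → ℝ → ℝ) : Prop where
  Z_cont : Continuous (Function.uncurry Z)
  S_cont : Continuous (Function.uncurry S)
  W_cont : Continuous (Function.uncurry W)
  T_cont : Continuous (Function.uncurry T)
  Z_eq : ∀ x ∈ Icc (0 : ℝ) 1, ∀ t, 0 ≤ t → Z x t = z x t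
  S_eq : ∀ x ∈ Icc (0 : ℝ) 1, ∀ t, 0 ≤ t → S x t = P.d₁ * w x t
  W_eq : ∀ x ∈ Icc (0 : ℝ) 1, ∀ t, 0 ≤ t → W x t = w x t
  T_eq : ∀ x ∈ Icc (0 : ℝ) 1, ∀ t, 0 ≤ t → T x t = P.d₂ * z x t
  Z_deriv : ∀ ξ s, HasDerivAt (fun s => Z (ξ + P.q₁ * s) s) (S (ξ + P.q₁ * s) s) s
  W_deriv : ∀ ξ s, HasDerivAt (fun s => W (ξ + -P.q₂ * s) s) (T (ξ + -P.q₂ * s) s) s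

variable {P} {z w : ℝ → ℝ → ℝ}

theorem TransportPair.exists_extension (h : P.TransportPair z w) (hq₁ : 0 < P.q₁) (hq₂ : 0 < P.q₂) :
    ∃ Z S W T, P.TransportExtension z w Z S W T := by
  obtain ⟨Z, S, hZ, hS, hZS, hZd⟩ := exists_transport_extension hq₁ (src := fun x t => P.d₁ * w x t)
    h.z_cont (continuousOn_const.mul h.w_cont) h.pde_z
  -- the leftward transport is the reflection `x ↦ 1 - x` of a rightward one
  have hrefl : ContinuousOn (fun v : ℝ × ℝ => (1 - v.1, v.2)) (Icc 0 1 ×ˢ Ici 0) := by fun_prop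
  have hmaps : MapsTo (fun v : ℝ × ℝ => (1 - v.1, v.2)) (Icc 0 1 ×ˢ Ici 0) (Icc 0 1 ×ˢ Ici 0) :=
    fun v hv => ⟨⟨by linarith [hv.1.2], by linarith [hv.1.1]⟩, hv.2⟩
  obtain ⟨W, T, hW, hT, hWT, hWd⟩ := exists_transport_extension hq₂ (z := fun x t => w (1 - x) t)
    (src := fun x t => P.d₂ * z (1 - x) t)
    (h.w_cont.comp hrefl hmaps) (continuousOn_const.mul (h.z_cont.comp hrefl hmaps))
    (fun x t s hx ht hs hxs => by
      have := h.pde_w (1 - x) t s (by linarith) ht hs (by linarith)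
      simpa only [sub_sub] using this)
  have hc : Continuous fun v : ℝ × ℝ => (1 - v.1, v.2) := by fun_prop
  have hI : ∀ x ∈ Icc (0 : ℝ) 1, 1 - x ∈ Icc (0 : ℝ) 1 := fun x hx =>
    ⟨by linarith [hx.2], by linarith [hx.1]⟩
  refine ⟨Z, S, fun x t => W (1 - x) t, fun x t => T (1 - x) t, hZ, hS, hW.comp hc, hT.comp hc,
    fun x hx t ht => (hZS x hx t ht).1, fun x hx t ht => (hZS x hx t ht).2,
    fun x hx t ht => ?_, fun x hx t ht => ?_, hZd, fun ξ s => ?_⟩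
  · simpa using (hWT (1 - x) (hI x hx) t ht).1
  · simpa using (hWT (1 - x) (hI x hx) t ht).2
  · have := hWd (1 - ξ) s
    have e : ∀ s, 1 - (ξ + -P.q₂ * s) = 1 - ξ + P.q₂ * s := fun s => by ring
    simpa only [e] using this

/-- The time derivative of a weighted integral of `z`. -/
theorem TransportPair.hasDerivWithinAt_integral_z (h : P.TransportPair z w) (hq₁ : 0 < P.q₁)
    (hq₂ : 0 < P.q₂) {R : ℝ → ℝ} (hR : ContDiff ℝ 1 R) {t : ℝ} (ht : 0 ≤ t) :
    HasDerivWithinAt (fun t => ∫ y in (0 : ℝ)..1, R y * z y t)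
      (-(P.q₁ * R 1 * z 1 t) + P.q₁ * R 0 * z 0 t
        + ∫ y in (0 : ℝ)..1, (P.q₁ * deriv R y * z y t + P.d₁ * R y * w y t)) (Ici 0) t := by
  obtain ⟨Z, S, W, T, e⟩ := h.exists_extension hq₁ hq₂
  have hR1 : Continuous (deriv R) := hR.continuous_deriv le_rfl
  have key := hasDerivAt_integral_transport (k := fun y _ => R y)
    (k' := fun y _ => P.q₁ * deriv R y) (s := t) e.Z_cont e.S_cont
    (hR.continuous.comp continuous_fst) (continuous_const.mul (hR1.comp continuous_fst)) e.Z_deriv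
    (fun ξ s => by
      have h1 : HasDerivAt (fun s => ξ + P.q₁ * s) P.q₁ s := by
        simpa using ((hasDerivAt_id s).const_mul P.q₁).const_add ξ
      have h2 := (hR.differentiable one_ne_zero (ξ + P.q₁ * s)).hasDerivAt.comp s h1
      exact h2.congr_deriv (mul_comm _ _))
    (hasDerivAt_const t 0) (hasDerivAt_const t 1)
  refine (key.hasDerivWithinAt.congr (s := Ici 0) (fun s hs => ?_) ?_).congr_deriv ?_
  · refine intervalIntegral.integral_congr fun y hy => ?_
    rw [uIcc_of_le zero_le_one] at hy
    simp only [e.Z_eq y hy s hs]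
  · refine intervalIntegral.integral_congr fun y hy => ?_
    rw [uIcc_of_le zero_le_one] at hy
    simp only [e.Z_eq y hy t ht]
  · rw [e.Z_eq 1 (by simp) t ht, e.Z_eq 0 (by simp) t ht]
    have : ∫ y in (0 : ℝ)..1, (P.q₁ * deriv R y * Z y t + R y * S y t)
        = ∫ y in (0 : ℝ)..1, (P.q₁ * deriv R y * z y t + P.d₁ * R y * w y t) := by
      refine intervalIntegral.integral_congr fun y hy => ?_
      rw [uIcc_of_le zero_le_one] at hy
      simp only [e.Z_eq y hy t ht, e.S_eq y hy t ht]
      ring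
    rw [this]
    ring

/-- The time derivative of a weighted integral of `w`. -/
theorem TransportPair.hasDerivWithinAt_integral_w (h : P.TransportPair z w) (hq₁ : 0 < P.q₁)
    (hq₂ : 0 < P.q₂) {R : ℝ → ℝ} (hR : ContDiff ℝ 1 R) {t : ℝ} (ht : 0 ≤ t) :
    HasDerivWithinAt (fun t => ∫ y in (0 : ℝ)..1, R y * w y t)
      (P.q₂ * R 1 * w 1 t - P.q₂ * R 0 * w 0 t
        + ∫ y in (0 : ℝ)..1, (-P.q₂ * deriv R y * w y t + P.d₂ * R y * z y t)) (Ici 0) t := by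
  obtain ⟨Z, S, W, T, e⟩ := h.exists_extension hq₁ hq₂
  have hR1 : Continuous (deriv R) := hR.continuous_deriv le_rfl
  have key := hasDerivAt_integral_transport (k := fun y _ => R y)
    (k' := fun y _ => -P.q₂ * deriv R y) (s := t) e.W_cont e.T_cont
    (hR.continuous.comp continuous_fst) (continuous_const.mul (hR1.comp continuous_fst)) e.W_deriv
    (fun ξ s => by
      have h1 : HasDerivAt (fun s => ξ + -P.q₂ * s) (-P.q₂) s := by
        simpa using ((hasDerivAt_id s).const_mul (-P.q₂)).const_add ξ
      have h2 := (hR.differentiable one_ne_zero (ξ + -P.q₂ * s)).hasDerivAt.comp s h1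
      exact h2.congr_deriv (mul_comm _ _))
    (hasDerivAt_const t 0) (hasDerivAt_const t 1)
  refine (key.hasDerivWithinAt.congr (s := Ici 0) (fun s hs => ?_) ?_).congr_deriv ?_
  · refine intervalIntegral.integral_congr fun y hy => ?_
    rw [uIcc_of_le zero_le_one] at hy
    simp only [e.W_eq y hy s hs]
  · refine intervalIntegral.integral_congr fun y hy => ?_
    rw [uIcc_of_le zero_le_one] at hy
    simp only [e.W_eq y hy t ht]
  · rw [e.W_eq 1 (by simp) t ht, e.W_eq 0 (by simp) t ht]
    have : ∫ y in (0 : ℝ)..1, (-P.q₂ * deriv R y * W y t + R y * T y t)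
        = ∫ y in (0 : ℝ)..1, (-P.q₂ * deriv R y * w y t + P.d₂ * R y * z y t) := by
      refine intervalIntegral.integral_congr fun y hy => ?_
      rw [uIcc_of_le zero_le_one] at hy
      simp only [e.W_eq y hy t ht, e.T_eq y hy t ht]
      ring
    rw [this]
    ring

/-- The backstepping transformation `w ↦ η` that decouples the leftward transport. -/
def eta (P : Plant n m) (z w : ℝ → ℝ → ℝ) (x t : ℝ) : ℝ :=
  w x t - (∫ y in (0 : ℝ)..x, P.F x y * z y t) - ∫ y in (0 : ℝ)..x, P.H x y * w y t

/-- The transformed state `η` is constant along the characteristics of the leftward transport. -/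
theorem TransportPair.eta_transport (h : P.TransportPair z w) (hq₁ : 0 < P.q₁) (hq₂ : 0 < P.q₂)
    {x t s : ℝ} (hx : x ≤ 1) (ht : 0 ≤ t) (hs : 0 ≤ s) (hxs : 0 ≤ x - P.q₂ * s) :
    P.eta z w (x - P.q₂ * s) (t + s) = P.eta z w x t := by
  obtain ⟨Z, S, W, T, e⟩ := h.exists_extension hq₁ hq₂
  have hQ : P.q₁ + P.q₂ ≠ 0 := (add_pos hq₁ hq₂).ne'
  set ξ := x + P.q₂ * t with hξ
  -- `η` along the characteristic, through extensions that can be differentiated in both directions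
  set E : ℝ → ℝ := fun σ => W (ξ + -P.q₂ * σ) σ
    - (∫ y in (0 : ℝ)..(ξ + -P.q₂ * σ), P.F (ξ - P.q₂ * σ) y * Z y σ)
    - ∫ y in (0 : ℝ)..(ξ + -P.q₂ * σ), P.H (ξ - P.q₂ * σ) y * W y σ with hE
  have hmem : ∀ σ ∈ Icc t (t + s), ξ + -P.q₂ * σ ∈ Icc (0 : ℝ) 1 ∧ 0 ≤ σ := fun σ hσ => by
    have h1 := mul_le_mul_of_nonneg_left hσ.1 hq₂.le
    have h2 := mul_le_mul_of_nonneg_left hσ.2 hq₂.le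
    exact ⟨⟨by linarith, by linarith⟩, ht.trans hσ.1⟩
  have hEeq : ∀ σ ∈ Icc t (t + s), E σ = P.eta z w (ξ + -P.q₂ * σ) σ := fun σ hσ => by
    obtain ⟨hm, h0⟩ := hmem σ hσ
    simp only [hE, eta]
    rw [e.W_eq _ hm _ h0]
    congr 1
    · congr 1
      refine intervalIntegral.integral_congr fun y hy => ?_
      rw [uIcc_of_le hm.1] at hy
      rw [e.Z_eq y ⟨hy.1, hy.2.trans hm.2⟩ _ h0]
      ring_nf
    · refine intervalIntegral.integral_congr fun y hy => ?_
      rw [uIcc_of_le hm.1] at hy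
      rw [e.W_eq y ⟨hy.1, hy.2.trans hm.2⟩ _ h0]
      ring_nf
  have hFc : ∀ G : ℝ → ℝ → ℝ, Continuous (Function.uncurry G) →
      Continuous (Function.uncurry fun y s => G (ξ - P.q₂ * s) y) := fun G hG =>
    hG.comp (by fun_prop : Continuous fun v : ℝ × ℝ => (ξ - P.q₂ * v.2, v.1))
  have hcF := hFc _ P.contDiff_F.continuous
  have hcH := hFc _ P.contDiff_H.continuous
  have hder : ∀ σ ∈ Icc t (t + s), HasDerivAt E 0 σ := fun σ hσ => by
    obtain ⟨hm, h0⟩ := hmem σ hσ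
    have hb : HasDerivAt (fun σ => ξ + -P.q₂ * σ) (-P.q₂) σ := by
      simpa using ((hasDerivAt_id σ).const_mul (-P.q₂)).const_add ξ
    have hF := hasDerivAt_integral_transport (s := σ)
      (k := fun y s => P.F (ξ - P.q₂ * s) y) (k' := fun y s => -(P.d₂ * P.H (ξ - P.q₂ * s) y))
      e.Z_cont e.S_cont hcF (continuous_const.mul hcH).neg e.Z_deriv
      (fun ζ s => P.hasDerivAt_F hQ hq₂.ne' ξ ζ s) (hasDerivAt_const σ 0) hb
    have hH := hasDerivAt_integral_transport (s := σ)
      (k := fun y s => P.H (ξ - P.q₂ * s) y) (k' := fun y s => -(P.d₁ * P.F (ξ - P.q₂ * s) y))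
      e.W_cont e.T_cont hcH (continuous_const.mul hcF).neg e.W_deriv
      (fun ζ s => by simpa only [neg_mul, ← sub_eq_add_neg] using P.hasDerivAt_H hQ hq₂.ne' ξ ζ s)
      (hasDerivAt_const σ 0) hb
    refine (((e.W_deriv ξ σ).sub hF).sub hH).congr_deriv ?_
    -- the integrals cancel by the kernel equations, the boundary terms by the values of `F` on the
    -- diagonal and of `H` at `y = 0`
    have e0 : (0 : ℝ) ∈ Icc (0 : ℝ) 1 := by simp
    have hint : ∫ y in (0 : ℝ)..(ξ + -P.q₂ * σ),
          (-(P.d₁ * P.F (ξ - P.q₂ * σ) y) * W y σ + P.H (ξ - P.q₂ * σ) y * T y σ)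
        = -∫ y in (0 : ℝ)..(ξ + -P.q₂ * σ),
          (-(P.d₂ * P.H (ξ - P.q₂ * σ) y) * Z y σ + P.F (ξ - P.q₂ * σ) y * S y σ) := by
      rw [← intervalIntegral.integral_neg]
      refine intervalIntegral.integral_congr fun y hy => ?_
      rw [uIcc_of_le hm.1] at hy
      have hy1 : y ∈ Icc (0 : ℝ) 1 := ⟨hy.1, hy.2.trans hm.2⟩
      rw [e.W_eq y hy1 _ h0, e.T_eq y hy1 _ h0, e.Z_eq y hy1 _ h0, e.S_eq y hy1 _ h0]
      ring
    rw [hint, e.T_eq _ hm _ h0, e.Z_eq _ hm _ h0, e.Z_eq 0 e0 _ h0, e.W_eq _ hm _ h0,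
      e.W_eq 0 e0 _ h0, h.bc_zero σ h0, P.H_zero, show ξ + -P.q₂ * σ = ξ - P.q₂ * σ by ring,
          P.F_diag]
    have := hq₂.ne'
    field_simp
    ring
  have hconst := constant_of_has_deriv_right_zero (f := E) (a := t) (b := t + s)
    (fun σ hσ => (hder σ hσ).continuousAt.continuousWithinAt)
    (fun σ hσ => (hder σ (Ico_subset_Icc_self hσ)).hasDerivWithinAt) (t + s)
    ⟨by linarith, le_rfl⟩
  rw [hEeq _ ⟨by linarith, le_rfl⟩, hEeq _ ⟨le_rfl, by linarith⟩] at hconst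
  rwa [show ξ + -P.q₂ * (t + s) = x - P.q₂ * s by simp only [hξ]; ring,
    show ξ + -P.q₂ * t = x by simp only [hξ]; ring] at hconst

end Plant

/-! ### Time derivatives of the transport states and of `Γ` -/

/-- A function that is differentiable on `[0, ∞)` extends to a differentiable function on the line,
by its tangent at `0`. -/
theorem hasDerivAt_tangent_extension {φ φ' : ℝ → ℝ}
    (h : ∀ t, 0 ≤ t → HasDerivWithinAt φ (φ' t) (Ici 0) t) (t : ℝ) :
    HasDerivAt (fun t => φ (max t 0) + min t 0 * φ' 0) (φ' (max t 0)) t := by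
  have hleft : ∀ t ≤ 0, HasDerivWithinAt (fun t => φ (max t 0) + min t 0 * φ' 0) (φ' 0) (Iic 0) t :=
    fun t ht => by
      have h1 : HasDerivWithinAt (fun t => φ 0 + t * φ' 0) (φ' 0) (Iic 0) t := by
        simpa using (((hasDerivAt_id t).mul_const (φ' 0)).const_add (φ 0)).hasDerivWithinAt
      refine h1.congr (fun s hs => ?_) ?_
      · rw [max_eq_right hs, min_eq_left hs]
      · rw [max_eq_right ht, min_eq_left ht]
  have hright : ∀ t, 0 ≤ t →
      HasDerivWithinAt (fun t => φ (max t 0) + min t 0 * φ' 0) (φ' t) (Ici 0) t := fun t ht => by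
    refine (h t ht).congr (fun s hs => ?_) ?_
    · rw [max_eq_left hs, min_eq_right hs]; ring
    · rw [max_eq_left ht, min_eq_right ht]; ring
  rcases lt_trichotomy t 0 with ht | rfl | ht
  · rw [max_eq_right ht.le]
    exact (hleft t ht.le).hasDerivAt (Iic_mem_nhds ht)
  · have := (hleft 0 le_rfl).union (hright 0 le_rfl)
    rw [Iic_union_Ici, hasDerivWithinAt_univ] at this
    simpa using this
  · rw [max_eq_left ht.le]
    exact (hright t ht.le).hasDerivAt (Ici_mem_nhds ht)

theorem uniqueDiffOn_strip : UniqueDiffOn ℝ (Icc (0 : ℝ) 1 ×ˢ Ici (0 : ℝ)) :=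
  (uniqueDiffOn_Icc zero_lt_one).prod (uniqueDiffOn_Ici 0)

theorem hasDerivWithinAt_time {f : ℝ → ℝ → ℝ}
    (hf : ContDiffOn ℝ 1 (fun a : ℝ × ℝ => f a.1 a.2) (Icc 0 1 ×ˢ Ici 0)) {x t : ℝ}
    (hx : x ∈ Icc (0 : ℝ) 1) (ht : 0 ≤ t) :
    HasDerivWithinAt (f x)
        (fderivWithin ℝ (fun a : ℝ × ℝ => f a.1 a.2) (Icc 0 1 ×ˢ Ici 0) (x, t) (0, 1))
      (Ici 0) t := by
  have h1 := (hf.differentiableOn one_ne_zero (x, t) ⟨hx, ht⟩).hasFDerivWithinAt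
  exact h1.comp_hasDerivWithinAt (f := fun t => (x, t)) t
    ((hasDerivAt_const t x).prodMk (hasDerivAt_id t)).hasDerivWithinAt (fun s hs => ⟨hx, hs⟩)

theorem contDiffOn_time_derivWithin {f : ℝ → ℝ → ℝ} {k : ℕ}
    (hf : ContDiffOn ℝ (k + 1 : ℕ) (fun a : ℝ × ℝ => f a.1 a.2) (Icc 0 1 ×ˢ Ici 0)) :
    ContDiffOn ℝ k (fun a : ℝ × ℝ => derivWithin (f a.1) (Ici 0) a.2) (Icc 0 1 ×ˢ Ici 0) := by
  have h1 : ContDiffOn ℝ 1 (fun a : ℝ × ℝ => f a.1 a.2) (Icc 0 1 ×ˢ Ici 0) :=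
    hf.of_le (by exact_mod_cast Nat.le_add_left 1 k)
  refine ((hf.fderivWithin (m := k) uniqueDiffOn_strip (by exact_mod_cast le_rfl)).clm_apply
    (contDiffOn_const (c := ((0 : ℝ), (1 : ℝ))))).congr fun a ha => ?_
  exact (hasDerivWithinAt_time h1 ha.1 ha.2).derivWithin (uniqueDiffOn_Ici 0 a.2 ha.2)

namespace Plant

variable {n m : ℕ} {P : Plant n m} {z w : ℝ → ℝ → ℝ}

theorem timeDeriv_zero (s : ℝ → ℝ) (t : ℝ) : timeDeriv 0 s t = s t := by
  simp [timeDeriv]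

theorem timeDeriv_succ (j : ℕ) (s : ℝ → ℝ) (t : ℝ) :
    timeDeriv (j + 1) s t = derivWithin (timeDeriv j s) (Ici 0) t := by
  simp only [timeDeriv, iteratedDerivWithin_succ]
  rfl

theorem contDiffOn_timeDeriv {f : ℝ → ℝ → ℝ} {N : ℕ}
    (hf : ContDiffOn ℝ N (fun a : ℝ × ℝ => f a.1 a.2) (Icc 0 1 ×ˢ Ici 0)) (j : ℕ) (hj : j ≤ N) :
    ContDiffOn ℝ (N - j : ℕ) (fun a : ℝ × ℝ => timeDeriv j (f a.1) a.2) (Icc 0 1 ×ˢ Ici 0) := by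
  induction j with
  | zero => simpa only [timeDeriv_zero, Nat.sub_zero] using hf
  | succ j ih =>
    have h1 := ih (by omega)
    rw [show N - j = (N - (j + 1)) + 1 by omega] at h1
    simpa only [timeDeriv_succ] using
      contDiffOn_time_derivWithin (f := fun x t => timeDeriv j (f x) t) h1

theorem hasDerivWithinAt_timeDeriv {f : ℝ → ℝ → ℝ} {N : ℕ}
    (hf : ContDiffOn ℝ N (fun a : ℝ × ℝ => f a.1 a.2) (Icc 0 1 ×ˢ Ici 0)) {j : ℕ} (hj : j < N)
    {x t : ℝ} (hx : x ∈ Icc (0 : ℝ) 1) (ht : 0 ≤ t) :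
    HasDerivWithinAt (timeDeriv j (f x)) (timeDeriv (j + 1) (f x) t) (Ici 0) t := by
  have h1 := (contDiffOn_timeDeriv hf j hj.le).of_le (m := 1)
      (by exact_mod_cast (by omega : 1 ≤ N - j))
  rw [timeDeriv_succ]
  exact (hasDerivWithinAt_time (f := fun x t => timeDeriv j (f x) t) h1 hx
    ht).differentiableWithinAt.hasDerivWithinAt

/-- Differentiation in time of an integral of `f` along a characteristic segment. -/
theorem hasDerivWithinAt_integral_char {f f' : ℝ → ℝ → ℝ}
    (hf : ContinuousOn (Function.uncurry f) (Icc 0 1 ×ˢ Ici 0))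
    (hf' : ContinuousOn (Function.uncurry f') (Icc 0 1 ×ˢ Ici 0))
    (hd : ∀ x ∈ Icc (0 : ℝ) 1, ∀ t, 0 ≤ t → HasDerivWithinAt (f x) (f' x t) (Ici 0) t)
    {ξ : ℝ → ℝ} (hξ : Continuous ξ) {s : ℝ} (hs : 0 ≤ s) (hmem : ∀ r ∈ Icc 0 s, ξ r ∈ Icc (0 : ℝ) 1)
    (d : ℝ) {t : ℝ} (ht : 0 ≤ t) :
    HasDerivWithinAt (fun t => ∫ r in (0 : ℝ)..s, d * f (ξ r) (t + r))
      (∫ r in (0 : ℝ)..s, d * f' (ξ r) (t + r)) (Ici 0) t := by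
  set cl : ℝ → ℝ := fun x => max 0 (min 1 x) with hcl
  have hclc : Continuous cl := by fun_prop
  have hcl_mem : ∀ x, cl x ∈ Icc (0 : ℝ) 1 := fun x =>
    ⟨le_max_left _ _, max_le zero_le_one (min_le_left _ _)⟩
  have hcl_id : ∀ x ∈ Icc (0 : ℝ) 1, cl x = x := fun x hx => by
    simp only [hcl, min_eq_right hx.2, max_eq_right hx.1]
  have hcomp : ∀ g : ℝ → ℝ → ℝ, ContinuousOn (Function.uncurry g) (Icc 0 1 ×ˢ Ici 0) →
      ∀ τ : ℝ × ℝ → ℝ, Continuous τ → Continuous fun v : ℝ × ℝ => g (cl (ξ v.1)) (max (τ v) 0) :=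
    fun g hg τ hτ => hg.comp_continuous (f := fun v : ℝ × ℝ => (cl (ξ v.1), max (τ v) 0))
      (by fun_prop) fun v => ⟨hcl_mem _, mem_Ici.2 (le_max_right _ _)⟩
  have hc1 := hcomp f hf (fun v => v.2 + v.1) (by fun_prop)
  have hc2 := hcomp f' hf' (fun v => v.2 + v.1) (by fun_prop)
  have hc3 := hcomp f' hf' (fun v => 0) continuous_const
  -- clamping in space and extending by tangents in time makes the two-sided Leibniz rule applicable
  have key := hasDerivAt_integral_moving (s := t)
    (g := fun r t => d * (f (cl (ξ r)) (max (t + r) 0) + min (t + r) 0 * f' (cl (ξ r)) 0))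
    (g' := fun r t => d * f' (cl (ξ r)) (max (t + r) 0))
    (by
      simp only [max_self] at hc3
      have : Continuous fun v : ℝ × ℝ => min (v.2 + v.1) 0 := by fun_prop
      exact continuous_const.mul (hc1.add (this.mul hc3)))
    (continuous_const.mul hc2)
    (fun r t => ((hasDerivAt_tangent_extension (fun t ht => hd _ (hcl_mem (ξ r)) t ht)
      (t + r)).comp_add_const t r).const_mul d)
    (hasDerivAt_const t 0) (hasDerivAt_const t s)
  have hval : ∀ t, 0 ≤ t → ∫ r in (0 : ℝ)..s, d * f (ξ r) (t + r) = ∫ r in (0 : ℝ)..s,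
      d * (f (cl (ξ r)) (max (t + r) 0) + min (t + r) 0 * f' (cl (ξ r)) 0) := fun t ht => by
    refine intervalIntegral.integral_congr fun r hr => ?_
    rw [uIcc_of_le hs] at hr
    have : 0 ≤ t + r := add_nonneg ht hr.1
    simp only [hcl_id _ (hmem r hr), max_eq_left this, min_eq_right this]
    ring
  refine (key.hasDerivWithinAt.congr (s := Ici 0) (fun t ht => hval t ht)
    (hval t ht)).congr_deriv ?_
  rw [zero_mul, zero_mul, sub_zero, zero_add]
  refine intervalIntegral.integral_congr fun r hr => ?_
  rw [uIcc_of_le hs] at hr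
  have : 0 ≤ t + r := add_nonneg ht hr.1
  simp only [hcl_id _ (hmem r hr), max_eq_left this]

/-- The time derivatives of a `C¹` solution of the transport subsystem solve it, too. -/
theorem TransportPair.of_time_deriv (h : P.TransportPair z w) (hq₁ : 0 < P.q₁) (hq₂ : 0 < P.q₂)
    {z' w' : ℝ → ℝ → ℝ}
    (hz' : ContinuousOn (Function.uncurry z') (Icc 0 1 ×ˢ Ici 0))
    (hw' : ContinuousOn (Function.uncurry w') (Icc 0 1 ×ˢ Ici 0))
    (hz : ∀ x ∈ Icc (0 : ℝ) 1, ∀ t, 0 ≤ t → HasDerivWithinAt (z x) (z' x t) (Ici 0) t)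
    (hw : ∀ x ∈ Icc (0 : ℝ) 1, ∀ t, 0 ≤ t → HasDerivWithinAt (w x) (w' x t) (Ici 0) t) :
    P.TransportPair z' w' := by
  have hshift : ∀ (f f' : ℝ → ℝ → ℝ) (x t s : ℝ), 0 ≤ t → 0 ≤ s →
      HasDerivWithinAt (f x) (f' x (t + s)) (Ici 0) (t + s) →
      HasDerivWithinAt (fun t => f x (t + s)) (f' x (t + s)) (Ici 0) t :=
          fun f f' x t s ht hs hd => by
    have h1 : HasDerivWithinAt (fun t => t + s) 1 (Ici 0) t :=
      ((hasDerivAt_id t).add_const s).hasDerivWithinAt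
    have := HasDerivWithinAt.comp (h := fun t => t + s) t hd h1 (fun r hr => add_nonneg hr hs)
    exact this.congr_deriv (mul_one _)
  have huniq : ∀ t : ℝ, 0 ≤ t → UniqueDiffWithinAt ℝ (Ici (0 : ℝ)) t := fun t ht =>
      uniqueDiffOn_Ici 0 t ht
  refine ⟨hz', hw', fun x t s hx ht hs hxs => ?_, fun x t s hx ht hs hxs => ?_, fun t ht => ?_⟩
  · have h0 := mul_nonneg hq₁.le hs
    have hmem : ∀ r ∈ Icc 0 s, x + P.q₁ * r ∈ Icc (0 : ℝ) 1 := fun r hr => by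
      have h1 := mul_le_mul_of_nonneg_left hr.2 hq₁.le
      have h2 := mul_nonneg hq₁.le hr.1
      exact ⟨by linarith, by linarith⟩
    have d1 := hshift z z' (x + P.q₁ * s) t s ht hs (hz _ ⟨by linarith, hxs⟩ _ (by linarith))
    have d2 := (hz x ⟨hx, by linarith⟩ t ht).add (hasDerivWithinAt_integral_char h.w_cont hw' hw
      (ξ := fun r => x + P.q₁ * r) (by fun_prop) hs hmem P.d₁ ht)
    refine (huniq t ht).eq_deriv _ d1 (d2.congr (fun r hr => ?_) ?_)
    · exact h.pde_z x r s hx hr hs hxs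
    · exact h.pde_z x t s hx ht hs hxs
  · have h0 := mul_nonneg hq₂.le hs
    have hmem : ∀ r ∈ Icc 0 s, x - P.q₂ * r ∈ Icc (0 : ℝ) 1 := fun r hr => by
      have h1 := mul_le_mul_of_nonneg_left hr.2 hq₂.le
      have h2 := mul_nonneg hq₂.le hr.1
      exact ⟨by linarith, by linarith⟩
    have d1 := hshift w w' (x - P.q₂ * s) t s ht hs (hw _ ⟨hxs, by linarith⟩ _ (by linarith))
    have d2 := (hw x ⟨by linarith, hx⟩ t ht).add (hasDerivWithinAt_integral_char h.z_cont hz' hz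
      (ξ := fun r => x - P.q₂ * r) (by fun_prop) hs hmem P.d₂ ht)
    refine (huniq t ht).eq_deriv _ d1 (d2.congr (fun r hr => ?_) ?_)
    · exact h.pde_w x r s hx hr hs hxs
    · exact h.pde_w x t s hx ht hs hxs
  · have hm : (0 : ℝ) ∈ Icc (0 : ℝ) 1 := by simp
    refine (huniq t ht).eq_deriv _ (hz 0 hm t ht) (((hw 0 hm t ht).const_mul P.p).congr
      (fun r hr => h.bc_zero r hr) (h.bc_zero t ht))

theorem TransportPair.iterated_timeDeriv (h : P.TransportPair z w) (hq₁ : 0 < P.q₁)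
    (hq₂ : 0 < P.q₂) {N : ℕ}
    (hz : ContDiffOn ℝ N (fun a : ℝ × ℝ => z a.1 a.2) (Icc 0 1 ×ˢ Ici 0))
    (hw : ContDiffOn ℝ N (fun a : ℝ × ℝ => w a.1 a.2) (Icc 0 1 ×ˢ Ici 0)) (j : ℕ) (hj : j ≤ N) :
    P.TransportPair (fun x => timeDeriv j (z x)) (fun x => timeDeriv j (w x)) := by
  induction j with
  | zero =>
    have : ∀ f : ℝ → ℝ → ℝ, (fun x => timeDeriv 0 (f x)) = f := fun f => by
      funext x t; exact timeDeriv_zero _ _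
    rw [this, this]; exact h
  | succ j ih =>
    exact (ih (by omega)).of_time_deriv hq₁ hq₂ (contDiffOn_timeDeriv hz (j + 1) hj).continuousOn
      (contDiffOn_timeDeriv hw (j + 1) hj).continuousOn
      (fun x hx t ht => hasDerivWithinAt_timeDeriv hz hj hx ht)
      (fun x hx t ht => hasDerivWithinAt_timeDeriv hw hj hx ht)

theorem TransportPair.continuousOn_z (h : P.TransportPair z w) {t : ℝ} (ht : 0 ≤ t) :
    ContinuousOn (fun y => z y t) (Icc 0 1) :=
  h.z_cont.comp (f := fun y => (y, t)) (by fun_prop) fun _ hy => ⟨hy, ht⟩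

theorem TransportPair.continuousOn_w (h : P.TransportPair z w) {t : ℝ} (ht : 0 ≤ t) :
    ContinuousOn (fun y => w y t) (Icc 0 1) :=
  h.w_cont.comp (f := fun y => (y, t)) (by fun_prop) fun _ hy => ⟨hy, ht⟩

theorem sum_range_shift (c g : ℕ → ℝ) (i : ℕ) :
    ∑ j ∈ Finset.range (i + 1), c (i + 1 - 1 - j) * g j
      = (∑ j ∈ Finset.range i, c (i - 1 - j) * g (j + 1)) + c i * g 0 := by
  rw [Finset.sum_range_succ']
  congr 1
  refine Finset.sum_congr rfl fun j hj => ?_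
  rw [show i + 1 - 1 - (j + 1) = i - 1 - j by omega]

open Matrix in
/-- `Γ⁽ⁱ⁺¹⁾` is the derivative of `Γ⁽ⁱ⁾`. -/
theorem TransportPair.hasDerivWithinAt_Gamma (h : P.TransportPair z w) (hq₁ : 0 < P.q₁)
    (hq₂ : 0 < P.q₂) (κ : ℕ → ℝ) {N : ℕ}
    (hz : ContDiffOn ℝ N (fun a : ℝ × ℝ => z a.1 a.2) (Icc 0 1 ×ˢ Ici 0))
    (hw : ContDiffOn ℝ N (fun a : ℝ × ℝ => w a.1 a.2) (Icc 0 1 ×ˢ Ici 0))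
    {Y : ℝ → Fin n → ℝ}
    (hY : ∀ t, 0 ≤ t → HasDerivWithinAt Y (P.A *ᵥ (Y t) + w 0 t • P.B) (Ici 0) t)
    {i : ℕ} (hi : i ≤ N) {t : ℝ} (ht : 0 ≤ t) :
    HasDerivWithinAt (P.Gamma κ z w Y i) (P.Gamma κ z w Y (i + 1) t) (Ici 0) t := by
  have h0 : (0 : ℝ) ∈ Icc (0 : ℝ) 1 := by simp
  have h1 : (1 : ℝ) ∈ Icc (0 : ℝ) 1 := by simp
  have hsum : ∀ (f : ℝ → ℝ → ℝ), ContDiffOn ℝ N (fun a : ℝ × ℝ => f a.1 a.2) (Icc 0 1 ×ˢ Ici 0) →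
      ∀ x ∈ Icc (0 : ℝ) 1, ∀ c : ℕ → ℝ, HasDerivWithinAt
        (fun t => ∑ j ∈ Finset.range i, c (i - 1 - j) * timeDeriv j (f x) t)
        ((∑ j ∈ Finset.range (i + 1), c (i + 1 - 1 - j) * timeDeriv j (f x) t)
          - c i * f x t) (Ici 0) t := fun f hf x hx c => by
    have := HasDerivWithinAt.fun_sum (u := Finset.range i) (x := t) (s := Ici 0)
      (A := fun j t => c (i - 1 - j) * timeDeriv j (f x) t)
      (A' := fun j => c (i - 1 - j) * timeDeriv (j + 1) (f x) t) fun j hj =>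
        (hasDerivWithinAt_timeDeriv hf ((Finset.mem_range.1 hj).trans_le hi) hx ht).const_mul _
    refine this.congr_deriv ?_
    rw [sum_range_shift c (fun j => timeDeriv j (f x) t), timeDeriv_zero]
    ring
  have hRs := P.contDiff_RP κ i
  have hR : ContDiff ℝ 1 (P.RP κ i).1 := hRs.1.of_le (by exact_mod_cast le_top)
  have hP : ContDiff ℝ 1 (P.RP κ i).2 := hRs.2.of_le (by exact_mod_cast le_top)
  have hRc : Continuous (deriv (P.RP κ i).1) := hR.continuous_deriv le_rfl
  have hPc : Continuous (deriv (P.RP κ i).2) := hP.continuous_deriv le_rfl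
  have hIz := h.hasDerivWithinAt_integral_z hq₁ hq₂ hR ht
  have hIw := h.hasDerivWithinAt_integral_w hq₁ hq₂ hP ht
  have hlam : HasDerivWithinAt (fun t => P.lam κ 1 ⬝ᵥ ((P.A ^ i) *ᵥ (Y t)))
      (P.lam κ 1 ⬝ᵥ ((P.A ^ i) *ᵥ (P.A *ᵥ (Y t) + w 0 t • P.B))) (Ici 0) t := by
    have hlin : IsLinearMap ℝ fun v : Fin n → ℝ => P.lam κ 1 ⬝ᵥ ((P.A ^ i) *ᵥ v) :=
      { map_add := fun u v => by rw [Matrix.mulVec_add, dotProduct_add]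
        map_smul := fun r v => by rw [Matrix.mulVec_smul, dotProduct_smul] }
    exact (LinearMap.toContinuousLinearMap hlin.mk').hasFDerivAt.comp_hasDerivWithinAt t (hY t ht)
  have total := ((((((hsum z hz 1 h1 (fun k => P.q₁ * (P.RP κ k).1 1)).neg.add
    (hsum z hz 0 h0 (fun k => P.q₁ * (P.RP κ k).1 0))).add hIz).add
    (hsum w hw 1 h1 (fun k => P.q₂ * (P.RP κ k).2 1))).sub
    (hsum w hw 0 h0 (fun k => P.q₂ * (P.RP κ k).2 0 - P.lam κ 1 ⬝ᵥ ((P.A ^ k).mulVec P.B)))).add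
    hIw).add hlam
  refine total.congr_deriv ?_
  have czi : ∀ g : ℝ → ℝ, Continuous g →
      IntervalIntegrable (fun y => g y * z y t) MeasureTheory.volume 0 1 := fun g hg =>
    ContinuousOn.intervalIntegrable (by
      rw [uIcc_of_le zero_le_one]; exact hg.continuousOn.mul (h.continuousOn_z ht))
  have cwi : ∀ g : ℝ → ℝ, Continuous g →
      IntervalIntegrable (fun y => g y * w y t) MeasureTheory.volume 0 1 := fun g hg =>
    ContinuousOn.intervalIntegrable (by
      rw [uIcc_of_le zero_le_one]; exact hg.continuousOn.mul (h.continuousOn_w ht))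
  have hint : (∫ y in (0 : ℝ)..1,
      (P.q₁ * deriv (P.RP κ i).1 y * z y t + P.d₁ * (P.RP κ i).1 y * w y t))
      + (∫ y in (0 : ℝ)..1, (-P.q₂ * deriv (P.RP κ i).2 y * w y t + P.d₂ * (P.RP κ i).2 y * z y t))
      = (∫ y in (0 : ℝ)..1, (P.RP κ (i + 1)).1 y * z y t)
        + ∫ y in (0 : ℝ)..1, (P.RP κ (i + 1)).2 y * w y t := by
    have i1 : IntervalIntegrable (fun y => P.q₁ * deriv (P.RP κ i).1 y * z y t)
        MeasureTheory.volume 0 1 := czi (fun y => P.q₁ * deriv (P.RP κ i).1 y) (by fun_prop)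
    have i2 : IntervalIntegrable (fun y => P.d₂ * (P.RP κ i).2 y * z y t)
        MeasureTheory.volume 0 1 :=
            czi (fun y => P.d₂ * (P.RP κ i).2 y) (continuous_const.mul hP.continuous)
    have i3 : IntervalIntegrable (fun y => -P.q₂ * deriv (P.RP κ i).2 y * w y t)
        MeasureTheory.volume 0 1 := cwi (fun y => -P.q₂ * deriv (P.RP κ i).2 y) (by fun_prop)
    have i4 : IntervalIntegrable (fun y => P.d₁ * (P.RP κ i).1 y * w y t)
        MeasureTheory.volume 0 1 :=
            cwi (fun y => P.d₁ * (P.RP κ i).1 y) (continuous_const.mul hR.continuous)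
    rw [intervalIntegral.integral_add i1 i4, intervalIntegral.integral_add i3 i2]
    have e1 : ∫ y in (0 : ℝ)..1, (P.RP κ (i + 1)).1 y * z y t
        = (∫ y in (0 : ℝ)..1, P.q₁ * deriv (P.RP κ i).1 y * z y t)
          + ∫ y in (0 : ℝ)..1, P.d₂ * (P.RP κ i).2 y * z y t := by
      rw [← intervalIntegral.integral_add i1 i2]
      exact intervalIntegral.integral_congr fun y _ => add_mul _ _ _
    have e2 : ∫ y in (0 : ℝ)..1, (P.RP κ (i + 1)).2 y * w y t
        = (∫ y in (0 : ℝ)..1, -P.q₂ * deriv (P.RP κ i).2 y * w y t)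
          + ∫ y in (0 : ℝ)..1, P.d₁ * (P.RP κ i).1 y * w y t := by
      rw [← intervalIntegral.integral_add i3 i4]
      exact intervalIntegral.integral_congr fun y _ => add_mul _ _ _
    rw [e1, e2]
    ring
  have hmat : P.lam κ 1 ⬝ᵥ ((P.A ^ i) *ᵥ (P.A *ᵥ (Y t) + w 0 t • P.B))
      = P.lam κ 1 ⬝ᵥ ((P.A ^ (i + 1)) *ᵥ (Y t)) + w 0 t * (P.lam κ 1 ⬝ᵥ ((P.A ^ i) *ᵥ P.B)) := by
    rw [Matrix.mulVec_add, dotProduct_add, Matrix.mulVec_smul, dotProduct_smul,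
        Matrix.mulVec_mulVec,
      ← pow_succ, smul_eq_mul]
  rw [hmat]
  unfold Gamma
  linear_combination hint

end Plant

/-! ### Prediction over the transport delay -/

/-- Exchange of the order of integration over a triangle. -/
theorem integral_triangle_swap {a ζ : ℝ → ℝ} {G : ℝ → ℝ → ℝ} (ha : Continuous a) (hζ : Continuous ζ)
    (hG : Continuous (Function.uncurry G)) (b : ℝ) :
    ∫ y in (0 : ℝ)..b, (∫ r in y..b, a r * G r y) * ζ y
      = ∫ r in (0 : ℝ)..b, a r * ∫ y in (0 : ℝ)..r, G r y * ζ y := by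
  have hI : ∀ f : ℝ → ℝ → ℝ, Continuous (Function.uncurry f) →
      Continuous fun v : ℝ × ℝ => ∫ r in (v.1)..(v.2), f r v.1 := fun f hf => by
    have h1 : Continuous fun v : (ℝ × ℝ) × ℝ => f v.2 v.1.1 :=
      hf.comp (by fun_prop : Continuous fun v : (ℝ × ℝ) × ℝ => (v.2, v.1.1))
    have h2 := intervalIntegral.continuous_parametric_intervalIntegral_of_continuous (X := ℝ × ℝ)
      (μ := MeasureTheory.volume) (a₀ := 0) (f := fun v r => f r v.1) h1 continuous_snd
    have h3 := intervalIntegral.continuous_parametric_intervalIntegral_of_continuous (X := ℝ × ℝ)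
      (μ := MeasureTheory.volume) (a₀ := 0) (f := fun v r => f r v.1) h1 continuous_fst
    refine (h2.sub h3).congr fun v => ?_
    have hc : Continuous fun r => f r v.1 := hf.comp (by fun_prop : Continuous fun r => (r, v.1))
    exact intervalIntegral.integral_interval_sub_left (hc.intervalIntegrable _ _)
      (hc.intervalIntegrable _ _)
  have haG : Continuous (Function.uncurry fun r y => a r * G r y) :=
    (ha.comp continuous_fst).mul hG
  have haG' : Continuous (Function.uncurry fun y r => a r * G r y) := haG.comp continuous_swap
  have hinner : Continuous fun r => ∫ y in (0 : ℝ)..r, G r y * ζ y :=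
    intervalIntegral.continuous_parametric_intervalIntegral_of_continuous
      (f := fun r y => G r y * ζ y) (hG.mul (hζ.comp continuous_snd)) continuous_id
  -- both sides vanish at `b = 0` and have the same derivative in `b`
  have hd : ∀ x, HasDerivAt (fun b => (∫ y in (0 : ℝ)..b, (∫ r in y..b, a r * G r y) * ζ y)
      - ∫ r in (0 : ℝ)..b, a r * ∫ y in (0 : ℝ)..r, G r y * ζ y) 0 x := fun x => by
    have h1 := hasDerivAt_integral_moving (s := x)
      (g := fun y b => (∫ r in y..b, a r * G r y) * ζ y)
      (g' := fun y b => a b * G b y * ζ y)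
      ((hI _ haG).mul (hζ.comp continuous_fst)) (haG'.mul (hζ.comp continuous_fst))
      (fun y s => by
        have hc : Continuous fun r => a r * G r y :=
            haG.comp (by fun_prop : Continuous fun r => (r, y))
        exact (intervalIntegral.integral_hasDerivAt_right (hc.intervalIntegrable _ _)
          (hc.stronglyMeasurableAtFilter _ _) hc.continuousAt).mul_const _)
      (hasDerivAt_const x 0) (hasDerivAt_id x)
    have hc2 : Continuous fun r => a r * ∫ y in (0 : ℝ)..r, G r y * ζ y := ha.mul hinner
    have h2 := intervalIntegral.integral_hasDerivAt_right (hc2.intervalIntegrable 0 x)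
          (hc2.stronglyMeasurableAtFilter _ _) hc2.continuousAt
    refine (h1.sub h2).congr_deriv ?_
    simp only [id, intervalIntegral.integral_same, mul_assoc, intervalIntegral.integral_const_mul]
    ring
  have := is_const_of_deriv_eq_zero (fun x => (hd x).differentiableAt) (fun x => (hd x).deriv) b 0
  simp only [intervalIntegral.integral_same, sub_zero] at this
  linarith

namespace Plant

variable {n m : ℕ} {P : Plant n m} {z w : ℝ → ℝ → ℝ}

open Matrix

theorem mulVec_eq_sum_single (M : Matrix (Fin n) (Fin n) ℝ) (v : Fin n → ℝ) :
    M *ᵥ v = ∑ k, v k • (M *ᵥ Pi.single k 1) := by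
  ext i
  simp [Matrix.mulVec, dotProduct, Finset.sum_apply, mul_comm]

/-- Variation of constants for the distal ODE. -/
theorem variation_of_constants {Y : ℝ → Fin n → ℝ} {u : ℝ → ℝ} (hu : ContinuousOn u (Ici 0))
    (hY : ∀ t, 0 ≤ t → HasDerivWithinAt Y (P.A *ᵥ (Y t) + u t • P.B) (Ici 0) t)
    {t s : ℝ} (ht : 0 ≤ t) (hs : 0 ≤ s) :
    Y (t + s) = P.expA s *ᵥ (Y t) + ∫ r in (0 : ℝ)..s, P.expA (s - r) *ᵥ (u (t + r) • P.B) := by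
  have hder : ∀ r, 0 ≤ r → HasDerivWithinAt (fun r => P.expA (s - r) *ᵥ (Y (t + r)))
      (P.expA (s - r) *ᵥ (u (t + r) • P.B)) (Ici 0) r := fun r hr => by
    have h1 : HasDerivWithinAt (fun r => Y (t + r)) (P.A *ᵥ (Y (t + r)) + u (t + r) • P.B)
        (Ici 0) r := by
      have hadd : HasDerivWithinAt (fun r => t + r) 1 (Ici 0) r :=
        ((hasDerivAt_id r).const_add t).hasDerivWithinAt
      have := HasDerivWithinAt.scomp (h := fun r => t + r) r (hY (t + r) (add_nonneg ht hr)) hadd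
        (fun q hq => add_nonneg ht hq)
      exact this.congr_deriv (one_smul _ _)
    have h2 : ∀ v, HasDerivWithinAt (fun r => P.expA (s - r) *ᵥ v)
        (-(P.A *ᵥ (P.expA (s - r) *ᵥ v))) (Ici 0) r := fun v =>
      ((P.hasDerivAt_expA_mulVec v (s - r)).comp_const_sub s r).hasDerivWithinAt
    have h3 := HasDerivWithinAt.fun_sum (u := (Finset.univ : Finset (Fin n))) fun k _ =>
      (hasDerivWithinAt_pi.1 h1 k).smul (h2 (Pi.single k 1))
    refine (h3.congr (fun q _ => mulVec_eq_sum_single _ _)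
      (mulVec_eq_sum_single _ _)).congr_deriv ?_
    rw [Finset.sum_add_distrib, ← mulVec_eq_sum_single]
    have : ∑ k, Y (t + r) k • -(P.A *ᵥ (P.expA (s - r) *ᵥ Pi.single k 1))
        = -(P.A *ᵥ (P.expA (s - r) *ᵥ Y (t + r))) := by
      conv_rhs => rw [mulVec_eq_sum_single (P.expA (s - r)) (Y (t + r)), Matrix.mulVec_sum]
      rw [← Finset.sum_neg_distrib]
      exact Finset.sum_congr rfl fun k _ => by rw [smul_neg, Matrix.mulVec_smul]
    rw [this, Matrix.mulVec_add, expA_mulVec_comm]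
    abel
  have hcont : ContinuousOn (fun r => P.expA (s - r) *ᵥ (u (t + r) • P.B)) (Icc 0 s) := by
    have h1 : ContinuousOn (fun r => u (t + r) • (P.expA (s - r) *ᵥ P.B)) (Icc 0 s) := by
      refine ContinuousOn.smul (hu.comp (by fun_prop) fun r hr => add_nonneg ht hr.1) ?_
      exact ((P.contDiff_expA_mulVec P.B).continuous.comp
        (by fun_prop : Continuous fun r => s - r)).continuousOn
    exact h1.congr fun r _ => Matrix.mulVec_smul _ _ _
  have key := intervalIntegral.integral_eq_sub_of_hasDeriv_right (a := 0) (b := s)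
    (f := fun r => P.expA (s - r) *ᵥ (Y (t + r)))
    (f' := fun r => P.expA (s - r) *ᵥ (u (t + r) • P.B))
    (fun r hr => ((hder r (by rw [uIcc_of_le hs] at hr; exact hr.1)).continuousWithinAt).mono
      (by rw [uIcc_of_le hs]; exact Icc_subset_Ici_self))
    (fun r hr => (hder r (by rw [min_eq_left hs] at hr; exact hr.1.le)).mono
      (by rw [min_eq_left hs] at hr; exact Ioi_subset_Ici hr.1.le))
    (ContinuousOn.intervalIntegrable (by rwa [uIcc_of_le hs]))
  rw [key]
  simp [expA_zero]

theorem TransportPair.continuousOn_w_zero (h : P.TransportPair z w) :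
    ContinuousOn (fun t => w 0 t) (Ici 0) :=
  h.w_cont.comp (f := fun t => ((0 : ℝ), t)) (by fun_prop) fun _ ht => ⟨by simp, ht⟩

theorem eta_zero_left (t : ℝ) : P.eta z w 0 t = w 0 t := by simp [eta]

/-- The value of `w` at the distal end is the delayed transformed state. -/
theorem TransportPair.w_zero_eq_eta (h : P.TransportPair z w) (hq₁ : 0 < P.q₁) (hq₂ : 0 < P.q₂)
    {x t : ℝ} (hx : x ∈ Icc (0 : ℝ) 1) (ht : 0 ≤ t) :
    w 0 (t + x / P.q₂) = P.eta z w x t := by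
  have e : P.q₂ * (x / P.q₂) = x := mul_div_cancel₀ _ hq₂.ne'
  have := h.eta_transport hq₁ hq₂ (s := x / P.q₂) hx.2 ht (div_nonneg hx.1 hq₂.le)
      (by rw [e, sub_self])
  rwa [e, sub_self, eta_zero_left] at this

theorem eta_eq_eta0 {z₀ w₀ : ℝ → ℝ} (h : ∀ x ∈ Icc (0 : ℝ) 1, z x 0 = z₀ x)
    (h' : ∀ x ∈ Icc (0 : ℝ) 1, w x 0 = w₀ x) {x : ℝ} (hx : x ∈ Icc (0 : ℝ) 1) :
    P.eta z w x 0 = P.eta0 z₀ w₀ x := by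
  unfold eta eta0
  rw [h' x hx]
  congr 1
  · congr 1
    refine intervalIntegral.integral_congr fun y hy => ?_
    rw [uIcc_of_le hx.1] at hy
    simp only [h y ⟨hy.1, hy.2.trans hx.2⟩]
  · refine intervalIntegral.integral_congr fun y hy => ?_
    rw [uIcc_of_le hx.1] at hy
    simp only [h' y ⟨hy.1, hy.2.trans hx.2⟩]

/-- Before the arrival of the control action, `Y` is determined by the initial values. -/
theorem TransportPair.Y_eq_PiVec (h : P.TransportPair z w) (hq₁ : 0 < P.q₁) (hq₂ : 0 < P.q₂)
    {z₀ w₀ : ℝ → ℝ} (hz₀ : ∀ x ∈ Icc (0 : ℝ) 1, z x 0 = z₀ x)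
    (hw₀ : ∀ x ∈ Icc (0 : ℝ) 1, w x 0 = w₀ x)
    {Y : ℝ → Fin n → ℝ}
    (hY : ∀ t, 0 ≤ t → HasDerivWithinAt Y (P.A *ᵥ (Y t) + w 0 t • P.B) (Ici 0) t)
    {ς : ℝ} (hς : ς ∈ Icc (0 : ℝ) 1) : Y (ς / P.q₂) = P.PiVec z₀ w₀ (Y 0) ς := by
  have hs : 0 ≤ ς / P.q₂ := div_nonneg hς.1 hq₂.le
  have hvoc := variation_of_constants h.continuousOn_w_zero hY le_rfl hs
  simp only [zero_add] at hvoc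
  rw [hvoc, PiVec]
  congr 1
  have heta : ∀ x ∈ Icc (0 : ℝ) ς, P.eta0 z₀ w₀ x = w 0 (x / P.q₂) := fun x hx => by
    have hx1 : x ∈ Icc (0 : ℝ) 1 := ⟨hx.1, hx.2.trans hς.2⟩
    have := h.w_zero_eq_eta hq₁ hq₂ hx1 le_rfl
    rw [zero_add] at this
    rw [this, eta_eq_eta0 hz₀ hw₀ hx1]
  have hintg : IntervalIntegrable (fun x => P.expA (-(x / P.q₂)) *ᵥ (P.eta0 z₀ w₀ x • P.B))
      MeasureTheory.volume 0 ς := by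
    refine ContinuousOn.intervalIntegrable ?_
    rw [uIcc_of_le hς.1]
    have h1 : ContinuousOn (fun x => w 0 (x / P.q₂) • (P.expA (-(x / P.q₂)) *ᵥ P.B)) (Icc 0 ς) := by
      refine ContinuousOn.smul (h.continuousOn_w_zero.comp (by fun_prop)
        fun r hr => div_nonneg hr.1 hq₂.le) ?_
      exact ((P.contDiff_expA_mulVec P.B).continuous.comp
        (by fun_prop : Continuous fun x => -(x / P.q₂))).continuousOn
    exact h1.congr fun x hx => by rw [Matrix.mulVec_smul, heta x hx]
  have hpull : P.expA (ς / P.q₂) *ᵥ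
      (∫ x in (0 : ℝ)..ς, P.expA (-(x / P.q₂)) *ᵥ (P.eta0 z₀ w₀ x • P.B))
      = ∫ x in (0 : ℝ)..ς, P.expA (ς / P.q₂) *ᵥ (P.expA (-(x / P.q₂)) *ᵥ (P.eta0 z₀ w₀ x • P.B)) :=
    (ContinuousLinearMap.intervalIntegral_comp_comm
      (LinearMap.toContinuousLinearMap (Matrix.mulVecLin (P.expA (ς / P.q₂)))) hintg).symm
  rw [hpull]
  have hsub := intervalIntegral.smul_integral_comp_mul_right (a := 0) (b := ς)
    (fun r => P.expA (ς / P.q₂ - r) *ᵥ (w 0 r • P.B)) (1 / P.q₂)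
  rw [zero_mul, mul_one_div] at hsub
  rw [← hsub]
  congr 1
  refine intervalIntegral.integral_congr fun x hx => ?_
  rw [uIcc_of_le hς.1] at hx
  simp only [mul_one_div]
  rw [heta x hx, Matrix.mulVec_mulVec, ← expA_add, ← sub_eq_add_neg]

/-- The value of `Y` at the arrival of the control action. -/
theorem TransportPair.Y_eq_YArrival (h : P.TransportPair z w) (hq₁ : 0 < P.q₁) (hq₂ : 0 < P.q₂)
    {z₀ w₀ : ℝ → ℝ} (hz₀ : ∀ x ∈ Icc (0 : ℝ) 1, z x 0 = z₀ x)
    (hw₀ : ∀ x ∈ Icc (0 : ℝ) 1, w x 0 = w₀ x)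
    {Y : ℝ → Fin n → ℝ}
    (hY : ∀ t, 0 ≤ t → HasDerivWithinAt Y (P.A *ᵥ (Y t) + w 0 t • P.B) (Ici 0) t) :
    Y (1 / P.q₂) = P.YArrival z₀ w₀ (Y 0) := by
  have hs : 0 ≤ 1 / P.q₂ := div_nonneg zero_le_one hq₂.le
  have hvoc := variation_of_constants h.continuousOn_w_zero hY le_rfl hs
  simp only [zero_add] at hvoc
  rw [hvoc, YArrival]
  congr 1
  refine intervalIntegral.integral_congr fun t ht => ?_
  rw [uIcc_of_le hs] at ht
  have hm : P.q₂ * t ∈ Icc (0 : ℝ) 1 := ⟨mul_nonneg hq₂.le ht.1, by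
    have := mul_le_mul_of_nonneg_left ht.2 hq₂.le
    rwa [mul_one_div_cancel hq₂.ne'] at this⟩
  have := h.w_zero_eq_eta hq₁ hq₂ hm le_rfl
  rw [zero_add, mul_div_cancel_left₀ _ hq₂.ne'] at this
  rw [this, eta_eq_eta0 hz₀ hw₀ hm]

/-- The prediction of `K Y` over the transport delay. -/
theorem TransportPair.K_dotProduct_prediction (h : P.TransportPair z w) (hq₁ : 0 < P.q₁)
    (hq₂ : 0 < P.q₂) (κ : ℕ → ℝ) {Y : ℝ → Fin n → ℝ}
    (hY : ∀ t, 0 ≤ t → HasDerivWithinAt Y (P.A *ᵥ (Y t) + w 0 t • P.B) (Ici 0) t)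
    {t : ℝ} (ht : 0 ≤ t) :
    P.K κ ⬝ᵥ Y (t + 1 / P.q₂)
      = P.lam κ 1 ⬝ᵥ Y t - ∫ x in (0 : ℝ)..1, P.L κ 1 x * P.eta z w x t := by
  have hs : 0 ≤ 1 / P.q₂ := div_nonneg zero_le_one hq₂.le
  rw [variation_of_constants h.continuousOn_w_zero hY ht hs, dotProduct_add, ← lam_dotProduct,
    sub_eq_add_neg]
  congr 1
  have hlin : IsLinearMap ℝ fun v : Fin n → ℝ => P.K κ ⬝ᵥ v :=
    { map_add := fun u v => dotProduct_add _ _ _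
      map_smul := fun r v => dotProduct_smul _ _ _ }
  have hcont : ContinuousOn (fun r => P.expA (1 / P.q₂ - r) *ᵥ (w 0 (t + r) • P.B))
      (Icc 0 (1 / P.q₂)) := by
    have h1 : ContinuousOn (fun r => w 0 (t + r) • (P.expA (1 / P.q₂ - r) *ᵥ P.B))
        (Icc 0 (1 / P.q₂)) := by
      refine ContinuousOn.smul (h.continuousOn_w_zero.comp (by fun_prop)
        fun r hr => add_nonneg ht hr.1) ?_
      exact ((P.contDiff_expA_mulVec P.B).continuous.comp
        (by fun_prop : Continuous fun r => 1 / P.q₂ - r)).continuousOn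
    exact h1.congr fun r _ => Matrix.mulVec_smul _ _ _
  have hpull : P.K κ ⬝ᵥ (∫ r in (0 : ℝ)..(1 / P.q₂), P.expA (1 / P.q₂ - r) *ᵥ (w 0 (t + r) • P.B))
      = ∫ r in (0 : ℝ)..(1 / P.q₂), P.K κ ⬝ᵥ (P.expA (1 / P.q₂ - r) *ᵥ (w 0 (t + r) • P.B)) :=
    (ContinuousLinearMap.intervalIntegral_comp_comm (LinearMap.toContinuousLinearMap hlin.mk')
      (ContinuousOn.intervalIntegrable (by rwa [uIcc_of_le hs]))).symm
  rw [hpull]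
  have hsub := intervalIntegral.smul_integral_comp_mul_right (a := 0) (b := 1)
    (fun r => P.K κ ⬝ᵥ (P.expA (1 / P.q₂ - r) *ᵥ (w 0 (t + r) • P.B))) (1 / P.q₂)
  rw [zero_mul, one_mul] at hsub
  rw [← hsub, ← intervalIntegral.integral_smul, ← intervalIntegral.integral_neg]
  refine intervalIntegral.integral_congr fun x hx => ?_
  rw [uIcc_of_le zero_le_one] at hx
  simp only [mul_one_div, smul_eq_mul]
  rw [h.w_zero_eq_eta hq₁ hq₂ hx ht, Matrix.mulVec_smul, dotProduct_smul, smul_eq_mul, L,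
    lam_dotProduct, sub_div]
  ring

/-- The weighted integrals in `Γ` in terms of the backstepping kernels `F` and `H`. -/
theorem integral_Psi_add_integral_Phi (P : Plant n m) (κ : ℕ → ℝ) {Z W : ℝ → ℝ} (hZ : Continuous Z)
    (hW : Continuous W) :
    (∫ y in (0 : ℝ)..1, P.Psi κ 1 y * Z y) + (∫ y in (0 : ℝ)..1, P.Phi κ 1 y * W y)
      = (∫ y in (0 : ℝ)..1, P.F 1 y * Z y) + (∫ y in (0 : ℝ)..1, P.H 1 y * W y)
        - ∫ x in (0 : ℝ)..1, P.L κ 1 x *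
          (W x - (∫ y in (0 : ℝ)..x, P.F x y * Z y) - ∫ y in (0 : ℝ)..x, P.H x y * W y) := by
  have hL : Continuous fun y => P.L κ 1 y :=
    Continuous.comp (g := Function.uncurry (P.L κ)) (f := fun y : ℝ => ((1 : ℝ), y))
      (P.contDiff_L κ).continuous (by fun_prop)
  have hF1 : Continuous fun y => P.F 1 y :=
    Continuous.comp (g := Function.uncurry P.F) (f := fun y : ℝ => ((1 : ℝ), y))
      P.contDiff_F.continuous (by fun_prop)
  have hH1 : Continuous fun y => P.H 1 y :=
    Continuous.comp (g := Function.uncurry P.H) (f := fun y : ℝ => ((1 : ℝ), y))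
      P.contDiff_H.continuous (by fun_prop)
  have hiF : Continuous fun x => ∫ y in (0 : ℝ)..x, P.F x y * Z y :=
    intervalIntegral.continuous_parametric_intervalIntegral_of_continuous
      (f := fun x y => P.F x y * Z y)
      (P.contDiff_F.continuous.mul (hZ.comp continuous_snd)) continuous_id
  have hiH : Continuous fun x => ∫ y in (0 : ℝ)..x, P.H x y * W y :=
    intervalIntegral.continuous_parametric_intervalIntegral_of_continuous
      (f := fun x y => P.H x y * W y)
      (P.contDiff_H.continuous.mul (hW.comp continuous_snd)) continuous_id
  have cF : Continuous fun y => ∫ r in y..1, P.L κ 1 r * P.F r y := by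
    refine ((P.contDiff_Psi_one κ).continuous.sub hF1).congr fun y => ?_
    simp only [Pi.sub_apply, Psi]; ring
  have cH : Continuous fun y => ∫ r in y..1, P.L κ 1 r * P.H r y := by
    refine ((P.contDiff_Phi_one κ).continuous.sub (hH1.sub hL)).congr fun y => ?_
    simp only [Pi.sub_apply, Phi]; ring
  have hI : ∀ {f g : ℝ → ℝ}, Continuous f → Continuous g →
      IntervalIntegrable (fun y => f y * g y) MeasureTheory.volume 0 1 := fun hf hg =>
    (hf.mul hg).intervalIntegrable _ _
  have hPsi : ∫ y in (0 : ℝ)..1, P.Psi κ 1 y * Z y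
      = (∫ y in (0 : ℝ)..1, P.F 1 y * Z y)
        + ∫ y in (0 : ℝ)..1, (∫ r in y..1, P.L κ 1 r * P.F r y) * Z y := by
    rw [← intervalIntegral.integral_add (hI hF1 hZ)
      (hI cF hZ)]
    exact intervalIntegral.integral_congr fun y _ => add_mul _ _ _
  have hPhi : ∫ y in (0 : ℝ)..1, P.Phi κ 1 y * W y
      = (∫ y in (0 : ℝ)..1, P.H 1 y * W y) - (∫ y in (0 : ℝ)..1, P.L κ 1 y * W y)
        + ∫ y in (0 : ℝ)..1, (∫ r in y..1, P.L κ 1 r * P.H r y) * W y := by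
    rw [← intervalIntegral.integral_sub (hI hH1 hW)
      (hI hL hW), ← intervalIntegral.integral_add
      ((hI hH1 hW).sub (hI hL hW)) (hI cH hW)]
    refine intervalIntegral.integral_congr fun y _ => ?_
    simp only [Phi]
    ring
  have hLeta : ∫ x in (0 : ℝ)..1, P.L κ 1 x *
        (W x - (∫ y in (0 : ℝ)..x, P.F x y * Z y) - ∫ y in (0 : ℝ)..x, P.H x y * W y)
      = (∫ x in (0 : ℝ)..1, P.L κ 1 x * W x)
        - (∫ x in (0 : ℝ)..1, P.L κ 1 x * ∫ y in (0 : ℝ)..x, P.F x y * Z y)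
        - ∫ x in (0 : ℝ)..1, P.L κ 1 x * ∫ y in (0 : ℝ)..x, P.H x y * W y := by
    rw [← intervalIntegral.integral_sub (hI hL hW)
      (hI hL hiF), ← intervalIntegral.integral_sub
      ((hI hL hW).sub (hI hL hiF)) (hI hL hiH)]
    refine intervalIntegral.integral_congr fun x _ => ?_
    ring
  rw [hPsi, hPhi, hLeta, integral_triangle_swap hL hZ P.contDiff_F.continuous,
    integral_triangle_swap hL hW P.contDiff_H.continuous]
  ring

/-- The predictor identity: after the transport delay, the input `w(0,·)` of the distal ODE is the
nominal feedback `K Y` plus the first error variable `w(1,·) - Γ`. -/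
theorem TransportPair.w_zero_eq_feedback (h : P.TransportPair z w) (hq₁ : 0 < P.q₁)
    (hq₂ : 0 < P.q₂) (κ : ℕ → ℝ) {Y : ℝ → Fin n → ℝ}
    (hY : ∀ t, 0 ≤ t → HasDerivWithinAt Y (P.A *ᵥ (Y t) + w 0 t • P.B) (Ici 0) t)
    {t : ℝ} (ht : 0 ≤ t) :
    w 0 (t + 1 / P.q₂) = P.K κ ⬝ᵥ Y (t + 1 / P.q₂) + (w 1 t - P.Gamma κ z w Y 0 t) := by
  have h01 : (1 : ℝ) ∈ Icc (0 : ℝ) 1 := by simp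
  obtain ⟨Z, S, W, T, e⟩ := h.exists_extension hq₁ hq₂
  have hZt : Continuous fun y => Z y t := e.Z_cont.comp (by fun_prop : Continuous fun y => (y, t))
  have hWt : Continuous fun y => W y t := e.W_cont.comp (by fun_prop : Continuous fun y => (y, t))
  have hcz : ∀ (f : ℝ → ℝ) {x : ℝ}, x ∈ Icc (0 : ℝ) 1 →
      ∫ y in (0 : ℝ)..x, f y * z y t = ∫ y in (0 : ℝ)..x, f y * Z y t := fun f x hx => by
    refine intervalIntegral.integral_congr fun y hy => ?_
    rw [uIcc_of_le hx.1] at hy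
    simp only [e.Z_eq y ⟨hy.1, hy.2.trans hx.2⟩ t ht]
  have hcw : ∀ (f : ℝ → ℝ) {x : ℝ}, x ∈ Icc (0 : ℝ) 1 →
      ∫ y in (0 : ℝ)..x, f y * w y t = ∫ y in (0 : ℝ)..x, f y * W y t := fun f x hx => by
    refine intervalIntegral.integral_congr fun y hy => ?_
    rw [uIcc_of_le hx.1] at hy
    simp only [e.W_eq y ⟨hy.1, hy.2.trans hx.2⟩ t ht]
  have heta : ∀ x ∈ Icc (0 : ℝ) 1, P.eta z w x t
      = W x t - (∫ y in (0 : ℝ)..x, P.F x y * Z y t) - ∫ y in (0 : ℝ)..x, P.H x y * W y t :=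
    fun x hx => by rw [eta, hcz (P.F x) hx, hcw (P.H x) hx, e.W_eq x hx t ht]
  have hLeta : ∫ x in (0 : ℝ)..1, P.L κ 1 x * P.eta z w x t = ∫ x in (0 : ℝ)..1, P.L κ 1 x *
      (W x t - (∫ y in (0 : ℝ)..x, P.F x y * Z y t) - ∫ y in (0 : ℝ)..x, P.H x y * W y t) := by
    refine intervalIntegral.integral_congr fun x hx => ?_
    rw [uIcc_of_le zero_le_one] at hx
    simp only [heta x hx]
  have hGamma : P.Gamma κ z w Y 0 t = (∫ y in (0 : ℝ)..1, P.Psi κ 1 y * z y t)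
      + (∫ y in (0 : ℝ)..1, P.Phi κ 1 y * w y t) + P.lam κ 1 ⬝ᵥ Y t := by
    simp [Gamma, RP]
  have hpred := h.K_dotProduct_prediction hq₁ hq₂ κ hY ht
  -- the continuous extensions agree with the states and provide integrability for all endpoints
  have hPP := P.integral_Psi_add_integral_Phi κ hZt hWt
  have hw := h.w_zero_eq_eta hq₁ hq₂ h01 ht
  rw [heta 1 h01, e.W_eq 1 h01 t ht] at hw
  rw [hcz (P.Psi κ 1) h01, hcw (P.Phi κ 1) h01] at hGamma
  rw [hw, hpred, hGamma, hLeta]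
  linear_combination hPP

end Plant

/-! ### Scalar linear comparison and exponential decay -/

/-- Positivity of the solutions of `u' = -c u + v`, `v ≥ 0`. -/
theorem nonneg_of_linear_ode {u v : ℝ → ℝ} {c a : ℝ}
    (hu : ∀ t, a ≤ t → HasDerivWithinAt u (-c * u t + v t) (Ici a) t)
    (hv : ∀ t, a ≤ t → 0 ≤ v t) (h0 : 0 ≤ u a) {t : ℝ} (ht : a ≤ t) : 0 ≤ u t := by
  have hexp : ∀ s, HasDerivAt (fun s => Real.exp (c * s)) (Real.exp (c * s) * c) s := fun s => by
    simpa using ((hasDerivAt_id s).const_mul c).exp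
  have hd : ∀ s, a ≤ s → HasDerivWithinAt (fun s => Real.exp (c * s) * u s)
      (Real.exp (c * s) * v s) (Ici a) s := fun s hs =>
    ((hexp s).hasDerivWithinAt.mul (hu s hs)).congr_deriv (by ring)
  have hmono : MonotoneOn (fun s => Real.exp (c * s) * u s) (Ici a) := by
    refine monotoneOn_of_deriv_nonneg (convex_Ici a) (fun s hs => (hd s hs).continuousWithinAt)
      (fun s hs => ?_) fun s hs => ?_
    · rw [interior_Ici] at hs ⊢
      exact ((hd s hs.le).hasDerivAt (Ici_mem_nhds hs)).differentiableAt.differentiableWithinAt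
    · rw [interior_Ici] at hs
      rw [((hd s hs.le).hasDerivAt (Ici_mem_nhds hs)).deriv]
      exact mul_nonneg (Real.exp_pos _).le (hv s hs.le)
  have h1 : Real.exp (c * a) * u a ≤ Real.exp (c * t) * u t := hmono self_mem_Ici ht ht
  exact nonneg_of_mul_nonneg_right ((mul_nonneg (Real.exp_pos _).le h0).trans h1) (Real.exp_pos _)

/-- Exponential decay at infinity, with an unspecified rate. -/
def ExpDecay (f : ℝ → ℝ) : Prop :=
  ∃ σ : ℝ, 0 < σ ∧ f =O[atTop] fun t => Real.exp (-σ * t)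

theorem exp_isBigO_exp {σ τ : ℝ} (h : τ ≤ σ) :
    (fun t => Real.exp (-σ * t)) =O[atTop] fun t => Real.exp (-τ * t) := by
  refine Asymptotics.IsBigO.of_bound 1 ?_
  filter_upwards [eventually_ge_atTop 0] with t ht
  rw [Real.norm_eq_abs, Real.norm_eq_abs, Real.abs_exp, Real.abs_exp, one_mul]
  exact Real.exp_le_exp.2 (by nlinarith)

theorem expDecay_iff {f : ℝ → ℝ} : ExpDecay f ↔
    ∃ σ C b : ℝ, 0 < σ ∧ 0 < C ∧ ∀ t, b ≤ t → |f t| ≤ C * Real.exp (-σ * t) := by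
  constructor
  · rintro ⟨σ, hσ, h⟩
    obtain ⟨C, hC, hb⟩ := h.exists_pos
    obtain ⟨b, hb⟩ := eventually_atTop.1 hb.bound
    refine ⟨σ, C, b, hσ, hC, fun t ht => ?_⟩
    simpa only [Real.norm_eq_abs, Real.abs_exp] using hb t ht
  · rintro ⟨σ, C, b, hσ, -, h⟩
    refine ⟨σ, hσ, Asymptotics.IsBigO.of_bound C ?_⟩
    filter_upwards [eventually_ge_atTop b] with t ht
    simpa only [Real.norm_eq_abs, Real.abs_exp] using h t ht

theorem ExpDecay.of_isBigO {E : Type*} [SeminormedAddCommGroup E] {f : ℝ → ℝ} {g : ℝ → E}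
    (hg : ExpDecay fun t => ‖g t‖) (h : f =O[atTop] g) : ExpDecay f := by
  obtain ⟨σ, hσ, hb⟩ := hg
  exact ⟨σ, hσ, h.norm_right.trans hb⟩

theorem ExpDecay.congr {f g : ℝ → ℝ} (hf : ExpDecay f) (h : f =ᶠ[atTop] g) : ExpDecay g := by
  obtain ⟨σ, hσ, hb⟩ := hf
  exact ⟨σ, hσ, hb.congr' h EventuallyEq.rfl⟩

theorem ExpDecay.add {f g : ℝ → ℝ} (hf : ExpDecay f) (hg : ExpDecay g) :
    ExpDecay fun t => f t + g t := by
  obtain ⟨σ, hσ, hf⟩ := hf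
  obtain ⟨τ, hτ, hg⟩ := hg
  exact ⟨min σ τ, lt_min hσ hτ, (hf.trans (exp_isBigO_exp (min_le_left _ _))).add
    (hg.trans (exp_isBigO_exp (min_le_right _ _)))⟩

theorem expDecay_zero : ExpDecay fun _ => 0 :=
  ⟨1, one_pos, Asymptotics.isBigO_zero _ _⟩

theorem ExpDecay.const_mul {f : ℝ → ℝ} (hf : ExpDecay f) (c : ℝ) : ExpDecay fun t => c * f t := by
  obtain ⟨σ, hσ, hf⟩ := hf
  exact ⟨σ, hσ, hf.const_mul_left c⟩

theorem ExpDecay.neg {f : ℝ → ℝ} (hf : ExpDecay f) : ExpDecay fun t => -f t := by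
  simpa using hf.const_mul (-1)

theorem ExpDecay.sub {f g : ℝ → ℝ} (hf : ExpDecay f) (hg : ExpDecay g) :
    ExpDecay fun t => f t - g t := by
  simpa only [sub_eq_add_neg] using hf.add hg.neg

theorem ExpDecay.sum {ι : Type*} {s : Finset ι} {f : ι → ℝ → ℝ} (h : ∀ i ∈ s, ExpDecay (f i)) :
    ExpDecay fun t => ∑ i ∈ s, f i t := by
  induction s using Finset.cons_induction with
  | empty => simpa using expDecay_zero
  | cons a s ha ih =>
    simp only [Finset.sum_cons]
    exact (h a (Finset.mem_cons_self _ _)).add (ih fun i hi => h i (Finset.mem_cons_of_mem hi))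

/-- A product of a bounded and an exponentially decaying factor. -/
theorem ExpDecay.bounded_mul {f g : ℝ → ℝ} (hg : ExpDecay g)
    (hf : f =O[atTop] fun _ => (1 : ℝ)) : ExpDecay fun t => f t * g t := by
  obtain ⟨σ, hσ, hg⟩ := hg
  exact ⟨σ, hσ, by simpa using hf.mul hg⟩

theorem ExpDecay.tendsto {f : ℝ → ℝ} (hf : ExpDecay f) : Tendsto f atTop (𝓝 0) := by
  obtain ⟨σ, hσ, hf⟩ := hf
  refine hf.trans_tendsto ?_
  have : Tendsto (fun t : ℝ => -σ * t) atTop atBot :=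
      tendsto_id.const_mul_atTop_of_neg (by linarith)
  exact Real.tendsto_exp_atBot.comp this

theorem ExpDecay.mul {f g : ℝ → ℝ} (hf : ExpDecay f) (hg : ExpDecay g) :
    ExpDecay fun t => f t * g t :=
  hg.bounded_mul (hf.tendsto.isBigO_one ℝ)

theorem ExpDecay.comp_sub {f : ℝ → ℝ} (hf : ExpDecay f) (T : ℝ) : ExpDecay fun t => f (t - T) := by
  obtain ⟨σ, C, b, hσ, hC, h⟩ := expDecay_iff.1 hf
  refine expDecay_iff.2 ⟨σ, C * Real.exp (σ * T), b + T, hσ, by positivity, fun t ht => ?_⟩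
  refine (h (t - T) (by linarith)).trans (le_of_eq ?_)
  rw [mul_assoc, ← Real.exp_add]
  ring_nf

theorem ExpDecay.norm_pi {ι : Type*} [Fintype ι] {V : ℝ → ι → ℝ}
    (h : ∀ i, ExpDecay fun t => V t i) :
    ExpDecay fun t => ‖V t‖ := by
  have hs : ExpDecay fun t => ∑ i, ‖V t i‖ := ExpDecay.sum fun i _ => by
    obtain ⟨σ, hσ, hb⟩ := h i
    exact ⟨σ, hσ, hb.norm_left⟩
  obtain ⟨σ, hσ, hb⟩ := hs
  refine ⟨σ, hσ, Asymptotics.IsBigO.trans ?_ hb⟩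
  refine Asymptotics.IsBigO.of_bound 1 (Eventually.of_forall fun t => ?_)
  rw [one_mul, norm_norm, Real.norm_of_nonneg (Finset.sum_nonneg fun i _ => norm_nonneg _)]
  exact (pi_norm_le_iff_of_nonneg (Finset.sum_nonneg fun i _ => norm_nonneg _)).2 fun i =>
    Finset.single_le_sum (f := fun i => ‖V t i‖) (fun i _ => norm_nonneg _) (Finset.mem_univ i)

/-- An exponentially decaying function that is continuous on `[0, ∞)` is bounded there by an
exponential. -/
theorem ExpDecay.exists_bound {f : ℝ → ℝ} (hf : ExpDecay f) (hc : ContinuousOn f (Ici 0)) :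
    ∃ C σ : ℝ, 0 < σ ∧ ∀ t, 0 ≤ t → |f t| ≤ C * Real.exp (-σ * t) := by
  obtain ⟨σ, C, b, hσ, hC, h⟩ := expDecay_iff.1 hf
  obtain ⟨M, hM⟩ := (isCompact_Icc (a := 0) (b := b)).exists_bound_of_continuousOn
    (hc.mono Icc_subset_Ici_self)
  refine ⟨max C (M * Real.exp (σ * b)), σ, hσ, fun t ht => ?_⟩
  rcases le_total b t with hb | hb
  · exact (h t hb).trans (mul_le_mul_of_nonneg_right (le_max_left _ _) (Real.exp_pos _).le)
  · have hMt := hM t ⟨ht, hb⟩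
    have hM0 : 0 ≤ M := (norm_nonneg _).trans hMt
    refine (hMt.trans ?_).trans
      (mul_le_mul_of_nonneg_right (le_max_right _ _) (Real.exp_pos _).le)
    rw [mul_assoc, ← Real.exp_add]
    exact le_mul_of_one_le_right hM0 (Real.one_le_exp (by nlinarith))

/-- Solutions of `u' = -c u + v` with `c > 0` inherit the exponential decay of `v`. -/
theorem ExpDecay.of_linear_ode {u v : ℝ → ℝ} {c a : ℝ} (hc : 0 < c)
    (hu : ∀ t, a ≤ t → HasDerivWithinAt u (-c * u t + v t) (Ici a) t) (hv : ExpDecay v) :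
    ExpDecay u := by
  obtain ⟨σ, C, b₀, hσ, hC, hb⟩ := expDecay_iff.1 hv
  -- the barrier `D exp (-τ t)`, whose rate `τ` lies below both `σ` and `c`
  set b := max a b₀
  set τ := min σ (c / 2) with hτ
  have hτ0 : 0 < τ := lt_min hσ (by linarith)
  have hτc : 0 < c - τ := by linarith [min_le_right σ (c / 2)]
  set D := C / (c - τ) * Real.exp (max 0 (-(σ - τ) * b)) + |u b| * Real.exp (τ * b) with hD
  have hD0 : 0 < D := by positivity
  have hvb : ∀ t, b ≤ t → |v t| ≤ (c - τ) * D * Real.exp (-τ * t) := fun t ht => by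
    have h1 := hb t ((le_max_right _ _).trans ht)
    have h2 : C * Real.exp (max 0 (-(σ - τ) * b)) ≤ (c - τ) * D := by
      rw [hD, mul_add, ← mul_assoc, mul_div_cancel₀ _ hτc.ne']
      exact le_add_of_nonneg_right (by positivity)
    have h3 : Real.exp (-σ * t) ≤ Real.exp (max 0 (-(σ - τ) * b)) * Real.exp (-τ * t) := by
      rw [← Real.exp_add]
      refine Real.exp_le_exp.2 ?_
      have : 0 ≤ σ - τ := by linarith [min_le_left σ (c / 2)]
      nlinarith [le_max_right 0 (-(σ - τ) * b), mul_le_mul_of_nonneg_left ht this]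
    calc |v t| ≤ C * Real.exp (-σ * t) := h1
      _ ≤ C * (Real.exp (max 0 (-(σ - τ) * b)) * Real.exp (-τ * t)) := by gcongr
      _ = C * Real.exp (max 0 (-(σ - τ) * b)) * Real.exp (-τ * t) := by ring
      _ ≤ _ := by gcongr
  have hexp : ∀ s, HasDerivAt (fun s => D * Real.exp (-τ * s)) (D * (Real.exp (-τ * s) * (-τ))) s :=
    fun s => by simpa using ((hasDerivAt_id s).const_mul (-τ)).exp.const_mul D
  have hub : ∀ t, b ≤ t → HasDerivWithinAt u (-c * u t + v t) (Ici b) t := fun t ht =>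
    (hu t ((le_max_left _ _).trans ht)).mono (Ici_subset_Ici.2 (le_max_left _ _))
  have hini : |u b| ≤ D * Real.exp (-τ * b) := by
    rw [hD, add_mul, mul_assoc |u b|, ← Real.exp_add]
    have : τ * b + -τ * b = 0 := by ring
    rw [this, Real.exp_zero, mul_one]
    exact le_add_of_nonneg_left (by positivity)
  refine expDecay_iff.2 ⟨τ, D, b, hτ0, hD0, fun t ht => abs_le.2 ⟨?_, ?_⟩⟩
  · have := nonneg_of_linear_ode (a := b) (c := c) (u := fun s => D * Real.exp (-τ * s) + u s)
      (v := fun s => (c - τ) * D * Real.exp (-τ * s) + v s)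
      (fun s hs => ((hexp s).hasDerivWithinAt.add (hub s hs)).congr_deriv (by ring))
      (fun s hs => by linarith [neg_abs_le (v s), hvb s hs]) (by linarith [neg_abs_le (u b)]) ht
    linarith
  · have := nonneg_of_linear_ode (a := b) (c := c) (u := fun s => D * Real.exp (-τ * s) - u s)
      (v := fun s => (c - τ) * D * Real.exp (-τ * s) - v s)
      (fun s hs => ((hexp s).hasDerivWithinAt.sub (hub s hs)).congr_deriv (by ring))
      (fun s hs => by linarith [le_abs_self (v s), hvb s hs]) (by linarith [le_abs_self (u b)]) ht
    linarith

/-! ### Backstepping of the distal ODE -/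

theorem extendZero_of_lt {m : ℕ} (X : Fin m → ℝ) {k : ℕ} (h : k < m) : extendZero X k = X ⟨k, h⟩ :=
  dif_pos h

theorem extendZero_of_ge {m : ℕ} (X : Fin m → ℝ) {k : ℕ} (h : m ≤ k) : extendZero X k = 0 :=
  dif_neg h.not_gt

theorem extendZero_fin {m : ℕ} (X : Fin m → ℝ) (k : Fin m) : extendZero X k = X k :=
  dif_pos k.2

theorem gCoef_succ (κ : ℕ → ℝ) (i j : ℕ) : gCoef κ (i + 1) j =
    -κ i * ((if j = i then 1 else 0) - gCoef κ i j) + gShift κ i j := by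
  cases j with
  | zero => simp [gCoef, gShift]
  | succ j => simp [gCoef, gShift]

theorem gCoef_eq_zero (κ : ℕ → ℝ) {i j : ℕ} (h : i ≤ j) : gCoef κ i j = 0 := by
  induction i generalizing j with
  | zero => simp [gCoef]
  | succ i ih =>
    obtain ⟨j, rfl⟩ : ∃ k, j = k + 1 := ⟨j - 1, by omega⟩
    rw [gCoef_succ, if_neg (by omega), ih (by omega)]
    simp [gShift, ih (show i ≤ j by omega)]

/-- The error variables `z_{i+1} = y_{i+1} - g_i(y)` of the distal ODE. -/
def distalError {n : ℕ} (κ : ℕ → ℝ) (y : Fin n → ℝ) (i : ℕ) : ℝ :=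
  extendZero y i - ∑ j : Fin n, gCoef κ i j * y j

theorem distalError_succ {n : ℕ} (κ : ℕ → ℝ) (y : Fin n → ℝ) {i : ℕ} (hi : i < n) :
    distalError κ y (i + 1) =
      extendZero y (i + 1) + κ i * distalError κ y i - ∑ j : Fin n, gShift κ i j * y j := by
  have h1 : ∑ j : Fin n, (if (j : ℕ) = i then (1 : ℝ) else 0) * y j = extendZero y i := by
    rw [extendZero_of_lt y hi, Finset.sum_eq_single ⟨i, hi⟩]
    · simp
    · intro j _ hj
      rw [if_neg (fun h => hj (Fin.ext h)), zero_mul]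
    · simp
  have h2 : ∑ j : Fin n, gCoef κ (i + 1) j * y j
      = -κ i * (extendZero y i - ∑ j : Fin n, gCoef κ i j * y j)
        + ∑ j : Fin n, gShift κ i j * y j := by
    rw [← h1, ← Finset.sum_sub_distrib, Finset.mul_sum, ← Finset.sum_add_distrib]
    refine Finset.sum_congr rfl fun j _ => ?_
    rw [gCoef_succ]
    ring
  unfold distalError
  rw [h2]
  ring

/-- `g_i` involves `y_1, …, y_i` only, so that its derivative along `y_j' = y_{j+1}` is given by
`gShift`, without a boundary term. -/
theorem sum_gCoef_shift {n : ℕ} (κ : ℕ → ℝ) (y : Fin n → ℝ) {i : ℕ} (hi : i < n) :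
    ∑ j : Fin n, gCoef κ i j * extendZero y (j + 1) = ∑ j : Fin n, gShift κ i j * y j := by
  obtain ⟨N, rfl⟩ : ∃ N, n = N + 1 := ⟨n - 1, by omega⟩
  have h1 : ∑ j : Fin (N + 1), gShift κ i j * y j
      = ∑ j : Fin (N + 1), gShift κ i j * extendZero y j :=
    Finset.sum_congr rfl fun j _ => by rw [extendZero_fin]
  rw [h1, ← Finset.sum_range (fun j => gCoef κ i j * extendZero y (j + 1)),
    ← Finset.sum_range (fun j => gShift κ i j * extendZero y j), Finset.sum_range_succ,
    Finset.sum_range_succ' (fun j => gShift κ i j * extendZero y j),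
    gCoef_eq_zero κ (show i ≤ N by omega)]
  simp [gShift]

namespace Plant

variable {n m : ℕ} {P : Plant n m}

open Matrix

theorem A_mulVec_of_lt (y : Fin n → ℝ) {i : ℕ} (hi : i + 1 < n) :
    (P.A *ᵥ y) ⟨i, by omega⟩ = extendZero y (i + 1) := by
  rw [extendZero_of_lt y hi]
  simp only [Matrix.mulVec, dotProduct, A]
  rw [Finset.sum_eq_single ⟨i + 1, hi⟩]
  · simp [hi.ne]
  · intro j _ hj
    rw [if_neg hi.ne, if_neg (fun h => hj (Fin.ext h)), zero_mul]
  · simp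

theorem A_mulVec_last (y : Fin n → ℝ) {i : Fin n} (hi : (i : ℕ) + 1 = n) :
    (P.A *ᵥ y) i = ∑ j, P.l j * y j := by
  simp only [Matrix.mulVec, dotProduct, A, if_pos hi]

/-- The error variables of the distal ODE form a stable chain, driven by the mismatch `h` of the
input and the nominal feedback. -/
theorem hasDerivWithinAt_distalError (hb : 0 < P.b) (κ : ℕ → ℝ) {Y : ℝ → Fin n → ℝ} {u h : ℝ → ℝ}
    {T : ℝ} (hY : ∀ t, T ≤ t → HasDerivWithinAt Y (P.A *ᵥ (Y t) + u t • P.B) (Ici T) t)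
    (hu : ∀ t, T ≤ t → u t = P.K κ ⬝ᵥ Y t + h t) {i : ℕ} (hi : i < n) {t : ℝ} (ht : T ≤ t) :
    HasDerivWithinAt (fun t => distalError κ (Y t) i)
      (-κ i * distalError κ (Y t) i
        + if i + 1 = n then P.b * h t else distalError κ (Y t) (i + 1)) (Ici T) t := by
  have hYi := hasDerivWithinAt_pi.1 (hY t ht)
  have hlow : ∀ (j : ℕ) (hj : j + 1 < n), HasDerivWithinAt (fun t => Y t ⟨j, by omega⟩)
      (extendZero (Y t) (j + 1)) (Ici T) t := fun j hj => by
    refine (hYi ⟨j, by omega⟩).congr_deriv ?_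
    rw [Pi.add_apply, A_mulVec_of_lt _ hj, Pi.smul_apply, B]
    simp [hj.ne]
  have hsum : HasDerivWithinAt (fun t => ∑ j : Fin n, gCoef κ i j * Y t j)
      (∑ j : Fin n, gShift κ i j * Y t j) (Ici T) t := by
    rw [← sum_gCoef_shift κ (Y t) hi]
    refine HasDerivWithinAt.fun_sum fun j _ => ?_
    rcases lt_or_ge (j : ℕ) i with hj | hj
    · exact (hlow j (by omega)).const_mul _
    · rw [gCoef_eq_zero κ hj]
      simpa using hasDerivWithinAt_const t (Ici T) (0 : ℝ)
  unfold distalError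
  simp only [extendZero_of_lt _ hi]
  split_ifs with hin
  · refine ((hYi ⟨i, hi⟩).sub hsum).congr_deriv ?_
    rw [Pi.add_apply, A_mulVec_last _ hin, Pi.smul_apply, B, if_pos hin, hu t ht, smul_eq_mul]
    have hK : P.b * (P.K κ ⬝ᵥ Y t) = -(∑ j, P.l j * Y t j) + (∑ j : Fin n, gShift κ i j * Y t j)
        + κ i * (∑ j : Fin n, gCoef κ i j * Y t j) - κ i * Y t ⟨i, hi⟩ := by
      have h1 : κ i * Y t ⟨i, hi⟩ = ∑ j : Fin n, (if (j : ℕ) + 1 = n then κ i else 0) * Y t j := by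
        rw [Finset.sum_eq_single ⟨i, hi⟩]
        · simp [hin]
        · intro j _ hj
          rw [if_neg (fun h => hj (Fin.ext (by simp only; omega))), zero_mul]
        · simp
      rw [h1, dotProduct, Finset.mul_sum, Finset.mul_sum, ← Finset.sum_neg_distrib,
        ← Finset.sum_add_distrib, ← Finset.sum_add_distrib, ← Finset.sum_sub_distrib]
      refine Finset.sum_congr rfl fun j _ => ?_
      rw [K, show n - 1 = i by omega]
      have := hb.ne'
      field_simp
    linear_combination hK
  · refine ((hlow i (by omega)).sub hsum).congr_deriv ?_
    have := distalError_succ κ (Y t) hi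
    unfold distalError at this
    rw [extendZero_of_lt _ hi] at this
    linear_combination -this

/-- The gain conditions make all error variables positive at the arrival of the control action. -/
theorem distalError_pos {κ : ℕ → ℝ} {z₀ w₀ : ℝ → ℝ} {Y₀ : Fin n → ℝ} (hn : 1 ≤ n)
    (hκ : ∀ i, i + 1 < n → P.kappaCheck κ z₀ w₀ Y₀ i < κ i)
    (h1 : 0 < P.YArrival z₀ w₀ Y₀ ⟨0, hn⟩) {i : ℕ} (hi : i < n) :
    0 < distalError κ (P.YArrival z₀ w₀ Y₀) i := by
  induction i with
  | zero =>
    simpa [distalError, gCoef, extendZero_of_lt _ hi] using h1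
  | succ i ih =>
    have hpos := ih (by omega)
    have hk := hκ i hi
    rw [kappaCheck] at hk
    change _ / distalError κ (P.YArrival z₀ w₀ Y₀) i < κ i at hk
    rw [div_lt_iff₀ hpos] at hk
    rw [distalError_succ κ _ (by omega)]
    linarith

/-- A nonnegative input mismatch propagates down the chain, from the last error to the first. -/
theorem distalError_nonneg (hb : 0 < P.b) {κ : ℕ → ℝ} {Y : ℝ → Fin n → ℝ} {u h : ℝ → ℝ}
    {T : ℝ} (hY : ∀ t, T ≤ t → HasDerivWithinAt Y (P.A *ᵥ (Y t) + u t • P.B) (Ici T) t)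
    (hu : ∀ t, T ≤ t → u t = P.K κ ⬝ᵥ Y t + h t) (hh : ∀ t, T ≤ t → 0 ≤ h t)
    (hini : ∀ i < n, 0 < distalError κ (Y T) i) {i : ℕ} (hi : i < n) {t : ℝ} (ht : T ≤ t) :
    0 ≤ distalError κ (Y t) i := by
  obtain ⟨d, hd⟩ : ∃ d, d = n - 1 - i := ⟨_, rfl⟩
  induction d generalizing i t with
  | zero =>
    refine nonneg_of_linear_ode (fun s hs => hasDerivWithinAt_distalError hb κ hY hu hi hs)
      (fun s hs => ?_) (hini i hi).le ht
    rw [if_pos (by omega)]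
    exact mul_nonneg hb.le (hh s hs)
  | succ d ih =>
    refine nonneg_of_linear_ode (fun s hs => hasDerivWithinAt_distalError hb κ hY hu hi hs)
      (fun s hs => ?_) (hini i hi).le ht
    rw [if_neg (by omega)]
    exact ih (by omega) hs (by omega)

theorem expDecay_distalError (hb : 0 < P.b) {κ : ℕ → ℝ} (hκ : ∀ i < n, 0 < κ i)
    {Y : ℝ → Fin n → ℝ} {u h : ℝ → ℝ}
    {T : ℝ} (hY : ∀ t, T ≤ t → HasDerivWithinAt Y (P.A *ᵥ (Y t) + u t • P.B) (Ici T) t)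
    (hu : ∀ t, T ≤ t → u t = P.K κ ⬝ᵥ Y t + h t) (hh : ExpDecay h) {i : ℕ} (hi : i < n) :
    ExpDecay fun t => distalError κ (Y t) i := by
  obtain ⟨d, hd⟩ : ∃ d, d = n - 1 - i := ⟨_, rfl⟩
  induction d generalizing i with
  | zero =>
    refine ExpDecay.of_linear_ode (hκ i hi)
      (fun s hs => hasDerivWithinAt_distalError hb κ hY hu hi hs) ?_
    simp only [if_pos (show i + 1 = n by omega)]
    exact hh.const_mul _
  | succ d ih =>
    refine ExpDecay.of_linear_ode (hκ i hi)
      (fun s hs => hasDerivWithinAt_distalError hb κ hY hu hi hs) ?_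
    simp only [if_neg (show ¬i + 1 = n by omega)]
    exact ih (by omega) (by omega)

theorem expDecay_of_distalError {κ : ℕ → ℝ} {Y : ℝ → Fin n → ℝ}
    (h : ∀ i < n, ExpDecay fun t => distalError κ (Y t) i) (i : Fin n) :
    ExpDecay fun t => Y t i := by
  obtain ⟨i, hi⟩ := i
  induction i using Nat.strong_induction_on with
  | _ i ih =>
    have h1 : ExpDecay fun t => ∑ j : Fin n, gCoef κ i j * Y t j := ExpDecay.sum fun j _ => by
      rcases lt_or_ge (j : ℕ) i with hj | hj
      · exact (ih j hj j.2).const_mul _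
      · simpa [gCoef_eq_zero κ hj] using expDecay_zero
    refine ((h i hi).add h1).congr (Eventually.of_forall fun t => ?_)
    simp [distalError, extendZero_of_lt _ hi]

end Plant

/-! ### Backstepping of the actuator ODE -/

theorem extendZero_update {m : ℕ} (v : Fin m → ℝ) {j : ℕ} (hj : j < m) (s : ℝ) :
    extendZero (Function.update v ⟨j, hj⟩ s) = Function.update (extendZero v) j s := by
  funext k
  rcases lt_or_ge k m with hk | hk
  · rw [extendZero_of_lt _ hk]
    by_cases hkj : k = j
    · subst hkj; simp
    · rw [Function.update_of_ne (fun h => hkj (by simpa using h)), Function.update_of_ne hkj,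
        extendZero_of_lt _ hk]
  · rw [extendZero_of_ge _ hk, Function.update_of_ne (by omega), extendZero_of_ge _ hk]

theorem extendZero_zero {m : ℕ} : extendZero (0 : Fin m → ℝ) = 0 := by
  funext k; unfold extendZero; split_ifs <;> rfl

theorem contDiff_extendZero {m : ℕ} (k : ℕ) {N : WithTop ℕ∞} :
    ContDiff ℝ N fun v : Fin m → ℝ => extendZero v k := by
  unfold extendZero
  split_ifs
  · fun_prop
  · exact contDiff_const

theorem sum_range_eq_sum_fin {m i : ℕ} (hi : i ≤ m) (g : ℕ → ℝ) :
    ∑ j ∈ Finset.range i, g j = ∑ k : Fin m, if (k : ℕ) < i then g k else 0 := by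
  rw [← Finset.sum_range (fun k => if k < i then g k else 0), ← Finset.sum_filter]
  refine Finset.sum_congr ?_ fun _ _ => rfl
  ext j
  simp only [Finset.mem_range, Finset.mem_filter]
  omega

namespace Plant

variable {n m : ℕ} (P : Plant n m) (c : ℕ → ℝ)

theorem fAt_congr {k : ℕ} {x x' : ℕ → ℝ} (h : ∀ j ≤ k, x j = x' j) : P.fAt k x = P.fAt k x' := by
  unfold fAt
  congr 1
  funext a
  exact h a (by omega)

theorem tau_succ (i : ℕ) (x G : ℕ → ℝ) : P.tau c (i + 1) x G =
    -c i * (x i - P.tau c i x G - G i) - P.fAt i x + P.drift (P.tau c i) i x G := rfl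

/-- `τ_i` depends on the first `i` actuator states and signals only. -/
theorem tau_congr {i : ℕ} {x x' G G' : ℕ → ℝ} (hx : ∀ j < i, x j = x' j)
    (hG : ∀ j < i, G j = G' j) :
    P.tau c i x G = P.tau c i x' G' := by
  induction i generalizing x x' G G' with
  | zero => rfl
  | succ i ih =>
    have hx' : ∀ j < i, x j = x' j := fun j hj => hx j (by omega)
    have hG' : ∀ j < i, G j = G' j := fun j hj => hG j (by omega)
    have hup : ∀ {a b : ℕ → ℝ} (j : ℕ) (s : ℝ), (∀ k < i, a k = b k) →
        ∀ k < i, Function.update a j s k = Function.update b j s k := fun j s h k hk => by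
      by_cases hkj : k = j
      · subst hkj; simp
      · rw [Function.update_of_ne hkj, Function.update_of_ne hkj, h k hk]
    have hdrift : P.drift (P.tau c i) i x G = P.drift (P.tau c i) i x' G' := by
      unfold drift
      refine Finset.sum_congr rfl fun j hj => ?_
      have hj' := Finset.mem_range.1 hj
      rw [hx' j hj', hG' j hj', hx (j + 1) (by omega), hG (j + 1) (by omega),
        P.fAt_congr (k := j) fun k hk => hx k (by omega)]
      congr 3
      · funext s; exact ih (hup j s hx') hG'
      · funext s; exact ih hx' (hup j s hG')
    rw [tau_succ, tau_succ, ih hx' hG', hx i (by omega), hG i (by omega),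
      P.fAt_congr (k := i) fun k hk => hx k (by omega), hdrift]

/-- `τ_i` as a function on a finite-dimensional space: of the vector of the actuator states and of
that of the signals `Γ⁽⁰⁾, …, Γ⁽ᵐ⁻¹⁾`. -/
def tauVec (i : ℕ) (v : (Fin m → ℝ) × (Fin m → ℝ)) : ℝ :=
  P.tau c i (extendZero v.1) (extendZero v.2)

variable {P c}

theorem deriv_tau_left {i j : ℕ} (hj : j < m) {v : (Fin m → ℝ) × (Fin m → ℝ)}
    (hd : DifferentiableAt ℝ (P.tauVec c i) v) :
    deriv (fun s => P.tau c i (Function.update (extendZero v.1) j s) (extendZero v.2))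
      (extendZero v.1 j) = fderiv ℝ (P.tauVec c i) v (Pi.single ⟨j, hj⟩ 1, 0) := by
  have h1 := (hasDerivAt_update v.1 ⟨j, hj⟩ (v.1 ⟨j, hj⟩)).prodMk
    (hasDerivAt_const (v.1 ⟨j, hj⟩) v.2)
  have h2 := hd.hasFDerivAt.comp_hasDerivAt_of_eq (v.1 ⟨j, hj⟩) h1 (by simp)
  rw [extendZero_of_lt _ hj, ← h2.deriv]
  congr 1
  funext s
  simp only [Function.comp_apply, tauVec, extendZero_update]

theorem deriv_tau_right {i j : ℕ} (hj : j < m) {v : (Fin m → ℝ) × (Fin m → ℝ)}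
    (hd : DifferentiableAt ℝ (P.tauVec c i) v) :
    deriv (fun s => P.tau c i (extendZero v.1) (Function.update (extendZero v.2) j s))
      (extendZero v.2 j) = fderiv ℝ (P.tauVec c i) v (0, Pi.single ⟨j, hj⟩ 1) := by
  have h1 := (hasDerivAt_const (v.2 ⟨j, hj⟩) v.1).prodMk
    (hasDerivAt_update v.2 ⟨j, hj⟩ (v.2 ⟨j, hj⟩))
  have h2 := hd.hasFDerivAt.comp_hasDerivAt_of_eq (v.2 ⟨j, hj⟩) h1 (by simp)
  rw [extendZero_of_lt _ hj, ← h2.deriv]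
  congr 1
  funext s
  simp only [Function.comp_apply, tauVec, extendZero_update]

theorem contDiff_fAt (hf : ∀ k < m, ContDiff ℝ ((m - (k + 1) : ℕ) : ℕ∞) (P.f k)) {k : ℕ}
    (hk : k < m) :
    ContDiff ℝ (m - (k + 1) : ℕ) (fun v : Fin m → ℝ => P.fAt k (extendZero v)) := by
  unfold fAt
  exact ContDiff.comp (by exact_mod_cast hf k hk) (contDiff_pi.2 fun a => contDiff_extendZero a)

/-- Every step of the recursion costs one derivative. -/
theorem contDiff_tauVec (hf : ∀ k < m, ContDiff ℝ ((m - (k + 1) : ℕ) : ℕ∞) (P.f k)) {i : ℕ}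
    (hi : i ≤ m) : ContDiff ℝ (m - i : ℕ) (P.tauVec c i) := by
  induction i with
  | zero => exact contDiff_const
  | succ i ih =>
    have h1 := ih (by omega)
    have hsucc : (((m - (i + 1) : ℕ) : WithTop ℕ∞) + 1) = ((m - i : ℕ) : WithTop ℕ∞) := by
      rw [show m - i = (m - (i + 1)) + 1 by omega]; rfl
    have hle : ((m - (i + 1) : ℕ) : WithTop ℕ∞) ≤ ((m - i : ℕ) : WithTop ℕ∞) := by
      exact_mod_cast (by omega : m - (i + 1) ≤ m - i)
    have hdiff : Differentiable ℝ (P.tauVec c i) := h1.differentiable (by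
      exact_mod_cast (by omega : m - i ≠ 0))
    have hfd : ∀ e, ContDiff ℝ (m - (i + 1) : ℕ) fun v => fderiv ℝ (P.tauVec c i) v e := fun e =>
      (h1.fderiv_right hsucc.le).clm_apply contDiff_const
    have hx : ∀ k, ContDiff ℝ (m - (i + 1) : ℕ)
        fun v : (Fin m → ℝ) × (Fin m → ℝ) => extendZero v.1 k := fun k =>
      (contDiff_extendZero k).comp contDiff_fst
    have hG : ∀ k, ContDiff ℝ (m - (i + 1) : ℕ)
        fun v : (Fin m → ℝ) × (Fin m → ℝ) => extendZero v.2 k := fun k =>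
      (contDiff_extendZero k).comp contDiff_snd
    have hfA : ∀ k ≤ i, ContDiff ℝ (m - (i + 1) : ℕ)
        fun v : (Fin m → ℝ) × (Fin m → ℝ) => P.fAt k (extendZero v.1) := fun k hk =>
      ((contDiff_fAt hf (by omega)).of_le (by
        exact_mod_cast (by omega : m - (i + 1) ≤ m - (k + 1)))).comp contDiff_fst
    have hdrift : ContDiff ℝ (m - (i + 1) : ℕ) fun v : (Fin m → ℝ) × (Fin m → ℝ) =>
        P.drift (P.tau c i) i (extendZero v.1) (extendZero v.2) := by
      unfold drift
      refine ContDiff.sum fun j hj => ?_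
      have hj' := Finset.mem_range.1 hj
      simp only [deriv_tau_left (show j < m by omega) (hdiff _),
        deriv_tau_right (show j < m by omega) (hdiff _)]
      exact ((hfd _).mul ((hx _).add (hfA j hj'.le))).add ((hfd _).mul (hG _))
    exact ((contDiff_const.mul (((hx i).sub (h1.of_le hle)).sub (hG i))).sub (hfA i le_rfl)).add
        hdrift

theorem fAt_zero (hf0 : ∀ k < m, P.f k 0 = 0) {k : ℕ} (hk : k < m) : P.fAt k 0 = 0 := hf0 k hk

theorem tau_zero (hf0 : ∀ k < m, P.f k 0 = 0) {i : ℕ} (hi : i ≤ m) : P.tau c i 0 0 = 0 := by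
  induction i with
  | zero => rfl
  | succ i ih =>
    have hdrift : P.drift (P.tau c i) i 0 0 = 0 := by
      unfold drift
      refine Finset.sum_eq_zero fun j hj => ?_
      rw [fAt_zero hf0 (by have := Finset.mem_range.1 hj; omega)]
      simp
    rw [tau_succ, ih (by omega), hdrift, fAt_zero hf0 (by omega)]
    simp

/-- The first `i` entries of a sequence, as a vector that is completed by zeros. -/
def trunc (m i : ℕ) (x : ℕ → ℝ) : Fin m → ℝ := fun k => if (k : ℕ) < i then x k else 0

theorem extendZero_trunc {i : ℕ} (hi : i ≤ m) (x : ℕ → ℝ) {j : ℕ} (hj : j < i) :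
    extendZero (trunc m i x) j = x j := by
  rw [extendZero_of_lt _ (by omega : j < m), trunc, if_pos hj]

theorem tau_eq_tauVec {i : ℕ} (hi : i ≤ m) (x G : ℕ → ℝ) :
    P.tau c i x G = P.tauVec c i (trunc m i x, trunc m i G) :=
  P.tau_congr c (fun _ hj => (extendZero_trunc hi x hj).symm)
    fun _ hj => (extendZero_trunc hi G hj).symm

/-- The derivatives in `drift` are partial derivatives of the differentiable function `tauVec`, and
hence never the default value of `deriv`. -/
theorem drift_eq_fderiv (hf : ∀ k < m, ContDiff ℝ ((m - (k + 1) : ℕ) : ℕ∞) (P.f k)) {i : ℕ}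
    (hi : i < m)
    (x G : ℕ → ℝ) {j : ℕ} (hj : j < i) :
    deriv (fun s => P.tau c i (Function.update x j s) G) (x j)
        = fderiv ℝ (P.tauVec c i) (trunc m i x, trunc m i G) (Pi.single ⟨j, hj.trans hi⟩ 1, 0)
      ∧ deriv (fun s => P.tau c i x (Function.update G j s)) (G j)
        = fderiv ℝ (P.tauVec c i) (trunc m i x, trunc m i G) (0, Pi.single ⟨j, hj.trans hi⟩ 1) := by
  have hdiff : Differentiable ℝ (P.tauVec c i) := (contDiff_tauVec hf hi.le).differentiable (by
      exact_mod_cast (by omega : m - i ≠ 0))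
  have hup : ∀ (a : ℕ → ℝ) (s : ℝ), ∀ k < i,
      Function.update a j s k = Function.update (extendZero (trunc m i a)) j s k :=
    fun a s k hk => by
    by_cases hkj : k = j
    · subst hkj; simp
    · rw [Function.update_of_ne hkj, Function.update_of_ne hkj, extendZero_trunc hi.le a hk]
  constructor
  · rw [← deriv_tau_left (hj.trans hi) (hdiff _), extendZero_trunc hi.le x hj]
    congr 1
    funext s
    exact P.tau_congr c (hup x s) fun k hk => (extendZero_trunc hi.le G hk).symm
  · rw [← deriv_tau_right (hj.trans hi) (hdiff _), extendZero_trunc hi.le G hj]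
    congr 1
    funext s
    exact P.tau_congr c (fun k hk => (extendZero_trunc hi.le x hk).symm) (hup G s)

/-- The chain rule for `τ_i` along the closed loop. -/
theorem hasDerivWithinAt_tau (hf : ∀ k < m, ContDiff ℝ ((m - (k + 1) : ℕ) : ℕ∞) (P.f k)) {i : ℕ}
    (hi : i < m) {x G : ℝ → ℕ → ℝ} {s : Set ℝ} {t : ℝ}
    (hx : ∀ j < i, HasDerivWithinAt (fun t => x t j) (x t (j + 1) + P.fAt j (x t)) s t)
    (hG : ∀ j < i, HasDerivWithinAt (fun t => G t j) (G t (j + 1)) s t) :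
    HasDerivWithinAt (fun t => P.tau c i (x t) (G t)) (P.drift (P.tau c i) i (x t) (G t)) s t := by
  have hdiff : Differentiable ℝ (P.tauVec c i) := (contDiff_tauVec hf hi.le).differentiable (by
      exact_mod_cast (by omega : m - i ≠ 0))
  have htr : ∀ (a : ℝ → ℕ → ℝ) (a' : ℕ → ℝ),
      (∀ j < i, HasDerivWithinAt (fun t => a t j) (a' j) s t) →
      HasDerivWithinAt (fun t => trunc m i (a t)) (trunc m i a') s t := fun a a' h => by
    refine hasDerivWithinAt_pi.2 fun k => ?_
    simp only [trunc]
    split_ifs with hk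
    · exact h k hk
    · exact hasDerivWithinAt_const _ _ _
  have hX := htr x (fun j => x t (j + 1) + P.fAt j (x t)) hx
  have hΓ := htr G (fun j => G t (j + 1)) hG
  have key := (hdiff (trunc m i (x t), trunc m i (G t))).hasFDerivAt.comp_hasDerivWithinAt t
    (hX.prodMk hΓ)
  refine (key.congr (fun r _ => tau_eq_tauVec hi.le _ _) (tau_eq_tauVec hi.le _ _)).congr_deriv ?_
  have hsplit : ∀ a b : Fin m → ℝ, (a, b) = ∑ k : Fin m,
      (a k • ((Pi.single k 1, 0) : (Fin m → ℝ) × (Fin m → ℝ)) + b k • (0, Pi.single k 1)) :=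
          fun a b => by
    ext k
    · simp [Finset.sum_apply, Prod.fst_sum, Pi.single_apply]
    · simp [Finset.sum_apply, Prod.snd_sum, Pi.single_apply]
  unfold drift
  rw [hsplit (trunc m i fun j => x t (j + 1) + P.fAt j (x t)) (trunc m i fun j => G t (j + 1)),
    map_sum, sum_range_eq_sum_fin hi.le]
  refine Finset.sum_congr rfl fun k _ => ?_
  rw [map_add, map_smul, map_smul, smul_eq_mul, smul_eq_mul]
  simp only [trunc]
  split_ifs with hk
  · obtain ⟨e1, e2⟩ := drift_eq_fderiv (c := c) hf hi (x t) (G t) hk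
    rw [e1, e2]
    ring
  · ring

variable (P c) in
/-- The error variables `h_{i+1} = x_{i+1} - τ_i - Γ⁽ⁱ⁾` of the actuator ODE. -/
def actuatorError (x G : ℕ → ℝ) (i : ℕ) : ℝ := x i - P.tau c i x G - G i

theorem actuatorError_succ (x G : ℕ → ℝ) (i : ℕ) :
    P.actuatorError c x G (i + 1) = x (i + 1) + c i * P.actuatorError c x G i + P.fAt i x
      - P.drift (P.tau c i) i x G - G (i + 1) := by
  unfold actuatorError
  rw [tau_succ]
  ring

/-- In closed loop, the error variables of the actuator ODE form a stable chain. -/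
theorem hasDerivWithinAt_actuatorError
    (hf : ∀ k < m, ContDiff ℝ ((m - (k + 1) : ℕ) : ℕ∞) (P.f k)) {x G : ℝ → ℕ → ℝ} {s : Set ℝ}
    {t : ℝ}
    (hx : ∀ j, j + 1 < m → HasDerivWithinAt (fun t => x t j) (x t (j + 1) + P.fAt j (x t)) s t)
    (hxl : ∀ j, j + 1 = m → HasDerivWithinAt (fun t => x t j)
      (P.fAt j (x t) + P.tau c m (x t) (G t) + G t m) s t)
    (hG : ∀ j < m, HasDerivWithinAt (fun t => G t j) (G t (j + 1)) s t) {i : ℕ} (hi : i < m) :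
    HasDerivWithinAt (fun t => P.actuatorError c (x t) (G t) i)
      (-c i * P.actuatorError c (x t) (G t) i
        + if i + 1 = m then 0 else P.actuatorError c (x t) (G t) (i + 1)) s t := by
  have hτ := hasDerivWithinAt_tau (c := c) hf hi (fun j hj => hx j (by omega))
    (fun j hj => hG j (by omega))
  split_ifs with him
  · refine (((hxl i him).sub hτ).sub (hG i hi)).congr_deriv ?_
    have : P.tau c m (x t) (G t) = P.tau c (i + 1) (x t) (G t) := by rw [him]
    have hGm : G t m = G t (i + 1) := by rw [him]
    rw [this, hGm, tau_succ, actuatorError]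
    ring
  · refine (((hx i (by omega)).sub hτ).sub (hG i hi)).congr_deriv ?_
    rw [actuatorError_succ]
    ring

/-- The gain conditions make the initial values of all error variables positive. -/
theorem actuatorError_pos {x G : ℕ → ℝ} (hc : ∀ i, i + 1 < m → P.cCheck c x G i < c i)
    (h0 : G 0 < x 0) {i : ℕ} (hi : i < m) : 0 < P.actuatorError c x G i := by
  induction i with
  | zero => simpa [actuatorError, tau] using h0
  | succ i ih =>
    have hpos := ih (by omega)
    have hk := hc i hi
    rw [cCheck] at hk
    change 1 / P.actuatorError c x G i * _ < c i at hk
    rw [one_div_mul_eq_div, div_lt_iff₀ hpos] at hk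
    rw [actuatorError_succ]
    linarith

/-- The last error solves a homogeneous equation, and every other one is driven by its successor. -/
theorem error_chain_nonneg {h : ℕ → ℝ → ℝ}
    (hh : ∀ i < m, ∀ t, 0 ≤ t → HasDerivWithinAt (h i)
      (-c i * h i t + if i + 1 = m then 0 else h (i + 1) t) (Ici 0) t)
    (hini : ∀ i < m, 0 ≤ h i 0) {i : ℕ} (hi : i < m) {t : ℝ} (ht : 0 ≤ t) : 0 ≤ h i t := by
  obtain ⟨d, hd⟩ : ∃ d, d = m - 1 - i := ⟨_, rfl⟩
  induction d generalizing i t with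
  | zero =>
    refine nonneg_of_linear_ode (hh i hi) (fun s hs => ?_) (hini i hi) ht
    rw [if_pos (by omega)]
  | succ d ih =>
    refine nonneg_of_linear_ode (hh i hi) (fun s hs => ?_) (hini i hi) ht
    rw [if_neg (by omega)]
    exact ih (by omega) hs (by omega)

theorem error_chain_expDecay {h : ℕ → ℝ → ℝ} (hc : ∀ i < m, 0 < c i)
    (hh : ∀ i < m, ∀ t, 0 ≤ t → HasDerivWithinAt (h i)
      (-c i * h i t + if i + 1 = m then 0 else h (i + 1) t) (Ici 0) t)
    {i : ℕ} (hi : i < m) : ExpDecay (h i) := by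
  obtain ⟨d, hd⟩ : ∃ d, d = m - 1 - i := ⟨_, rfl⟩
  induction d generalizing i with
  | zero =>
    refine ExpDecay.of_linear_ode (hc i hi) (hh i hi) ?_
    simpa only [if_pos (show i + 1 = m by omega)] using expDecay_zero
  | succ d ih =>
    refine ExpDecay.of_linear_ode (hc i hi) (hh i hi) ?_
    simp only [if_neg (show ¬i + 1 = m by omega)]
    exact ih (by omega) (by omega)

/-! ### Decay of the actuator states -/

theorem expDecay_trunc {i : ℕ} {x G : ℝ → ℕ → ℝ} (hx : ∀ j < i, ExpDecay fun t => x t j)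
    (hG : ∀ j < i, ExpDecay fun t => G t j) :
    ExpDecay fun t => ‖((trunc m i (x t), trunc m i (G t)) : (Fin m → ℝ) × (Fin m → ℝ))‖ := by
  have h : ∀ a : ℝ → ℕ → ℝ, (∀ j < i, ExpDecay fun t => a t j) →
      ExpDecay fun t => ‖trunc m i (a t)‖ := fun a ha => ExpDecay.norm_pi fun k => by
    simp only [trunc]
    split_ifs with hk
    · exact ha k hk
    · exact expDecay_zero
  obtain ⟨σ, hσ, hb⟩ := (h x hx).add (h G hG)
  refine ⟨σ, hσ, Asymptotics.IsBigO.trans ?_ hb⟩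
  refine Asymptotics.IsBigO.of_bound 1 (Eventually.of_forall fun t => ?_)
  rw [one_mul, norm_norm, Real.norm_of_nonneg (by positivity)]
  exact max_le (le_add_of_nonneg_right (norm_nonneg _)) (le_add_of_nonneg_left (norm_nonneg _))

theorem tauVec_zero (hf0 : ∀ k < m, P.f k 0 = 0) {i : ℕ} (hi : i ≤ m) : P.tauVec c i 0 = 0 := by
  simp only [tauVec, Prod.fst_zero, Prod.snd_zero, extendZero_zero, tau_zero hf0 hi]

/-- For `i = m` there is no rate: `τ_m` need not be differentiable at the origin. -/
theorem tendsto_tau (hf : ∀ k < m, ContDiff ℝ ((m - (k + 1) : ℕ) : ℕ∞) (P.f k))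
    (hf0 : ∀ k < m, P.f k 0 = 0) {i : ℕ} (hi : i ≤ m) {x G : ℝ → ℕ → ℝ}
    (hx : ∀ j < i, ExpDecay fun t => x t j) (hG : ∀ j < i, ExpDecay fun t => G t j) :
    Tendsto (fun t => P.tau c i (x t) (G t)) atTop (𝓝 0) := by
  have h1 := (expDecay_trunc (m := m) hx hG).tendsto
  have h2 := (contDiff_tauVec (c := c) hf hi).continuous.tendsto 0
  rw [tauVec_zero hf0 hi] at h2
  exact (h2.comp (tendsto_zero_iff_norm_tendsto_zero.2 h1)).congr fun t =>
    (tau_eq_tauVec hi _ _).symm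

/-- For `i < m`, `τ_i` is differentiable and vanishes at the origin, so it is `O(|(x, G)|)`. -/
theorem expDecay_tau (hf : ∀ k < m, ContDiff ℝ ((m - (k + 1) : ℕ) : ℕ∞) (P.f k))
    (hf0 : ∀ k < m, P.f k 0 = 0) {i : ℕ} (hi : i < m) {x G : ℝ → ℕ → ℝ}
    (hx : ∀ j < i, ExpDecay fun t => x t j) (hG : ∀ j < i, ExpDecay fun t => G t j) :
    ExpDecay fun t => P.tau c i (x t) (G t) := by
  have h1 := expDecay_trunc (m := m) hx hG
  have hdiff : Differentiable ℝ (P.tauVec c i) := (contDiff_tauVec hf hi.le).differentiable (by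
      exact_mod_cast (by omega : m - i ≠ 0))
  have h2 := (hdiff 0).isBigO_sub
  rw [tauVec_zero hf0 hi.le] at h2
  simp only [sub_zero] at h2
  refine (h1.of_isBigO (h2.comp_tendsto (tendsto_zero_iff_norm_tendsto_zero.2 h1.tendsto))).congr
    (Eventually.of_forall fun t => ?_)
  exact (tau_eq_tauVec hi.le _ _).symm

/-- The actuator states decay when the error variables and the signals `Γ⁽ⁱ⁾` do. -/
theorem expDecay_of_actuatorError (hf : ∀ k < m, ContDiff ℝ ((m - (k + 1) : ℕ) : ℕ∞) (P.f k))
    (hf0 : ∀ k < m, P.f k 0 = 0) {x G : ℝ → ℕ → ℝ}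
    (he : ∀ i < m, ExpDecay fun t => P.actuatorError c (x t) (G t) i)
    (hG : ∀ j < m, ExpDecay fun t => G t j) {i : ℕ} (hi : i < m) : ExpDecay fun t => x t i := by
  induction i using Nat.strong_induction_on with
  | _ i ih =>
    have hτ := expDecay_tau (c := c) hf hf0 hi (fun j hj => ih j hj (hj.trans hi))
      fun j hj => hG j (hj.trans hi)
    refine (((he i hi).add hτ).add (hG i hi)).congr (Eventually.of_forall fun t => ?_)
    simp only [actuatorError]
    ring

theorem expDecay_fAt {k : ℕ} (hk : k < m)
    (hO : P.f k =O[𝓝 0] (fun x => x)) {x : ℝ → ℕ → ℝ} (hx : ∀ j < m, ExpDecay fun t => x t j) :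
    ExpDecay fun t => P.fAt k (x t) := by
  have h1 : ExpDecay fun t => ‖fun a : Fin (k + 1) => x t a‖ :=
    ExpDecay.norm_pi fun a => hx a (by omega)
  exact h1.of_isBigO (hO.comp_tendsto (tendsto_zero_iff_norm_tendsto_zero.2 h1.tendsto))

theorem isBigO_f (hf : ∀ k < m, ContDiff ℝ ((m - (k + 1) : ℕ) : ℕ∞) (P.f k))
    (hf0 : ∀ k < m, P.f k 0 = 0) {k : ℕ} (hk : k + 1 < m) : P.f k =O[𝓝 0] (fun x => x) := by
  have hdiff : Differentiable ℝ (P.f k) := (hf k (by omega)).differentiable (by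
    exact_mod_cast (by omega : m - (k + 1) ≠ 0))
  have := (hdiff 0).isBigO_sub
  rw [hf0 k (by omega)] at this
  simpa only [sub_zero] using this

/-- The partial derivatives of `τ_i` stay bounded near the origin. -/
theorem expDecay_drift (hf : ∀ k < m, ContDiff ℝ ((m - (k + 1) : ℕ) : ℕ∞) (P.f k))
    (hf0 : ∀ k < m, P.f k 0 = 0) {i : ℕ} (hi : i < m) {x G : ℝ → ℕ → ℝ}
    (hx : ∀ j < m, ExpDecay fun t => x t j) (hG : ∀ j < m, ExpDecay fun t => G t j) :
    ExpDecay fun t => P.drift (P.tau c i) i (x t) (G t) := by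
  have h1 := expDecay_trunc (m := m) (i := i) (fun j hj => hx j (hj.trans hi))
    fun j hj => hG j (hj.trans hi)
  have h0 := tendsto_zero_iff_norm_tendsto_zero.2 h1.tendsto
  have hbd : ∀ e, (fun t => fderiv ℝ (P.tauVec c i) (trunc m i (x t), trunc m i (G t)) e)
      =O[atTop] fun _ => (1 : ℝ) := fun e => by
    have hc : Continuous fun v => fderiv ℝ (P.tauVec c i) v e :=
      ((contDiff_tauVec hf hi.le).continuous_fderiv (by
        exact_mod_cast (by omega : m - i ≠ 0))).clm_apply continuous_const
    exact ((hc.tendsto 0).comp h0).isBigO_one ℝ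
  unfold drift
  refine ExpDecay.sum fun j hj => ?_
  have hj' := Finset.mem_range.1 hj
  simp only [(drift_eq_fderiv (c := c) hf hi _ _ hj').1, (drift_eq_fderiv (c := c) hf hi _ _ hj').2]
  exact (((hx _ (by omega)).add (expDecay_fAt (by omega)
    (isBigO_f hf hf0 (by omega)) hx)).bounded_mul (hbd _)).add
    ((hG _ (by omega)).bounded_mul (hbd _))

/-- The full virtual control `τ_m` decays exponentially if the last nonlinearity is `O(|x|)`. -/
theorem expDecay_tau_last (hf : ∀ k < m, ContDiff ℝ ((m - (k + 1) : ℕ) : ℕ∞) (P.f k))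
    (hf0 : ∀ k < m, P.f k 0 = 0) (hm : 1 ≤ m) (hO : P.f (m - 1) =O[𝓝 0] (fun x => x))
    {x G : ℝ → ℕ → ℝ} (hx : ∀ j < m, ExpDecay fun t => x t j)
    (hG : ∀ j < m, ExpDecay fun t => G t j) :
    ExpDecay fun t => P.tau c m (x t) (G t) := by
  obtain ⟨N, rfl⟩ : ∃ N, m = N + 1 := ⟨m - 1, by omega⟩
  have hτ := expDecay_tau (c := c) hf hf0 (show N < N + 1 by omega) (fun j hj => hx j (by omega))
    (fun j hj => hG j (by omega))
  have hd := expDecay_drift (c := c) hf hf0 (show N < N + 1 by omega) hx hG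
  have hF := expDecay_fAt (show N < N + 1 by omega) hO hx
  exact ((((((hx N (by omega)).sub hτ).sub (hG N (by omega))).const_mul (-c N)).sub hF).add hd)

end Plant

/-! ### Transport as an evolution in space -/

theorem integral_exp_affine {a k s lam : ℝ} (hk : k ≠ 0) :
    ∫ r in (0 : ℝ)..s, lam * Real.exp (a + k * r)
      = lam * ((Real.exp (a + k * s) - Real.exp a) / k) := by
  have h : ∀ r ∈ uIcc 0 s, HasDerivAt (fun r => Real.exp (a + k * r) / k)
      (Real.exp (a + k * r)) r :=
    fun r _ => by
      have := ((((hasDerivAt_id r).const_mul k).const_add a).exp).div_const k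
      refine this.congr_deriv ?_
      simp only [id]
      field_simp
  rw [intervalIntegral.integral_const_mul, intervalIntegral.integral_eq_sub_of_hasDerivAt h
    (Continuous.intervalIntegrable (by fun_prop) _ _)]
  simp only [mul_zero, add_zero]
  ring

namespace Plant

variable {n m : ℕ} {P : Plant n m} {z w : ℝ → ℝ → ℝ}

/-- The transport subsystem, read as an evolution in `x`, is bounded by its values at `x = 0`: the
values at `(x₀, t₀)` depend only on those of `w(0,·)` on `[t₀ - 1/q₁, t₀ + 1/q₂]`. -/
theorem TransportPair.bound_of_boundary (h : P.TransportPair z w) (hq₁ : 0 < P.q₁)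
    (hq₂ : 0 < P.q₂) :
    ∃ C : ℝ, 0 ≤ C ∧ ∀ x₀ ∈ Icc (0 : ℝ) 1, ∀ t₀ E : ℝ, 1 / P.q₁ ≤ t₀ →
      (∀ t ∈ Icc (t₀ - 1 / P.q₁) (t₀ + 1 / P.q₂), |w 0 t| ≤ E) →
      |z x₀ t₀| + |w x₀ t₀| ≤ C * E := by
  set μ : ℝ := 2 * (|P.d₁| / P.q₁ + |P.d₂| / P.q₂) + 1 with hμ
  have hμ0 : 0 < μ := by positivity
  refine ⟨Real.exp μ * (2 * (|P.p| + 1)), by positivity, fun x₀ hx₀ t₀ E ht₀ hE => ?_⟩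
  -- the backward and forward characteristics through `(x₀, t₀)` bound the domain of dependence
  set D : Set (ℝ × ℝ) := {v | v.1 ∈ Icc 0 x₀ ∧
    t₀ - (x₀ - v.1) / P.q₁ ≤ v.2 ∧ v.2 ≤ t₀ + (x₀ - v.1) / P.q₂} with hD
  have hdiv : ∀ {q x y : ℝ}, 0 < q → x ≤ y → x / q ≤ y / q := fun hq hxy =>
    div_le_div_of_nonneg_right hxy hq.le
  have hDbox : D ⊆ Icc (0 : ℝ) 1 ×ˢ Icc (t₀ - 1 / P.q₁) (t₀ + 1 / P.q₂) := fun v hv => by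
    obtain ⟨⟨h0, h1⟩, h2, h3⟩ := hv
    have e1 := hdiv hq₁ (show x₀ - v.1 ≤ 1 by linarith [hx₀.2])
    have e2 := hdiv hq₂ (show x₀ - v.1 ≤ 1 by linarith [hx₀.2])
    exact ⟨⟨h0, h1.trans hx₀.2⟩, by linarith, by linarith⟩
  have hDclosed : IsClosed D := by
    have c1 : Continuous fun v : ℝ × ℝ => t₀ - (x₀ - v.1) / P.q₁ := by fun_prop
    have c2 : Continuous fun v : ℝ × ℝ => t₀ + (x₀ - v.1) / P.q₂ := by fun_prop
    exact (isClosed_Icc.preimage continuous_fst).inter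
      ((isClosed_le c1 continuous_snd).inter (isClosed_le continuous_snd c2))
  have hDcompact : IsCompact D :=
      (isCompact_Icc.prod isCompact_Icc).of_isClosed_subset hDclosed hDbox
  have hDdom : D ⊆ Icc (0 : ℝ) 1 ×ˢ Ici 0 := fun v hv =>
    ⟨(hDbox hv).1, mem_Ici.2 (le_trans (by linarith) (hDbox hv).2.1)⟩
  have hmem₀ : (x₀, t₀) ∈ D := by
    refine ⟨⟨hx₀.1, le_rfl⟩, ?_, ?_⟩ <;> simp
  set φ : ℝ × ℝ → ℝ := fun v => Real.exp (-μ * v.1) * (|z v.1 v.2| + |w v.1 v.2|) with hφ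
  have hφc : ContinuousOn φ D := by
    have h1 := (h.z_cont.mono hDdom).abs
    have h2 := (h.w_cont.mono hDdom).abs
    exact ContinuousOn.mul (by fun_prop) (h1.add h2)
  obtain ⟨v, hv, hmax⟩ := hDcompact.exists_isMaxOn ⟨_, hmem₀⟩ hφc
  set M := φ v with hM
  have hM0 : 0 ≤ M := mul_nonneg (Real.exp_pos _).le (by positivity)
  have hbound : ∀ a ∈ D, |z a.1 a.2| + |w a.1 a.2| ≤ M * Real.exp (μ * a.1) := fun a ha => by
    have h1 : φ a ≤ M := hmax ha
    have h2 : |z a.1 a.2| + |w a.1 a.2| = φ a * Real.exp (μ * a.1) := by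
      simp only [hφ]
      rw [mul_right_comm, ← Real.exp_add]
      simp
    rw [h2]
    exact mul_le_mul_of_nonneg_right h1 (Real.exp_pos _).le
  -- the two integral equations, from `x = 0` to the maximum point
  obtain ⟨x, t⟩ := v
  obtain ⟨⟨hx0, hxx⟩, htl, htu⟩ := hv
  simp only at hx0 hxx htl htu
  have hx1 : x ≤ 1 := hxx.trans hx₀.2
  have e0 : (x₀ - x) / P.q₁ + x / P.q₁ = x₀ / P.q₁ := by ring
  have e0' : (x₀ - x) / P.q₂ + x / P.q₂ = x₀ / P.q₂ := by ring
  have hxq1 : 0 ≤ x / P.q₁ := div_nonneg hx0 hq₁.le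
  have hxq2 : 0 ≤ x / P.q₂ := div_nonneg hx0 hq₂.le
  have hrq1 : 0 ≤ (x₀ - x) / P.q₁ := div_nonneg (by linarith) hq₁.le
  have hrq2 : 0 ≤ (x₀ - x) / P.q₂ := div_nonneg (by linarith) hq₂.le
  have hx₀1 := hdiv hq₁ hx₀.2
  have hx₀2 := hdiv hq₂ hx₀.2
  have hz : |z x t| ≤ |P.p| * E + M * Real.exp (μ * x) * (|P.d₁| / P.q₁ / μ) := by
    have heq := h.pde_z 0 (t - x / P.q₁) (x / P.q₁) le_rfl (by linarith) hxq1
      (by rw [mul_div_cancel₀ _ hq₁.ne']; linarith)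
    rw [mul_div_cancel₀ _ hq₁.ne', zero_add, sub_add_cancel, h.bc_zero _ (by linarith)] at heq
    have hw0 := hE (t - x / P.q₁) ⟨by linarith, by linarith⟩
    have hint : ‖∫ r in (0 : ℝ)..(x / P.q₁), P.d₁ * w (0 + P.q₁ * r) (t - x / P.q₁ + r)‖
        ≤ ∫ r in (0 : ℝ)..(x / P.q₁), |P.d₁| * M * Real.exp (0 + μ * P.q₁ * r) := by
      refine intervalIntegral.norm_integral_le_of_norm_le hxq1 (Eventually.of_forall fun r hr => ?_)
        (Continuous.intervalIntegrable (by fun_prop) _ _)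
      have hr1 : P.q₁ * r ≤ x := by
        have := mul_le_mul_of_nonneg_left hr.2 hq₁.le
        rwa [mul_div_cancel₀ _ hq₁.ne'] at this
      have er : P.q₁ * r / P.q₁ = r := mul_div_cancel_left₀ _ hq₁.ne'
      have hm : (P.q₁ * r, t - x / P.q₁ + r) ∈ D := by
        refine ⟨⟨mul_nonneg hq₁.le hr.1.le, hr1.trans hxx⟩, ?_, ?_⟩
        · simp only [sub_div, er]
          rw [sub_div] at htl
          linarith
        · have := hdiv hq₂ (show x₀ - x ≤ x₀ - P.q₁ * r by linarith)
          simp only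
          linarith [hr.2]
      have := hbound _ hm
      simp only at this
      rw [zero_add, zero_add, Real.norm_eq_abs, abs_mul, mul_assoc |P.d₁|, mul_assoc μ]
      exact mul_le_mul_of_nonneg_left (by linarith [abs_nonneg (z (P.q₁ * r) (t - x / P.q₁ + r))])
        (abs_nonneg _)
    rw [integral_exp_affine (by positivity), zero_add, Real.exp_zero, mul_assoc μ,
      mul_div_cancel₀ _ hq₁.ne'] at hint
    have hle : |P.d₁| * M * ((Real.exp (μ * x) - 1) / (μ * P.q₁))
        ≤ M * Real.exp (μ * x) * (|P.d₁| / P.q₁ / μ) := by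
      have : M * Real.exp (μ * x) * (|P.d₁| / P.q₁ / μ)
          = |P.d₁| * M * (Real.exp (μ * x) / (μ * P.q₁)) := by field_simp
      rw [this]
      have : (Real.exp (μ * x) - 1) / (μ * P.q₁) ≤ Real.exp (μ * x) / (μ * P.q₁) :=
        div_le_div_of_nonneg_right (by linarith) (by positivity)
      gcongr
    rw [heq]
    refine (abs_add_le _ _).trans (add_le_add ?_ (hint.trans hle))
    rw [abs_mul]
    exact mul_le_mul_of_nonneg_left hw0 (abs_nonneg _)
  have hw : |w x t| ≤ E + M * Real.exp (μ * x) * (|P.d₂| / P.q₂ / μ) := by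
    have heq := h.pde_w x t (x / P.q₂) hx1 (by linarith) hxq2
      (by rw [mul_div_cancel₀ _ hq₂.ne', sub_self])
    rw [mul_div_cancel₀ _ hq₂.ne', sub_self] at heq
    have hw0 := hE (t + x / P.q₂) ⟨by linarith, by linarith⟩
    have hint : ‖∫ r in (0 : ℝ)..(x / P.q₂), P.d₂ * z (x - P.q₂ * r) (t + r)‖
        ≤ ∫ r in (0 : ℝ)..(x / P.q₂), |P.d₂| * M * Real.exp (μ * x + -(μ * P.q₂) * r) := by
      refine intervalIntegral.norm_integral_le_of_norm_le hxq2 (Eventually.of_forall fun r hr => ?_)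
        (Continuous.intervalIntegrable (by fun_prop) _ _)
      have hr1 : P.q₂ * r ≤ x := by
        have := mul_le_mul_of_nonneg_left hr.2 hq₂.le
        rwa [mul_div_cancel₀ _ hq₂.ne'] at this
      have hr0 : 0 ≤ P.q₂ * r := mul_nonneg hq₂.le hr.1.le
      have er : (x₀ - (x - P.q₂ * r)) / P.q₂ = (x₀ - x) / P.q₂ + r := by field_simp; ring
      have hm : (x - P.q₂ * r, t + r) ∈ D := by
        refine ⟨⟨by simp only; linarith, by simp only; linarith⟩, ?_, ?_⟩
        · have := hdiv hq₁ (show x₀ - x ≤ x₀ - (x - P.q₂ * r) by linarith)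
          simp only
          linarith [hr.1]
        · simp only [er]
          linarith
      have := hbound _ hm
      simp only at this
      rw [Real.norm_eq_abs, abs_mul, mul_assoc |P.d₂|,
        show μ * x + -(μ * P.q₂) * r = μ * (x - P.q₂ * r) by ring]
      exact mul_le_mul_of_nonneg_left (by linarith [abs_nonneg (w (x - P.q₂ * r) (t + r))])
        (abs_nonneg _)
    rw [integral_exp_affine (neg_ne_zero.2 (by positivity)),
      show -(μ * P.q₂) * (x / P.q₂) = -(μ * x) by field_simp, add_neg_cancel, Real.exp_zero] at hint
    have hle : |P.d₂| * M * ((1 - Real.exp (μ * x)) / -(μ * P.q₂))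
        ≤ M * Real.exp (μ * x) * (|P.d₂| / P.q₂ / μ) := by
      have : M * Real.exp (μ * x) * (|P.d₂| / P.q₂ / μ)
          = |P.d₂| * M * (Real.exp (μ * x) / (μ * P.q₂)) := by field_simp
      rw [this, div_neg, ← neg_div, neg_sub]
      have : (Real.exp (μ * x) - 1) / (μ * P.q₂) ≤ Real.exp (μ * x) / (μ * P.q₂) :=
        div_le_div_of_nonneg_right (by linarith) (by positivity)
      gcongr
    have hw' : w x t = w 0 (t + x / P.q₂)
        - ∫ r in (0 : ℝ)..(x / P.q₂), P.d₂ * z (x - P.q₂ * r) (t + r) := by linarith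
    rw [hw']
    exact (abs_sub _ _).trans (add_le_add hw0 (hint.trans hle))
  -- the weight `μ` makes the integral terms a contraction
  have hE0 : 0 ≤ E := (abs_nonneg _).trans
    (hE t₀ ⟨by linarith [div_nonneg zero_le_one hq₁.le],
        by linarith [div_nonneg zero_le_one hq₂.le]⟩)
  have hhalf : |P.d₁| / P.q₁ / μ + |P.d₂| / P.q₂ / μ ≤ 1 / 2 := by
    rw [← add_div, div_le_iff₀ hμ0, hμ]
    linarith
  have hMle : M ≤ (|P.p| + 1) * E + M * (1 / 2) := by
    have h1 : M = Real.exp (-μ * x) * (|z x t| + |w x t|) := rfl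
    have h2 : Real.exp (-μ * x) * Real.exp (μ * x) = 1 := by rw [← Real.exp_add]; simp
    have h3 : Real.exp (-μ * x) ≤ 1 := Real.exp_le_one_iff.2 (by nlinarith)
    calc M = Real.exp (-μ * x) * (|z x t| + |w x t|) := h1
      _ ≤ Real.exp (-μ * x) * ((|P.p| * E + M * Real.exp (μ * x) * (|P.d₁| / P.q₁ / μ))
          + (E + M * Real.exp (μ * x) * (|P.d₂| / P.q₂ / μ))) := by gcongr
      _ = Real.exp (-μ * x) * ((|P.p| + 1) * E)
          + M * (|P.d₁| / P.q₁ / μ + |P.d₂| / P.q₂ / μ) := by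
        linear_combination (M * (|P.d₁| / P.q₁ / μ + |P.d₂| / P.q₂ / μ)) * h2
      _ ≤ 1 * ((|P.p| + 1) * E) + M * (1 / 2) := by gcongr
      _ = _ := by ring
  have hfin := hbound _ hmem₀
  simp only at hfin
  have h4 : Real.exp (μ * x₀) ≤ Real.exp μ := Real.exp_le_exp.2 (by nlinarith [hx₀.2])
  calc |z x₀ t₀| + |w x₀ t₀| ≤ M * Real.exp (μ * x₀) := hfin
    _ ≤ (2 * ((|P.p| + 1) * E)) * Real.exp μ := by gcongr; linarith
    _ = _ := by ring

/-- Exponential decay of a transport state, uniformly in `x ∈ [0,1]`. -/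
def UniformExpDecay (f : ℝ → ℝ → ℝ) : Prop :=
  ∃ σ C b : ℝ, 0 < σ ∧ 0 < C ∧ ∀ t, b ≤ t → ∀ x ∈ Icc (0 : ℝ) 1, |f x t| ≤ C * Real.exp (-σ * t)

theorem UniformExpDecay.expDecay {f : ℝ → ℝ → ℝ} (h : UniformExpDecay f) {x : ℝ}
    (hx : x ∈ Icc (0 : ℝ) 1) : ExpDecay (f x) := by
  obtain ⟨σ, C, b, hσ, hC, h⟩ := h
  exact expDecay_iff.2 ⟨σ, C, b, hσ, hC, fun t ht => h t ht x hx⟩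

/-- Integrals of a uniformly decaying state against bounded kernels decay. -/
theorem UniformExpDecay.expDecay_integral {f g : ℝ → ℝ → ℝ} (h : UniformExpDecay f) {M b' : ℝ}
    (hg : ∀ t, b' ≤ t → ∀ x ∈ Icc (0 : ℝ) 1, |g x t| ≤ M) :
    ExpDecay fun t => ∫ y in (0 : ℝ)..1, g y t * f y t := by
  obtain ⟨σ, C, b, hσ, hC, h⟩ := h
  refine expDecay_iff.2 ⟨σ, (|M| + 1) * C, max b b', hσ, by positivity, fun t ht => ?_⟩
  have := intervalIntegral.norm_integral_le_of_norm_le_const (a := 0) (b := 1)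
    (f := fun y => g y t * f y t) (C := (|M| + 1) * C * Real.exp (-σ * t)) fun y hy => ?_
  · simpa using this
  · rw [uIoc_of_le zero_le_one] at hy
    have hy' : y ∈ Icc (0 : ℝ) 1 := ⟨hy.1.le, hy.2⟩
    rw [norm_mul, mul_assoc]
    refine mul_le_mul ?_ (h t ((le_max_left _ _).trans ht) y hy') (norm_nonneg _) (by positivity)
    exact (hg t ((le_max_right _ _).trans ht) y hy').trans ((le_abs_self M).trans (by linarith))

/-- Decay of `w(0,·)` spreads to the whole transport subsystem. -/
theorem TransportPair.uniformExpDecay (h : P.TransportPair z w) (hq₁ : 0 < P.q₁) (hq₂ : 0 < P.q₂)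
    (h0 : ExpDecay (w 0)) : UniformExpDecay z ∧ UniformExpDecay w := by
  obtain ⟨C, hC, hb⟩ := h.bound_of_boundary hq₁ hq₂
  obtain ⟨σ, D, b, hσ, hD, hw⟩ := expDecay_iff.1 h0
  have key : ∀ t, max (1 / P.q₁) (b + 1 / P.q₁) ≤ t → ∀ x ∈ Icc (0 : ℝ) 1,
      |z x t| + |w x t| ≤ ((C + 1) * (D * Real.exp (σ / P.q₁))) * Real.exp (-σ * t) :=
    fun t ht x hx => by
      refine (hb x hx t (D * Real.exp (-σ * (t - 1 / P.q₁))) ((le_max_left _ _).trans ht)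
        fun s hs => ?_).trans ?_
      · have hbs : b ≤ s := by linarith [(le_max_right (1 / P.q₁) (b + 1 / P.q₁)).trans ht, hs.1]
        refine (hw s hbs).trans ?_
        have : Real.exp (-σ * s) ≤ Real.exp (-σ * (t - 1 / P.q₁)) :=
          Real.exp_le_exp.2 (by nlinarith [hs.1])
        gcongr
      · rw [show -σ * (t - 1 / P.q₁) = σ / P.q₁ + -σ * t by ring, Real.exp_add]
        have : 0 ≤ D * (Real.exp (σ / P.q₁) * Real.exp (-σ * t)) := by positivity
        nlinarith
  refine ⟨⟨σ, _, _, hσ, ?_, fun t ht x hx => le_trans ?_ (key t ht x hx)⟩,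
    ⟨σ, _, _, hσ, ?_, fun t ht x hx => le_trans ?_ (key t ht x hx)⟩⟩
  · positivity
  · linarith [abs_nonneg (w x t)]
  · positivity
  · linarith [abs_nonneg (z x t)]

end Plant

/-! ### Decay of time derivatives along linear systems -/

/-- Along a solution of a linear system on `(T, ∞)`, the time derivatives of a linear output are
linear outputs. -/
theorem timeDeriv_eq_of_linear {E : Type*} [NormedAddCommGroup E] [NormedSpace ℝ E]
    {V : ℝ → E} {N : E →L[ℝ] E} {φ : E →L[ℝ] ℝ} {u : ℝ → ℝ} {T : ℝ} (hT : 0 ≤ T)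
    (hV : ∀ t, T < t → HasDerivAt V (N (V t)) t) (hu : ∀ t, T < t → u t = φ (V t)) (j : ℕ) :
    ∀ t, T < t → Plant.timeDeriv j u t = φ ((N ^ j) (V t)) := by
  induction j with
  | zero =>
    intro t ht
    rw [Plant.timeDeriv_zero, hu t ht]
    rfl
  | succ j ih =>
    intro t ht
    have heq : Plant.timeDeriv j u =ᶠ[𝓝 t] fun s => φ ((N ^ j) (V s)) :=
      Filter.mem_of_superset (Ioi_mem_nhds ht) ih
    have hd : HasDerivAt (fun s => φ ((N ^ j) (V s))) (φ ((N ^ j) (N (V t)))) t :=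
      (φ.comp (N ^ j)).hasFDerivAt.comp_hasDerivAt t (hV t ht)
    rw [Plant.timeDeriv_succ, (hd.congr_of_eventuallyEq heq).hasDerivWithinAt.derivWithin
      (uniqueDiffOn_Ici 0 t (hT.trans ht.le)), pow_succ]
    rfl

namespace Plant

variable {n m : ℕ} {P : Plant n m}

open Matrix

/-- The state matrix of the distal ODE under the nominal feedback, coupled to the chain of actuator
errors; the error after the last one is `0`. -/
def targetMap (P : Plant n m) (κ c : ℕ → ℝ) :
    (Fin n → ℝ) × (Fin m → ℝ) →ₗ[ℝ] (Fin n → ℝ) × (Fin m → ℝ) where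
  toFun v := (P.A *ᵥ v.1 + (P.K κ ⬝ᵥ v.1 + extendZero v.2 0) • P.B,
    fun k => -c k * v.2 k + extendZero v.2 (k + 1))
  map_add' v v' := by
    have h : ∀ k, extendZero (v.2 + v'.2) k = extendZero v.2 k + extendZero v'.2 k := fun k => by
      unfold extendZero; split_ifs <;> simp
    refine Prod.ext ?_ (funext fun k => ?_)
    · simp only [h, Prod.fst_add, Prod.snd_add, mulVec_add, dotProduct_add, add_smul]
      abel
    · simp only [h, Prod.snd_add, Pi.add_apply]
      ring
  map_smul' a v := by
    have h : ∀ k, extendZero (a • v.2) k = a * extendZero v.2 k := fun k => by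
      unfold extendZero; split_ifs <;> simp
    refine Prod.ext ?_ (funext fun k => ?_)
    · simp only [h, Prod.smul_fst, Prod.smul_snd, mulVec_smul, dotProduct_smul, RingHom.id_apply,
        smul_add,
        smul_smul, mul_add, smul_eq_mul]
    · simp only [h, Prod.smul_snd, Pi.smul_apply, RingHom.id_apply, smul_eq_mul]
      ring

/-- If the distal ODE is driven by the nominal feedback plus the first error of a stable chain,
all time derivatives of its input decay as soon as its state does. -/
theorem expDecay_timeDeriv_input {κ c : ℕ → ℝ} {Y : ℝ → Fin n → ℝ} {u : ℝ → ℝ} {e : ℕ → ℝ → ℝ}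
    {T : ℝ} (hm : 1 ≤ m) (hT : 0 ≤ T)
    (hY : ∀ t, T < t → HasDerivAt Y (P.A *ᵥ (Y t) + u t • P.B) t)
    (hu : ∀ t, T < t → u t = P.K κ ⬝ᵥ Y t + e 0 t)
    (he : ∀ i < m, ∀ t, T < t →
      HasDerivAt (e i) (-c i * e i t + if i + 1 = m then 0 else e (i + 1) t) t)
    (hYd : ∀ i, ExpDecay fun t => Y t i) (hed : ∀ i < m, ExpDecay (e i)) (j : ℕ) :
    ExpDecay (timeDeriv j u) := by
  set V : ℝ → (Fin n → ℝ) × (Fin m → ℝ) := fun t => (Y t, fun k => e k t) with hVdef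
  set N := LinearMap.toContinuousLinearMap (P.targetMap κ c) with hN
  set φ : (Fin n → ℝ) × (Fin m → ℝ) →L[ℝ] ℝ := LinearMap.toContinuousLinearMap
    ((dotProductBilin ℝ ℝ (P.K κ)).comp (LinearMap.fst ℝ (Fin n → ℝ) (Fin m → ℝ)) +
      (LinearMap.proj ⟨0, hm⟩).comp (LinearMap.snd ℝ (Fin n → ℝ) (Fin m → ℝ))) with hφ
  have he0 : ∀ t, extendZero (V t).2 0 = e 0 t := fun t => extendZero_of_lt _ hm
  have hV : ∀ t, T < t → HasDerivAt V (N (V t)) t := fun t ht => by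
    refine HasDerivAt.prodMk ?_ (hasDerivAt_pi.2 fun k => ?_)
    · rw [he0, ← hu t ht]
      exact hY t ht
    · refine (he k k.2 t ht).congr_deriv ?_
      split_ifs with hk
      · rw [extendZero_of_ge _ hk.ge]
      · rw [extendZero_of_lt _ (show (k : ℕ) + 1 < m by omega)]
  have hφV : ∀ t, T < t → u t = φ (V t) := fun t ht => hu t ht
  have hnorm : ExpDecay fun t => ‖V t‖ := by
    have h1 := (ExpDecay.norm_pi hYd).add
      (ExpDecay.norm_pi (V := fun t (k : Fin m) => e k t) fun k => hed k k.2)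
    obtain ⟨σ, hσ, hb⟩ := h1
    refine ⟨σ, hσ, Asymptotics.IsBigO.trans (Asymptotics.isBigO_of_le _ fun t => ?_) hb⟩
    rw [norm_norm, Prod.norm_def, Real.norm_of_nonneg (by positivity)]
    exact max_le_add_of_nonneg (norm_nonneg _) (norm_nonneg _)
  have hO : timeDeriv j u =O[atTop] V := by
    have h1 : (fun t => (φ.comp (N ^ j)) (V t)) =O[atTop] V :=
      (φ.comp (N ^ j)).isBigO_comp V atTop
    refine h1.congr' ?_ EventuallyEq.rfl
    filter_upwards [eventually_gt_atTop T] with t ht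
    exact (timeDeriv_eq_of_linear hT hV hφV j t ht).symm
  exact hnorm.of_isBigO hO

/-! ### Solutions of the closed loop -/

variable {U : ℝ → ℝ} {z₀ w₀ : ℝ → ℝ} {X₀ : Fin m → ℝ} {Y₀ : Fin n → ℝ} {z w : ℝ → ℝ → ℝ}
  {X : ℝ → Fin m → ℝ} {Y : ℝ → Fin n → ℝ} {κ c : ℕ → ℝ}

theorem IsSolution.transportPair (h : P.IsSolution U z₀ w₀ X₀ Y₀ z w X Y) : P.TransportPair z w :=
  ⟨h.z_reg.continuousOn, h.w_reg.continuousOn, h.pde_z, h.pde_w, h.bc_zero⟩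

theorem IsSolution.contDiffOn_z (h : P.IsSolution U z₀ w₀ X₀ Y₀ z w X Y) :
    ContDiffOn ℝ (m - 1 : ℕ) (fun a : ℝ × ℝ => z a.1 a.2) (Icc 0 1 ×ˢ Ici 0) := h.z_reg

theorem IsSolution.contDiffOn_w (h : P.IsSolution U z₀ w₀ X₀ Y₀ z w X Y) :
    ContDiffOn ℝ (m - 1 : ℕ) (fun a : ℝ × ℝ => w a.1 a.2) (Icc 0 1 ×ˢ Ici 0) := h.w_reg

theorem IsSolution.hasDerivWithinAt_Gamma (h : P.IsSolution U z₀ w₀ X₀ Y₀ z w X Y) (hq₁ : 0 < P.q₁)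
    (hq₂ : 0 < P.q₂) (κ : ℕ → ℝ) {i : ℕ} (hi : i < m) {t : ℝ} (ht : 0 ≤ t) :
    HasDerivWithinAt (P.Gamma κ z w Y i) (P.Gamma κ z w Y (i + 1) t) (Ici 0) t :=
  h.transportPair.hasDerivWithinAt_Gamma hq₁ hq₂ κ h.contDiffOn_z h.contDiffOn_w h.ode_Y
    (by omega) ht

theorem IsSolution.Gamma_zero_zero (h : P.IsSolution U z₀ w₀ X₀ Y₀ z w X Y) (κ : ℕ → ℝ) :
    P.Gamma κ z w Y 0 0 = P.Gamma0 κ z₀ w₀ Y₀ := by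
  have hz : ∫ y in (0 : ℝ)..1, P.Psi κ 1 y * z y 0 = ∫ y in (0 : ℝ)..1, P.Psi κ 1 y * z₀ y :=
    intervalIntegral.integral_congr fun y hy => by
      rw [uIcc_of_le zero_le_one] at hy
      simp only [h.z_init y hy]
  have hw : ∫ y in (0 : ℝ)..1, P.Phi κ 1 y * w y 0 = ∫ y in (0 : ℝ)..1, P.Phi κ 1 y * w₀ y :=
    intervalIntegral.integral_congr fun y hy => by
      rw [uIcc_of_le zero_le_one] at hy
      simp only [h.w_init y hy]
  simp [Gamma, Gamma0, RP, hz, hw, h.Y_init]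

/-- The errors `h_{i+1}` of the actuator ODE along a trajectory. -/
def loopError (P : Plant n m) (κ c : ℕ → ℝ) (z w : ℝ → ℝ → ℝ) (X : ℝ → Fin m → ℝ)
    (Y : ℝ → Fin n → ℝ) (i : ℕ) (t : ℝ) : ℝ :=
  P.actuatorError c (extendZero (X t)) (fun k => P.Gamma κ z w Y k t) i

/-- In closed loop the actuator errors form an autonomous chain. -/
theorem IsSolution.hasDerivWithinAt_loopError
    (h : P.IsSolution (P.control κ c z w X Y) z₀ w₀ X₀ Y₀ z w X Y) (hq₁ : 0 < P.q₁)
    (hq₂ : 0 < P.q₂) (hf : ∀ k < m, ContDiff ℝ ((m - (k + 1) : ℕ) : ℕ∞) (P.f k))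
    {i : ℕ} (hi : i < m) {t : ℝ} (ht : 0 ≤ t) :
    HasDerivWithinAt (P.loopError κ c z w X Y i) (-c i * P.loopError κ c z w X Y i t
      + if i + 1 = m then 0 else P.loopError κ c z w X Y (i + 1) t) (Ici 0) t := by
  refine hasDerivWithinAt_actuatorError (x := fun t => extendZero (X t))
    (G := fun t k => P.Gamma κ z w Y k t) hf (fun j hj => ?_) (fun j hj => ?_)
    (fun j hj => h.hasDerivWithinAt_Gamma hq₁ hq₂ κ hj ht) hi
  · simp only [extendZero_of_lt (X _) (show j < m by omega)]
    exact h.ode_X ⟨j, by omega⟩ hj t ht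
  · simp only [extendZero_of_lt (X _) (show j < m by omega)]
    refine (h.ode_X_last ⟨j, by omega⟩ hj t ht).congr_deriv ?_
    simp only [control]
    ring

theorem IsSolution.loopError_zero (h : P.IsSolution U z₀ w₀ X₀ Y₀ z w X Y) {t : ℝ} (ht : 0 ≤ t) :
    P.loopError κ c z w X Y 0 t = w 1 t - P.Gamma κ z w Y 0 t := by
  rw [h.bc_one t ht]
  simp [loopError, actuatorError, tau]

/-- After the transport delay `1/q₂`, the distal ODE receives the nominal feedback plus the delayed
first actuator error. -/
theorem IsSolution.w_zero_eq (h : P.IsSolution U z₀ w₀ X₀ Y₀ z w X Y) (hq₁ : 0 < P.q₁)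
    (hq₂ : 0 < P.q₂) (κ c : ℕ → ℝ) {t : ℝ} (ht : 1 / P.q₂ ≤ t) :
    w 0 t = P.K κ ⬝ᵥ Y t + P.loopError κ c z w X Y 0 (t - 1 / P.q₂) := by
  have ht' : 0 ≤ t - 1 / P.q₂ := sub_nonneg.2 ht
  have := h.transportPair.w_zero_eq_feedback hq₁ hq₂ κ h.ode_Y ht'
  rwa [sub_add_cancel, ← h.loopError_zero (c := c) ht'] at this

theorem IsSolution.hasDerivWithinAt_Y (h : P.IsSolution U z₀ w₀ X₀ Y₀ z w X Y) {T : ℝ}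
    (hT : 0 ≤ T) :
    ∀ t, T ≤ t → HasDerivWithinAt Y (P.A *ᵥ (Y t) + w 0 t • P.B) (Ici T) t := fun t ht =>
  (h.ode_Y t (hT.trans ht)).mono (Ici_subset_Ici.2 hT)

/-- Up to time `1/q₂` the output is given by `Π`; afterwards it is the first error of a chain with
positive initial values and nonnegative input. -/
theorem IsSolution.safety
    (h : P.IsSolution (P.control κ c z w X Y) z₀ w₀ X₀ Y₀ z w X Y)
    (hn : 1 ≤ n) (hm : 1 ≤ m) (hq₁ : 0 < P.q₁) (hq₂ : 0 < P.q₂) (hb : 0 < P.b)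
    (hf : ∀ k < m, ContDiff ℝ ((m - (k + 1) : ℕ) : ℕ∞) (P.f k))
    (hY₀ : 0 ≤ Y₀ ⟨0, hn⟩) (hPi : ∀ ς ∈ Ioo (0 : ℝ) 1, 0 ≤ P.PiVec z₀ w₀ Y₀ ς ⟨0, hn⟩)
    (hPi1 : 0 < P.PiVec z₀ w₀ Y₀ 1 ⟨0, hn⟩)
    (hκ : ∀ i, i + 1 < n → P.kappaCheck κ z₀ w₀ Y₀ i < κ i)
    (hX₀ : P.Gamma0 κ z₀ w₀ Y₀ < X₀ ⟨0, hm⟩)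
    (hc : ∀ i, i + 1 < m →
      P.cCheck c (extendZero X₀) (fun k => P.Gamma κ z w Y k 0) i < c i)
    {t : ℝ} (ht : 0 ≤ t) : 0 ≤ Y t ⟨0, hn⟩ := by
  have hT : 0 < 1 / P.q₂ := one_div_pos.2 hq₂
  have hPiv : ∀ ς ∈ Icc (0 : ℝ) 1, Y (ς / P.q₂) = P.PiVec z₀ w₀ Y₀ ς := fun ς hς => by
    rw [h.transportPair.Y_eq_PiVec hq₁ hq₂ h.z_init h.w_init h.ode_Y hς, h.Y_init]
  rcases le_total t (1 / P.q₂) with htT | htT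
  · have hς : P.q₂ * t ≤ 1 := by
      have := mul_le_mul_of_nonneg_left htT hq₂.le
      rwa [mul_one_div_cancel hq₂.ne'] at this
    have heq := hPiv (P.q₂ * t) ⟨mul_nonneg hq₂.le ht, hς⟩
    rw [mul_div_cancel_left₀ _ hq₂.ne'] at heq
    rcases ht.eq_or_lt with rfl | ht0
    · rw [h.Y_init]
      exact hY₀
    · rw [heq]
      rcases hς.eq_or_lt with h1 | h1
      · rw [h1]
        exact hPi1.le
      · exact hPi _ ⟨mul_pos hq₂ ht0, h1⟩
  · have hYT : Y (1 / P.q₂) = P.YArrival z₀ w₀ Y₀ := by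
      rw [h.transportPair.Y_eq_YArrival hq₁ hq₂ h.z_init h.w_init h.ode_Y, h.Y_init]
    have hpos : 0 < P.YArrival z₀ w₀ Y₀ ⟨0, hn⟩ := by
      rw [← hYT, hPiv 1 ⟨zero_le_one, le_rfl⟩]
      exact hPi1
    have herr : ∀ s, 1 / P.q₂ ≤ s → 0 ≤ P.loopError κ c z w X Y 0 (s - 1 / P.q₂) := fun s hs =>
      error_chain_nonneg (m := m) (fun i hi s hs => h.hasDerivWithinAt_loopError hq₁ hq₂ hf hi hs)
        (fun i hi => by
          rw [loopError, h.X_init]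
          refine (actuatorError_pos hc ?_ hi).le
          rw [h.Gamma_zero_zero, extendZero_of_lt _ hm]
          exact hX₀) hm (sub_nonneg.2 hs)
    have := distalError_nonneg hb (h.hasDerivWithinAt_Y hT.le)
      (fun s hs => h.w_zero_eq hq₁ hq₂ κ c hs) herr
      (fun i hi => by rw [hYT]; exact distalError_pos hn hκ hpos hi) hn htT
    simpa [distalError, gCoef, extendZero_of_lt _ hn] using this

/-! ### Decay of the closed-loop signals -/

theorem IsSolution.expDecay_loopError
    (h : P.IsSolution (P.control κ c z w X Y) z₀ w₀ X₀ Y₀ z w X Y) (hq₁ : 0 < P.q₁)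
    (hq₂ : 0 < P.q₂) (hf : ∀ k < m, ContDiff ℝ ((m - (k + 1) : ℕ) : ℕ∞) (P.f k))
    (hc : ∀ i < m, 0 < c i) {i : ℕ} (hi : i < m) : ExpDecay (P.loopError κ c z w X Y i) :=
  error_chain_expDecay hc (fun _ hi _ ht => h.hasDerivWithinAt_loopError hq₁ hq₂ hf hi ht) hi

/-- The errors of the distal ODE are driven by the delayed first actuator error. -/
theorem IsSolution.expDecay_Y
    (h : P.IsSolution (P.control κ c z w X Y) z₀ w₀ X₀ Y₀ z w X Y) (hm : 1 ≤ m) (hq₁ : 0 < P.q₁)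
    (hq₂ : 0 < P.q₂) (hb : 0 < P.b)
    (hf : ∀ k < m, ContDiff ℝ ((m - (k + 1) : ℕ) : ℕ∞) (P.f k))
    (hκ : ∀ i < n, 0 < κ i) (hc : ∀ i < m, 0 < c i) (i : Fin n) : ExpDecay fun t => Y t i :=
  expDecay_of_distalError (fun _ hi => expDecay_distalError hb hκ
    (h.hasDerivWithinAt_Y (one_div_pos.2 hq₂).le) (fun _ hs => h.w_zero_eq hq₁ hq₂ κ c hs)
    ((h.expDecay_loopError hq₁ hq₂ hf hc hm).comp_sub _) hi) i

/-- All time derivatives of the input of the distal ODE decay. -/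
theorem IsSolution.expDecay_timeDeriv_w_zero
    (h : P.IsSolution (P.control κ c z w X Y) z₀ w₀ X₀ Y₀ z w X Y) (hm : 1 ≤ m) (hq₁ : 0 < P.q₁)
    (hq₂ : 0 < P.q₂) (hb : 0 < P.b)
    (hf : ∀ k < m, ContDiff ℝ ((m - (k + 1) : ℕ) : ℕ∞) (P.f k))
    (hκ : ∀ i < n, 0 < κ i) (hc : ∀ i < m, 0 < c i) (j : ℕ) : ExpDecay (timeDeriv j (w 0)) := by
  have hT : 0 < 1 / P.q₂ := one_div_pos.2 hq₂
  refine expDecay_timeDeriv_input (κ := κ) (c := c)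
    (e := fun i t => P.loopError κ c z w X Y i (t - 1 / P.q₂)) hm hT.le
    (fun t ht => (h.ode_Y t (hT.trans ht).le).hasDerivAt (Ici_mem_nhds (hT.trans ht)))
    (fun t ht => h.w_zero_eq hq₁ hq₂ κ c ht.le) (fun i hi t ht => ?_)
    (h.expDecay_Y hm hq₁ hq₂ hb hf hκ hc)
    (fun i hi => (h.expDecay_loopError hq₁ hq₂ hf hc hi).comp_sub _) j
  have ht' : 0 < t - 1 / P.q₂ := sub_pos.2 ht
  exact ((h.hasDerivWithinAt_loopError hq₁ hq₂ hf hi ht'.le).hasDerivAt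
    (Ici_mem_nhds ht')).comp_sub_const t _

theorem IsSolution.uniformExpDecay_timeDeriv
    (h : P.IsSolution (P.control κ c z w X Y) z₀ w₀ X₀ Y₀ z w X Y) (hm : 1 ≤ m) (hq₁ : 0 < P.q₁)
    (hq₂ : 0 < P.q₂) (hb : 0 < P.b)
    (hf : ∀ k < m, ContDiff ℝ ((m - (k + 1) : ℕ) : ℕ∞) (P.f k))
    (hκ : ∀ i < n, 0 < κ i) (hc : ∀ i < m, 0 < c i) {j : ℕ} (hj : j < m) :
    UniformExpDecay (fun x => timeDeriv j (z x)) ∧ UniformExpDecay (fun x => timeDeriv j (w x)) :=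
  (h.transportPair.iterated_timeDeriv hq₁ hq₂ h.contDiffOn_z h.contDiffOn_w j
    (by omega)).uniformExpDecay hq₁ hq₂ (h.expDecay_timeDeriv_w_zero hm hq₁ hq₂ hb hf hκ hc j)

theorem IsSolution.uniformExpDecay
    (h : P.IsSolution (P.control κ c z w X Y) z₀ w₀ X₀ Y₀ z w X Y) (hm : 1 ≤ m) (hq₁ : 0 < P.q₁)
    (hq₂ : 0 < P.q₂) (hb : 0 < P.b)
    (hf : ∀ k < m, ContDiff ℝ ((m - (k + 1) : ℕ) : ℕ∞) (P.f k))
    (hκ : ∀ i < n, 0 < κ i) (hc : ∀ i < m, 0 < c i) : UniformExpDecay z ∧ UniformExpDecay w := by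
  have h0 : ∀ s : ℝ → ℝ, timeDeriv 0 s = s := fun s => funext fun t => by rw [timeDeriv_zero]
  simpa only [h0] using h.uniformExpDecay_timeDeriv hm hq₁ hq₂ hb hf hκ hc hm

theorem expDecay_dotProduct {k : ℕ} {V : ℝ → Fin k → ℝ} (hV : ∀ i, ExpDecay fun t => V t i)
    (a : Fin k → ℝ) : ExpDecay fun t => a ⬝ᵥ V t :=
  ExpDecay.sum fun i _ => (hV i).const_mul (a i)

theorem IsSolution.expDecay_Gamma
    (h : P.IsSolution (P.control κ c z w X Y) z₀ w₀ X₀ Y₀ z w X Y) (hm : 1 ≤ m) (hq₁ : 0 < P.q₁)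
    (hq₂ : 0 < P.q₂) (hb : 0 < P.b)
    (hf : ∀ k < m, ContDiff ℝ ((m - (k + 1) : ℕ) : ℕ∞) (P.f k))
    (hκ : ∀ i < n, 0 < κ i) (hc : ∀ i < m, 0 < c i) {i : ℕ} (hi : i ≤ m) :
    ExpDecay (P.Gamma κ z w Y i) := by
  have h0 : (0 : ℝ) ∈ Icc (0 : ℝ) 1 := by simp
  have h1 : (1 : ℝ) ∈ Icc (0 : ℝ) 1 := by simp
  have hd := fun {j : ℕ} (hj : j ∈ Finset.range i) =>
    h.uniformExpDecay_timeDeriv hm hq₁ hq₂ hb hf hκ hc ((Finset.mem_range.1 hj).trans_le hi)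
  have hbd : ∀ g : ℝ → ℝ, Continuous g → ∃ M, ∀ t : ℝ, 0 ≤ t → ∀ x ∈ Icc (0 : ℝ) 1, |g x| ≤ M :=
    fun g hg => by
      obtain ⟨M, hM⟩ := (isCompact_Icc (a := (0 : ℝ)) (b := 1)).exists_bound_of_continuousOn
        hg.continuousOn
      exact ⟨M, fun _ _ => hM⟩
  obtain ⟨M₁, hM₁⟩ := hbd _ (P.contDiff_RP κ i).1.continuous
  obtain ⟨M₂, hM₂⟩ := hbd _ (P.contDiff_RP κ i).2.continuous
  have hzw := h.uniformExpDecay hm hq₁ hq₂ hb hf hκ hc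
  have hY : ExpDecay fun t => P.lam κ 1 ⬝ᵥ ((P.A ^ i) *ᵥ Y t) := by
    simp only [dotProduct_mulVec]
    exact expDecay_dotProduct (h.expDecay_Y hm hq₁ hq₂ hb hf hκ hc) _
  exact ((((((ExpDecay.sum fun j hj => ((hd hj).1.expDecay h1).const_mul _).neg.add
    (ExpDecay.sum fun j hj => ((hd hj).1.expDecay h0).const_mul _)).add
    (hzw.1.expDecay_integral hM₁)).add
    (ExpDecay.sum fun j hj => ((hd hj).2.expDecay h1).const_mul _)).sub
    (ExpDecay.sum fun j hj => ((hd hj).2.expDecay h0).const_mul _)).add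
    (hzw.2.expDecay_integral hM₂)).add hY

theorem IsSolution.expDecay_X
    (h : P.IsSolution (P.control κ c z w X Y) z₀ w₀ X₀ Y₀ z w X Y) (hm : 1 ≤ m) (hq₁ : 0 < P.q₁)
    (hq₂ : 0 < P.q₂) (hb : 0 < P.b)
    (hf : ∀ k < m, ContDiff ℝ ((m - (k + 1) : ℕ) : ℕ∞) (P.f k)) (hf0 : ∀ k < m, P.f k 0 = 0)
    (hκ : ∀ i < n, 0 < κ i) (hc : ∀ i < m, 0 < c i) {i : ℕ} (hi : i < m) :
    ExpDecay fun t => extendZero (X t) i :=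
  expDecay_of_actuatorError (x := fun t => extendZero (X t))
    (G := fun t k => P.Gamma κ z w Y k t) hf hf0
    (fun _ hi => h.expDecay_loopError hq₁ hq₂ hf hc hi)
    (fun _ hj => h.expDecay_Gamma hm hq₁ hq₂ hb hf hκ hc hj.le) hi

/-- The part of the control law that is linear in the plant states decays. -/
theorem IsSolution.expDecay_control_sub_tau
    (h : P.IsSolution (P.control κ c z w X Y) z₀ w₀ X₀ Y₀ z w X Y) (hm : 1 ≤ m) (hq₁ : 0 < P.q₁)
    (hq₂ : 0 < P.q₂) (hb : 0 < P.b)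
    (hf : ∀ k < m, ContDiff ℝ ((m - (k + 1) : ℕ) : ℕ∞) (P.f k))
    (hκ : ∀ i < n, 0 < κ i) (hc : ∀ i < m, 0 < c i) :
    ExpDecay fun t => P.control κ c z w X Y t
      - P.tau c m (extendZero (X t)) (fun i => P.Gamma κ z w Y i t) := by
  have h1 : (1 : ℝ) ∈ Icc (0 : ℝ) 1 := by simp
  have hs : ExpDecay fun t => ∑ i : Fin m, P.qbar i * timeDeriv i (z 1) t :=
    ExpDecay.sum fun i _ =>
      ((h.uniformExpDecay_timeDeriv hm hq₁ hq₂ hb hf hκ hc i.2).1.expDecay h1).const_mul _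
  refine (((h.expDecay_Gamma hm hq₁ hq₂ hb hf hκ hc le_rfl).sub hs).sub
    (expDecay_dotProduct (h.expDecay_Y hm hq₁ hq₂ hb hf hκ hc) P.M)).congr
    (Eventually.of_forall fun t => ?_)
  simp only [control]
  ring

/-! ### Continuity of the closed-loop signals -/

theorem IsSolution.continuousOn_Y (h : P.IsSolution U z₀ w₀ X₀ Y₀ z w X Y) :
    ContinuousOn Y (Ici 0) := fun t ht => (h.ode_Y t ht).continuousWithinAt

theorem IsSolution.continuousOn_X (h : P.IsSolution U z₀ w₀ X₀ Y₀ z w X Y) :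
    ContinuousOn X (Ici 0) := continuousOn_pi.2 fun j t ht => by
  rcases (show (j : ℕ) + 1 < m ∨ (j : ℕ) + 1 = m by omega) with hj | hj
  · exact (h.ode_X j hj t ht).continuousWithinAt
  · exact (h.ode_X_last j hj t ht).continuousWithinAt

theorem continuousOn_timeDeriv {f : ℝ → ℝ → ℝ} {N j : ℕ}
    (hf : ContDiffOn ℝ N (fun a : ℝ × ℝ => f a.1 a.2) (Icc 0 1 ×ˢ Ici 0)) (hj : j ≤ N) {x : ℝ}
    (hx : x ∈ Icc (0 : ℝ) 1) : ContinuousOn (timeDeriv j (f x)) (Ici 0) :=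
  (contDiffOn_timeDeriv hf j hj).continuousOn.comp (f := fun t => (x, t)) (by fun_prop)
    fun _ ht => ⟨hx, ht⟩

theorem IsSolution.continuousOn_Gamma (h : P.IsSolution U z₀ w₀ X₀ Y₀ z w X Y) (hq₁ : 0 < P.q₁)
    (hq₂ : 0 < P.q₂) (κ : ℕ → ℝ) {i : ℕ} (hi : i ≤ m) :
    ContinuousOn (P.Gamma κ z w Y i) (Ici 0) := by
  have h0 : (0 : ℝ) ∈ Icc (0 : ℝ) 1 := by simp
  have h1 : (1 : ℝ) ∈ Icc (0 : ℝ) 1 := by simp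
  have hs : ∀ (f : ℝ → ℝ → ℝ), ContDiffOn ℝ (m - 1 : ℕ) (fun a : ℝ × ℝ => f a.1 a.2)
      (Icc 0 1 ×ˢ Ici 0) → ∀ x ∈ Icc (0 : ℝ) 1, ∀ a : ℕ → ℝ,
      ContinuousOn (fun t => ∑ j ∈ Finset.range i, a j * timeDeriv j (f x) t) (Ici 0) :=
    fun f hf x hx a => continuousOn_finsetSum _ fun j hj => continuousOn_const.mul
      (continuousOn_timeDeriv hf (by have := Finset.mem_range.1 hj; omega) hx)
  have hRP := P.contDiff_RP κ i
  have hIz : ContinuousOn (fun t => ∫ y in (0 : ℝ)..1, (P.RP κ i).1 y * z y t) (Ici 0) :=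
    fun t ht => (h.transportPair.hasDerivWithinAt_integral_z hq₁ hq₂
      (hRP.1.of_le (by exact_mod_cast le_top)) ht).continuousWithinAt
  have hIw : ContinuousOn (fun t => ∫ y in (0 : ℝ)..1, (P.RP κ i).2 y * w y t) (Ici 0) :=
    fun t ht => (h.transportPair.hasDerivWithinAt_integral_w hq₁ hq₂
      (hRP.2.of_le (by exact_mod_cast le_top)) ht).continuousWithinAt
  have hY : ContinuousOn (fun t => P.lam κ 1 ⬝ᵥ ((P.A ^ i) *ᵥ Y t)) (Ici 0) := by
    have : Continuous fun v : Fin n → ℝ => P.lam κ 1 ⬝ᵥ ((P.A ^ i) *ᵥ v) := by fun_prop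
    exact this.comp_continuousOn h.continuousOn_Y
  exact ((((((hs z h.contDiffOn_z 1 h1 _).neg.add (hs z h.contDiffOn_z 0 h0 _)).add hIz).add
    (hs w h.contDiffOn_w 1 h1 _)).sub (hs w h.contDiffOn_w 0 h0 _)).add hIw).add hY

theorem IsSolution.continuousOn_control (h : P.IsSolution U z₀ w₀ X₀ Y₀ z w X Y) (hm : 1 ≤ m)
    (hq₁ : 0 < P.q₁) (hq₂ : 0 < P.q₂)
    (hf : ∀ k < m, ContDiff ℝ ((m - (k + 1) : ℕ) : ℕ∞) (P.f k)) :
    ContinuousOn (P.control κ c z w X Y) (Ici 0) := by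
  have htau : ContinuousOn
      (fun t => P.tau c m (extendZero (X t)) fun i => P.Gamma κ z w Y i t) (Ici 0) := by
    simp only [tau_eq_tauVec le_rfl]
    refine (contDiff_tauVec hf le_rfl).continuous.comp_continuousOn
      (ContinuousOn.prodMk (continuousOn_pi.2 fun k => ?_) (continuousOn_pi.2 fun k => ?_))
    · simp only [trunc, k.2, if_true, extendZero_fin]
      exact (continuous_apply k).comp_continuousOn h.continuousOn_X
    · simp only [trunc, k.2, if_true]
      exact h.continuousOn_Gamma hq₁ hq₂ κ k.2.le
  have hs : ContinuousOn (fun t => ∑ i : Fin m, P.qbar i * timeDeriv i (z 1) t) (Ici 0) :=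
    continuousOn_finsetSum _ fun i _ => continuousOn_const.mul
      (continuousOn_timeDeriv h.contDiffOn_z (by omega) (by simp))
  have hM : ContinuousOn (fun t => P.M ⬝ᵥ Y t) (Ici 0) := by
    have : Continuous fun v : Fin n → ℝ => P.M ⬝ᵥ v := by fun_prop
    exact this.comp_continuousOn h.continuousOn_Y
  exact ((htau.sub hs).sub hM).add (h.continuousOn_Gamma hq₁ hq₂ κ le_rfl)

theorem continuousOn_integral_sq {f : ℝ → ℝ → ℝ}
    (hf : ContinuousOn (Function.uncurry f) (Icc 0 1 ×ˢ Ici 0)) :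
    ContinuousOn (fun t => ∫ x in (0 : ℝ)..1, f x t ^ 2) (Ici 0) := by
  -- `F` is a continuous extension to the plane
  set F : ℝ → ℝ → ℝ := fun t x => f (max 0 (min 1 x)) (max 0 t) ^ 2 with hF
  have hFc : Continuous (Function.uncurry F) := by
    have : Continuous fun v : ℝ × ℝ => Function.uncurry f (max 0 (min 1 v.2), max 0 v.1) :=
      hf.comp_continuous (by fun_prop) fun v =>
        ⟨⟨le_max_left _ _, max_le zero_le_one (min_le_left _ _)⟩, mem_Ici.2 (le_max_left _ _)⟩
    exact this.pow 2
  refine (intervalIntegral.continuous_parametric_intervalIntegral_of_continuous' hFc 0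
    1).continuousOn.congr fun t ht => intervalIntegral.integral_congr fun x hx => ?_
  rw [uIcc_of_le zero_le_one] at hx
  simp only [hF, min_eq_right hx.2, max_eq_right hx.1, max_eq_right (mem_Ici.1 ht)]

theorem UniformExpDecay.expDecay_integral_sq {f : ℝ → ℝ → ℝ} (hf : UniformExpDecay f) :
    ExpDecay fun t => ∫ x in (0 : ℝ)..1, f x t ^ 2 := by
  obtain ⟨σ, C, b, hσ, hC, h⟩ := hf
  simp only [pow_two]
  refine UniformExpDecay.expDecay_integral ⟨σ, C, b, hσ, hC, h⟩ (M := C) (b' := max b 0)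
    fun t ht x hx => (h t ((le_max_left _ _).trans ht) x hx).trans ?_
  have : 0 ≤ t := (le_max_right _ _).trans ht
  exact mul_le_of_le_one_right hC.le (Real.exp_le_one_iff.2 (by nlinarith))

end Plant

theorem theorem1 {n m : ℕ} (hn : 1 ≤ n) (hm : 1 ≤ m) (P : Plant n m)
    (hq₁ : 0 < P.q₁) (hq₂ : 0 < P.q₂) (hb : 0 < P.b)
    -- the nonlinearities: `f_{k+1}` is of class `C^{m-(k+1)}` and vanishes at the origin
    (hf : ∀ k < m, ContDiff ℝ ((m - (k + 1) : ℕ) : ℕ∞) (P.f k))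
    (hf0 : ∀ k < m, P.f k 0 = 0)
    -- initial data
    (z₀ w₀ : ℝ → ℝ) (X₀ : Fin m → ℝ) (Y₀ : Fin n → ℝ)
    (hz₀ : ContDiffOn ℝ ((m - 1 : ℕ) : ℕ∞) z₀ (Icc 0 1))
    (hw₀ : ContDiffOn ℝ ((m - 1 : ℕ) : ℕ∞) w₀ (Icc 0 1))
    -- safety before the control action arrives at the distal ODE
    (hY₀ : 0 ≤ Y₀ ⟨0, hn⟩)
    (hPi : ∀ ς ∈ Ioo (0 : ℝ) 1, 0 ≤ P.PiVec z₀ w₀ Y₀ ς ⟨0, hn⟩)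
    (hPi1 : 0 < P.PiVec z₀ w₀ Y₀ 1 ⟨0, hn⟩)
    -- the gains `κ_1, …, κ_n` and `c_1, …, c_m`
    (κ c : ℕ → ℝ)
    (hκ_pos : ∀ i < n, 0 < κ i)
    (hκ : ∀ i, i + 1 < n → P.kappaCheck κ z₀ w₀ Y₀ i < κ i)
    -- the initial value of the actuator state
    (hX₀ : P.Gamma0 κ z₀ w₀ Y₀ < X₀ ⟨0, hm⟩)
    -- a solution of the closed loop
    (z w : ℝ → ℝ → ℝ) (X : ℝ → Fin m → ℝ) (Y : ℝ → Fin n → ℝ)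
    (hsol : P.IsSolution (P.control κ c z w X Y) z₀ w₀ X₀ Y₀ z w X Y)
    (hc : ∀ i, i + 1 < m →
      max 2 (P.cCheck c (extendZero X₀) (fun k => P.Gamma κ z w Y k 0) i) < c i)
    (hc_last : 1 < c (m - 1)) :
    -- 1) safety
    (∀ t, 0 ≤ t → 0 ≤ Y t ⟨0, hn⟩) ∧
    -- 2) exponential regulation
    (∃ C σ : ℝ, 0 < σ ∧ ∀ t, 0 ≤ t →
      (∫ x in (0 : ℝ)..1, w x t ^ 2) + (∫ x in (0 : ℝ)..1, z x t ^ 2)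
        + (∑ i, X t i ^ 2) + (∑ i, Y t i ^ 2) ≤ C * Real.exp (-σ * t)) ∧
    -- 3) the control input converges to zero, exponentially if `f_m(x) = O(|x|)` near the origin
    Tendsto (P.control κ c z w X Y) atTop (𝓝 0) ∧
    (P.f (m - 1) =O[𝓝 0] (fun x => x) →
      ∃ C σ : ℝ, 0 < σ ∧ ∀ t, 0 ≤ t →
        |P.control κ c z w X Y t| ≤ C * Real.exp (-σ * t)) := by
  have hc0 : ∀ i < m, 0 < c i := fun i hi => by
    rcases (show i + 1 < m ∨ i = m - 1 by omega) with h | rfl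
    · exact lt_trans two_pos ((le_max_left _ _).trans_lt (hc i h))
    · exact one_pos.trans hc_last
  have hX := fun {i : ℕ} (hi : i < m) =>
    hsol.expDecay_X hm hq₁ hq₂ hb hf hf0 hκ_pos hc0 hi
  have hΓ := fun {i : ℕ} (hi : i < m) =>
    hsol.expDecay_Gamma hm hq₁ hq₂ hb hf hκ_pos hc0 hi.le
  have hY := hsol.expDecay_Y hm hq₁ hq₂ hb hf hκ_pos hc0
  have hzw := hsol.uniformExpDecay hm hq₁ hq₂ hb hf hκ_pos hc0
  have hU := hsol.expDecay_control_sub_tau hm hq₁ hq₂ hb hf hκ_pos hc0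
  refine ⟨fun t ht => hsol.safety hn hm hq₁ hq₂ hb hf hY₀ hPi hPi1 hκ hX₀
    (fun i hi => (le_max_right _ _).trans_lt (hc i hi)) ht, ?_, ?_, fun hO => ?_⟩
  · have hXs : ExpDecay fun t => ∑ i, X t i ^ 2 := ExpDecay.sum fun i _ => by
      have := hX i.2
      simp only [extendZero_fin] at this
      simpa only [pow_two] using this.mul this
    have hYs : ExpDecay fun t => ∑ i, Y t i ^ 2 := ExpDecay.sum fun i _ => by
      simpa only [pow_two] using (hY i).mul (hY i)
    have hcont : ContinuousOn (fun t => (∫ x in (0 : ℝ)..1, w x t ^ 2)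
        + (∫ x in (0 : ℝ)..1, z x t ^ 2) + (∑ i, X t i ^ 2) + (∑ i, Y t i ^ 2)) (Ici 0) := by
      have h1 : Continuous fun v : Fin m → ℝ => ∑ i, v i ^ 2 := by fun_prop
      have h2 : Continuous fun v : Fin n → ℝ => ∑ i, v i ^ 2 := by fun_prop
      exact (((Plant.continuousOn_integral_sq hsol.transportPair.w_cont).add
        (Plant.continuousOn_integral_sq hsol.transportPair.z_cont)).add
        (h1.comp_continuousOn hsol.continuousOn_X)).add
        (h2.comp_continuousOn hsol.continuousOn_Y)
    obtain ⟨C, σ, hσ, hC⟩ := (((hzw.2.expDecay_integral_sq.add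
      hzw.1.expDecay_integral_sq).add hXs).add hYs).exists_bound hcont
    exact ⟨C, σ, hσ, fun t ht => (le_abs_self _).trans (hC t ht)⟩
  · have := hU.tendsto.add (Plant.tendsto_tau (c := c) (x := fun t => extendZero (X t))
      (G := fun t k => P.Gamma κ z w Y k t) hf hf0 le_rfl (fun _ hj => hX hj) fun _ hj => hΓ hj)
    simpa only [sub_add_cancel, add_zero] using this
  · have := hU.add (Plant.expDecay_tau_last (c := c) (x := fun t => extendZero (X t))
      (G := fun t k => P.Gamma κ z w Y k t) hf hf0 hm hO (fun _ hj => hX hj) fun _ hj => hΓ hj)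
    simp only [sub_add_cancel] at this
    exact this.exists_bound (hsol.continuousOn_control hm hq₁ hq₂ hf)

end
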